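/- **Diagrams.** A diagram is a finite graph with vertices of degree $3$ and $1$ (up to isomorphism; closed circles without vertices are allowed as additional components), with a cyclic order of the half-edges at each trivalent vertex. Its univalent vertices (legs) are totally ordered from left to right along an orienting line, and each leg is of one of the following kinds: $\bot$ (grade $1$), $\mathrm F$ (grade $2$), the parameter legs $a$ (grade $2$) and $b$ (grade $1$), and the operator legs $\partial_a$ (grade $2$) and $\partial_b$ (grade $1$). The type of a diagram is the pair $(i,j)$, where $i$ is the total grade of its parameter legs and $j$ that of its operator legs. The product $\#$ is juxtaposition along the orienting line. **Spaces.** $\widehat{\mathcal W}_{\mathrm F}[a,b]^{(i,j)}$ and $\widehat{\mathcal W}_\wedge[a,b]^{(i,j)}$ are the $\mathbb Q$-vector spaces of formal combinations of diagrams of type $(i,j)$ modulo the following relations. In both spaces: AS; IHX; a parameter or operator leg may be exchanged with any adjacent leg, with the sign $(-1)^{gh}$, where $g,h$ are the grades of the two legs; adjacent $\mathrm F$-legs satisfy the STU relation (a diagram minus the diagram in which the two legs are exchanged equals the diagram in which they are joined to a trivalent vertex whose third edge ends in one $\mathrm F$-leg); adjacent $\mathrm F$- and $\bot$-legs commute.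 For two adjacent $\bot$-legs, the sum of a diagram and of the diagram in which the two legs are exchanged equals, in $\widehat{\mathcal W}_{\mathrm F}$, the diagram in which the two legs are glued to each other, and, in $\widehat{\mathcal W}_\wedge$, zero. (As the operator legs can be moved to the far right, it makes no difference whether they are required to stand there.) Put $\widehat{\mathcal W}_{\mathrm F}[[a,b]]=\prod_{i,j\ge 0}\widehat{\mathcal W}_{\mathrm F}[a,b]^{(i,j)}$ and similarly for $\widehat{\mathcal W}_\wedge[[a,b]]$. The product $\#$ extends to these power series, and $\exp_\#(x)=\sum_{n\ge0}\frac1{n!}x^{\#n}$, where $x^{\#0}$ is the empty diagram. A sum of power series converges if for each type $(i,j)$ only finitely many summands have a nonzero part of type $(i,j)$. **The map $\lambda$.** A pairing of a diagram $D$ is a (possibly empty) set $\wp$ of disjoint two-element sets of $\bot$-legs of $D$. Let $D_\wp$ be $D$ with the two legs of every pair glued to each other. Join the legs of each pair by an arc below the orienting line and carry all other legs straight down; let $x(\wp)$ be the number of crossings of an arc with another arc or with the line of an unpaired leg of grade $1$. Set $\mathcal D_\wp(D)=(-1)^{x(\wp)}\left(\tfrac12\right)^{|\wp|}D_\wp\in\widehat{\mathcal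 W}_\wedge[[a,b]]$. **Terms.** Let $A$ be $\tfrac12$ times the tripod with the legs $a,\bot,\bot$ (in this order on the line, which is also their cyclic order around the vertex), and let $B$ be the single edge with the legs $b,\bot$ (in this order). Let $\mathcal T$ be the set of pairs $\tau=(w,\wp)$ of a nonempty word $w$ in the symbols $A,B$ and a pairing $\wp$ of the $\bot$-legs of the diagram obtained by juxtaposing the diagrams of the letters of $w$; put $|\tau|=|w|$, and let $T_\tau\in\widehat{\mathcal W}_\wedge[[a,b]]$ be the term $\mathcal D_\wp$ of this diagram, multiplied by the factor $\tfrac12$ for each letter $A$ of $w$. Let $\mathcal T_{\mathcal C}\subset\mathcal T$ be the set of those $\tau$ for which the graph underlying $T_\tau$ is connected (the orienting line being ignored). **Theorem.** There is exactly one type-preserving map $\lambda:\widehat{\mathcal W}_{\mathrm F}[[a,b]]\to\widehat{\mathcal W}_\wedge[[a,b]]$ that acts on each type separately and linearly and satisfies $\lambda(D)=\sum_{\wp}\mathcal D_\wp(D)$ for every diagram $D$, the sum being over all pairings of $D$. The series $\exp_\#(A+B)$, $\sum_{\tau\in\mathcal T_{\mathcal C}}\frac1{|\tau|!}T_\tau$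 and the exponential of the latter converge, and in $\widehat{\mathcal W}_\wedge[[a,b]]$ $$\lambda\bigl(\exp_\#(A+B)\bigr)=\exp_\#\Bigl(\sum_{\tau\in\mathcal T_{\mathcal C}}\frac{1}{|\tau|!}\,T_\tau\Bigr).$$ -/

import Mathlib

noncomputable section

namespace Weil

open Relation

/-! ## Diagrams -/

/-- The kinds of degree-one vertices: the two usual kinds (grade one legs `bot`, curvature legs
`curv`), the parameter legs `a`, `b`, and the operator legs `da`, `db`. -/
inductive Leg
  | bot | curv | a | b | da | db
  deriving DecidableEq

namespace Leg

/-- The grade of a leg. -/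
def grade : Leg → ℕ
  | bot => 1 | curv => 2 | a => 2 | b => 1 | da => 2 | db => 1

/-- The contribution of a leg to the parameter-grade of a diagram. -/
def paramGrade : Leg → ℕ
  | a => 2 | b => 1 | _ => 0

/-- The contribution of a leg to the operator-grade of a diagram. -/
def opGrade : Leg → ℕ
  | da => 2 | db => 1 | _ => 0

/-- The legs labelled by one of the formal symbols. -/
def IsFormal (x : Leg) : Prop := x ≠ bot ∧ x ≠ curv

end Leg

/-- A finite graph with vertices of degree one and three. The half-edges at the trivalent vertex
`v` are `(v, 0)`, `(v, 1)`, `(v, 2)`, in this cyclic order; the degree-one vertices (legs) are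
labelled and linearly ordered (from left to right along the orienting line). `att` sends a
half-edge at a trivalent vertex, or a leg, to the edge it is an end of. An edge has two ends, or
none if it is a closed circle (such circles can arise when legs are glued). -/
structure Diagram : Type 1 where
  V : Type
  L : Type
  E : Type
  [finV : Finite V]
  [finL : Finite L]
  [finE : Finite E]
  [ordL : LinearOrder L]
  label : L → Leg
  att : (V × Fin 3) ⊕ L → E
  ends : ∀ e, Nat.card {h // att h = e} = 2 ∨ Nat.card {h // att h = e} = 0

attribute [instance] Diagram.finV Diagram.finL Diagram.finE Diagram.ordL

/-- Isomorphisms of diagrams: they preserve the labels and the order of the legs, and the cyclic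
orders at the trivalent vertices. -/
structure Diagram.Iso (D D' : Diagram) where
  onV : D.V ≃ D'.V
  rot : D.V → Fin 3
  onL : D.L ≃o D'.L
  onE : D.E ≃ D'.E
  label_eq : ∀ l, D'.label (onL l) = D.label l
  att_vertex : ∀ v k, D'.att (Sum.inl (onV v, k + rot v)) = onE (D.att (Sum.inl (v, k)))
  att_leg : ∀ l, D'.att (Sum.inr (onL l)) = onE (D.att (Sum.inr l))

namespace Diagram

def Iso.refl (D : Diagram) : Iso D D where
  onV := Equiv.refl _
  rot := fun _ => 0
  onL := OrderIso.refl _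
  onE := Equiv.refl _
  label_eq := fun _ => rfl
  att_vertex := fun v k => by simp
  att_leg := fun _ => rfl

def Iso.symm {D D' : Diagram} (f : Iso D D') : Iso D' D where
  onV := f.onV.symm
  rot := fun v => - f.rot (f.onV.symm v)
  onL := f.onL.symm
  onE := f.onE.symm
  label_eq := fun l => by
    have := f.label_eq (f.onL.symm l)
    simpa using this.symm
  att_vertex := fun v k => by
    have := f.att_vertex (f.onV.symm v) (k + - f.rot (f.onV.symm v))
    rw [Equiv.eq_symm_apply, ← this]
    simp
  att_leg := fun l => by
    have := f.att_leg (f.onL.symm l)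
    rw [Equiv.eq_symm_apply, ← this]
    simp

def Iso.trans {D D' D'' : Diagram} (f : Iso D D') (g : Iso D' D'') : Iso D D'' where
  onV := f.onV.trans g.onV
  rot := fun v => f.rot v + g.rot (f.onV v)
  onL := f.onL.trans g.onL
  onE := f.onE.trans g.onE
  label_eq := fun l => by simp [f.label_eq, g.label_eq]
  att_vertex := fun v k => by
    have h1 := f.att_vertex v k
    have h2 := g.att_vertex (f.onV v) (k + f.rot v)
    simp only [Equiv.trans_apply, ← add_assoc]
    rw [h2, h1]
  att_leg := fun l => by simp [f.att_leg, g.att_leg]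

instance isoSetoid : Setoid Diagram where
  r D D' := Nonempty (Iso D D')
  iseqv :=
    { refl := fun D => ⟨Iso.refl D⟩
      symm := fun ⟨f⟩ => ⟨f.symm⟩
      trans := fun ⟨f⟩ ⟨g⟩ => ⟨f.trans g⟩ }

/-- The diagram with no vertices and no edges. -/
def empty : Diagram where
  V := Empty
  L := Empty
  E := Empty
  label := Empty.elim
  att := Sum.elim (fun x => x.1.elim) Empty.elim
  ends := fun e => e.elim

/-- The attaching map of the juxtaposition of two diagrams. -/
def juxtAtt (D D' : Diagram) : ((D.V ⊕ D'.V) × Fin 3) ⊕ (D.L ⊕ₗ D'.L) → D.E ⊕ D'.E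
  | Sum.inl (Sum.inl v, k) => Sum.inl (D.att (Sum.inl (v, k)))
  | Sum.inl (Sum.inr v, k) => Sum.inr (D'.att (Sum.inl (v, k)))
  | Sum.inr l =>
    Sum.map (fun i => D.att (Sum.inr i)) (fun i => D'.att (Sum.inr i)) (ofLex l)

/-- The half-edges of a juxtaposition. -/
def juxtHalfEdges (D D' : Diagram) :
    (((D.V × Fin 3) ⊕ D.L) ⊕ ((D'.V × Fin 3) ⊕ D'.L)) ≃
      ((D.V ⊕ D'.V) × Fin 3) ⊕ (D.L ⊕ₗ D'.L) :=
  (Equiv.sumSumSumComm _ _ _ _).trans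
    (Equiv.sumCongr (Equiv.sumProdDistrib _ _ _).symm toLex)

lemma juxtAtt_halfEdges (D D' : Diagram) (h) :
    juxtAtt D D' (juxtHalfEdges D D' h) = Sum.map D.att D'.att h := by
  rcases h with (⟨v, k⟩ | l) | (⟨v, k⟩ | l) <;> rfl

/-- Juxtaposition: the second diagram is placed to the right of the first one. -/
def juxt (D D' : Diagram) : Diagram where
  V := D.V ⊕ D'.V
  L := D.L ⊕ₗ D'.L
  E := D.E ⊕ D'.E
  finL := inferInstanceAs (Finite (D.L ⊕ D'.L))
  label := fun l => Sum.elim D.label D'.label (ofLex l)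
  att := juxtAtt D D'
  ends := fun e => by
    have key : Nat.card {h // juxtAtt D D' h = e} =
        Nat.card {h // Sum.map D.att D'.att h = e} :=
      Nat.card_congr ((juxtHalfEdges D D').subtypeEquiv
        (fun h => by rw [juxtAtt_halfEdges])).symm
    rw [key]
    rcases e with e | e
    · have : Nat.card {h // Sum.map D.att D'.att h = Sum.inl e} =
          Nat.card {h // D.att h = e} := by
        refine Nat.card_congr (Equiv.ofBijective
          (fun h : {h // D.att h = e} => ⟨Sum.inl h.1, by simp [h.2]⟩) ⟨?_, ?_⟩).symm
        · rintro ⟨x, hx⟩ ⟨y, hy⟩ h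
          simpa using h
        · rintro ⟨x | x, hx⟩
          · exact ⟨⟨x, by simpa using hx⟩, rfl⟩
          · simp at hx
      rw [this]
      exact D.ends e
    · have : Nat.card {h // Sum.map D.att D'.att h = Sum.inr e} =
          Nat.card {h // D'.att h = e} := by
        refine Nat.card_congr (Equiv.ofBijective
          (fun h : {h // D'.att h = e} => ⟨Sum.inr h.1, by simp [h.2]⟩) ⟨?_, ?_⟩).symm
        · rintro ⟨x, hx⟩ ⟨y, hy⟩ h
          simpa using h
        · rintro ⟨x | x, hx⟩
          · simp at hx
          · exact ⟨⟨x, by simpa using hx⟩, rfl⟩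
      rw [this]
      exact D'.ends e

/-- The diagrams considered up to isomorphism. -/
def IsoClass : Type 1 := Quotient isoSetoid

/-- The isomorphism class of a diagram. -/
def isoClass (D : Diagram) : IsoClass := Quotient.mk _ D

def juxtCongr {D₁ D₁' D₂ D₂' : Diagram} (f : Iso D₁ D₁') (g : Iso D₂ D₂') :
    Iso (juxt D₁ D₂) (juxt D₁' D₂') where
  onV := Equiv.sumCongr f.onV g.onV
  rot := Sum.elim f.rot g.rot
  onL := OrderIso.sumLexCongr f.onL g.onL
  onE := Equiv.sumCongr f.onE g.onE
  label_eq := by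
    intro (l : D₁.L ⊕ D₂.L)
    rcases l with l | l
    · exact f.label_eq l
    · exact g.label_eq l
  att_vertex := by
    rintro (v | v) k
    · exact congrArg Sum.inl (f.att_vertex v k)
    · exact congrArg Sum.inr (g.att_vertex v k)
  att_leg := by
    intro (l : D₁.L ⊕ D₂.L)
    rcases l with l | l
    · exact congrArg Sum.inl (f.att_leg l)
    · exact congrArg Sum.inr (g.att_leg l)

def juxtAssoc (D₁ D₂ D₃ : Diagram) :
    Iso (juxt (juxt D₁ D₂) D₃) (juxt D₁ (juxt D₂ D₃)) where
  onV := Equiv.sumAssoc _ _ _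
  rot := fun _ => 0
  onL := OrderIso.sumLexAssoc _ _ _
  onE := Equiv.sumAssoc _ _ _
  label_eq := by
    intro (l : (D₁.L ⊕ D₂.L) ⊕ D₃.L)
    rcases l with (l | l) | l <;> rfl
  att_vertex := by
    rintro ((v | v) | v) k <;> (rw [add_zero]; rfl)
  att_leg := by
    intro (l : (D₁.L ⊕ D₂.L) ⊕ D₃.L)
    rcases l with (l | l) | l <;> rfl

instance : IsEmpty empty.V := inferInstanceAs (IsEmpty Empty)
instance : IsEmpty empty.L := inferInstanceAs (IsEmpty Empty)
instance : IsEmpty empty.E := inferInstanceAs (IsEmpty Empty)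

def emptyJuxt (D : Diagram) : Iso (juxt empty D) D where
  onV := Equiv.emptySum _ _
  rot := fun _ => 0
  onL := OrderIso.emptySumLex
  onE := Equiv.emptySum _ _
  label_eq := by
    intro (l : Empty ⊕ D.L)
    rcases l with l | l
    · exact l.elim
    · rfl
  att_vertex := by
    rintro (v | v) k
    · exact v.elim
    · rw [add_zero]; rfl
  att_leg := by
    intro (l : Empty ⊕ D.L)
    rcases l with l | l
    · exact l.elim
    · rfl

def juxtEmpty (D : Diagram) : Iso (juxt D empty) D where
  onV := Equiv.sumEmpty _ _
  rot := fun _ => 0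
  onL := OrderIso.sumLexEmpty
  onE := Equiv.sumEmpty _ _
  label_eq := by
    intro (l : D.L ⊕ Empty)
    rcases l with l | l
    · rfl
    · exact l.elim
  att_vertex := by
    rintro (v | v) k
    · rw [add_zero]; rfl
    · exact v.elim
  att_leg := by
    intro (l : D.L ⊕ Empty)
    rcases l with l | l
    · rfl
    · exact l.elim

/-- Diagrams form a monoid under juxtaposition. -/
instance : Monoid IsoClass where
  mul := Quotient.map₂ juxt (fun _ _ ⟨f⟩ _ _ ⟨g⟩ => ⟨juxtCongr f g⟩)
  one := Quotient.mk _ empty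
  mul_assoc := by
    rintro ⟨D₁⟩ ⟨D₂⟩ ⟨D₃⟩
    exact Quotient.sound ⟨juxtAssoc D₁ D₂ D₃⟩
  one_mul := by
    rintro ⟨D⟩
    exact Quotient.sound ⟨emptyJuxt D⟩
  mul_one := by
    rintro ⟨D⟩
    exact Quotient.sound ⟨juxtEmpty D⟩

/-- The type of a diagram: its parameter-grade and its operator-grade. -/
def bidegree (D : Diagram) : ℕ × ℕ :=
  (∑ᶠ l, (D.label l).paramGrade, ∑ᶠ l, (D.label l).opGrade)

lemma bidegree_juxt (D D' : Diagram) : (juxt D D').bidegree = D.bidegree + D'.bidegree := by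
  have key : ∀ g : Leg → ℕ, ∑ᶠ l, g ((juxt D D').label l) =
      ∑ᶠ l, g (D.label l) + ∑ᶠ l, g (D'.label l) := by
    intro g
    have := Fintype.ofFinite D.L
    have := Fintype.ofFinite D'.L
    have h : ∑ᶠ l, g ((juxt D D').label l) =
        ∑ᶠ l : D.L ⊕ D'.L, g (Sum.elim D.label D'.label l) := rfl
    rw [h, finsum_eq_sum_of_fintype, finsum_eq_sum_of_fintype, finsum_eq_sum_of_fintype,
      Fintype.sum_sum_type]
    rfl
  exact Prod.ext (key _) (key _)

/-- A diagram is connected if, the orienting line being ignored, its underlying graph is connected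
(in particular nonempty). -/
def Connected (D : Diagram) : Prop :=
  Nonempty D.E ∧ ∀ e e' : D.E, EqvGen
    (fun x y => ∃ v k k', D.att (Sum.inl (v, k)) = x ∧ D.att (Sum.inl (v, k')) = y) e e'

/-! ## Operations on diagrams that enter the relations -/

/-- The half-edges at the trivalent vertices are permuted: what was attached at `σ h` is now
attached at `h`. -/
def permVertices (D : Diagram) (σ : Equiv.Perm (D.V × Fin 3)) : Diagram where
  V := D.V
  L := D.L
  E := D.E
  label := D.label
  att := D.att ∘ Sum.map σ id
  ends := fun e => by
    have : Nat.card {h // (D.att ∘ Sum.map σ id) h = e} = Nat.card {h // D.att h = e} :=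
      Nat.card_congr ((Equiv.sumCongr σ (Equiv.refl D.L)).subtypeEquiv (fun h => by
        rcases h with h | h <;> rfl))
    rw [this]
    exact D.ends e

open Classical in
/-- The cyclic order at the vertex `v` is reversed. -/
def flip (D : Diagram) (v : D.V) : Diagram :=
  D.permVertices (Equiv.swap (v, 1) (v, 2))

open Classical in
/-- What is attached at `(u, 1)`, `(u, 2)`, `(v, 1)` is rotated cyclically. -/
def rotate (D : Diagram) (u v : D.V) : Diagram :=
  D.permVertices (Equiv.swap (u, 1) (u, 2) * Equiv.swap (u, 2) (v, 1))

/-- The legs `i` and `j` exchange their positions on the orienting line. -/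
def swapLegs (D : Diagram) (i j : D.L) : Diagram where
  V := D.V
  L := D.L
  E := D.E
  label := D.label ∘ Equiv.swap i j
  att := D.att ∘ Sum.map id (Equiv.swap i j)
  ends := fun e => by
    have : Nat.card {h // (D.att ∘ Sum.map id (Equiv.swap i j)) h = e} =
        Nat.card {h // D.att h = e} :=
      Nat.card_congr ((Equiv.sumCongr (Equiv.refl _) (Equiv.swap i j)).subtypeEquiv (fun h => by
        rcases h with h | h <;> rfl))
    rw [this]
    exact D.ends e

/-- The attaching map of `fork`; the new vertex is `none` and the new edge is `none`. -/
def forkAtt (D : Diagram) (i j : D.L) :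
    (Option D.V × Fin 3) ⊕ {l : D.L // l ≠ j} → Option D.E
  | Sum.inl (some v, k) => some (D.att (Sum.inl (v, k)))
  | Sum.inl (none, 0) => none
  | Sum.inl (none, 1) => some (D.att (Sum.inr j))
  | Sum.inl (none, 2) => some (D.att (Sum.inr i))
  | Sum.inr l => if l.1 = i then none else some (D.att (Sum.inr l.1))

open Classical in
lemma fork_ends (D : Diagram) (i j : D.L) (hij : i ≠ j) (e : Option D.E) :
    Nat.card {h // forkAtt D i j h = e} = 2 ∨ Nat.card {h // forkAtt D i j h = e} = 0 := by
  rcases e with _ | e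
  · left
    rw [Nat.card_eq_two_iff]
    refine ⟨⟨Sum.inl (none, 0), rfl⟩, ⟨Sum.inr ⟨i, hij⟩, by simp [forkAtt]⟩,
      fun h => by simpa using congrArg Subtype.val h, ?_⟩
    ext ⟨x, hx⟩
    simp only [Set.mem_insert_iff, Set.mem_singleton_iff, Set.mem_univ, iff_true]
    rcases x with ⟨_ | v, k⟩ | l
    · fin_cases k
      · exact Or.inl rfl
      · exact absurd hx (by simp [forkAtt])
      · exact absurd hx (by simp [forkAtt])
    · exact absurd hx (by simp [forkAtt])
    · right
      have : l.1 = i := by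
        by_contra h
        simp [forkAtt, h] at hx
      exact Subtype.ext (congrArg Sum.inr (Subtype.ext this))
  · let g : (D.V × Fin 3) ⊕ D.L → (Option D.V × Fin 3) ⊕ {l : D.L // l ≠ j} := fun h =>
      match h with
      | Sum.inl (v, k) => Sum.inl (some v, k)
      | Sum.inr l => if hl : l = j then Sum.inl (none, 1) else
          if l = i then Sum.inl (none, 2) else Sum.inr ⟨l, hl⟩
    have hg : ∀ h, forkAtt D i j (g h) = some (D.att h) := by
      rintro (⟨v, k⟩ | l)
      · rfl
      · by_cases hl : l = j
        · subst hl; simp [g, forkAtt]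
        · by_cases hl' : l = i
          · subst hl'; simp [g, forkAtt, hl]
          · simp [g, forkAtt, hl, hl']
    have key : Nat.card {h // forkAtt D i j h = some e} = Nat.card {h // D.att h = e} := by
      refine Nat.card_congr (Equiv.ofBijective
        (fun h : {h // D.att h = e} => ⟨g h.1, by rw [hg, h.2]⟩) ⟨?_, ?_⟩).symm
      · rintro ⟨x, hx⟩ ⟨y, hy⟩ h
        have h' : g x = g y := congrArg Subtype.val h
        apply Subtype.ext
        change x = y
        rcases x with ⟨v, k⟩ | l <;> rcases y with ⟨v', k'⟩ | l' <;> simp only [g] at h'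
        · simpa using h'
        · split_ifs at h' <;> simp at h'
        · split_ifs at h' <;> simp at h'
        · split_ifs at h' <;> simp_all
      · rintro ⟨⟨_ | v, k⟩ | l, hx⟩
        · fin_cases k
          · exact absurd hx (by simp [forkAtt])
          · exact ⟨⟨Sum.inr j, by simpa [forkAtt] using hx⟩, by simp [g]⟩
          · exact ⟨⟨Sum.inr i, by simpa [forkAtt] using hx⟩, by simp [g, hij]⟩
        · exact ⟨⟨Sum.inl (v, k), by simpa [forkAtt] using hx⟩, rfl⟩
        · have hl : l.1 ≠ i := by
            intro h
            simp [forkAtt, h] at hx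
          exact ⟨⟨Sum.inr l.1, by simpa [forkAtt, hl] using hx⟩, by simp [g, hl, l.2]⟩
    rw [key]
    exact D.ends e

/-- The strands of the legs `i` and `j` are joined at a new trivalent vertex, whose third edge ends
at the leg `i`, while the leg `j` is removed. With the legs on a line, the strand of `i` coming in
from the upper left and that of `j` from the upper right, the vertex is oriented
counterclockwise. -/
def fork (D : Diagram) (i j : D.L) (hij : i ≠ j) : Diagram where
  V := Option D.V
  L := {l : D.L // l ≠ j}
  E := Option D.E
  label := fun l => D.label l.1
  att := forkAtt D i j
  ends := fork_ends D i j hij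

/-! ## Gluing legs in pairs -/

/-- A pairing: a (possibly empty) family of disjoint two-element sets of `bot`-legs. -/
structure Pairing (D : Diagram) where
  pairs : Finset (Finset D.L)
  card_two : ∀ p ∈ pairs, p.card = 2
  bot : ∀ p ∈ pairs, ∀ l ∈ p, D.label l = Leg.bot
  disj : ∀ p ∈ pairs, ∀ q ∈ pairs, p ≠ q → Disjoint p q

instance (D : Diagram) : Finite D.Pairing :=
  Finite.of_injective (fun P => P.pairs) (fun P Q h => by cases P; cases Q; simpa using h)

instance (D : Diagram) : Fintype D.Pairing := Fintype.ofFinite _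

/-- Two edges meet if they contain the two legs of a pair. -/
def Meet (D : Diagram) (P : Finset (Finset D.L)) (e e' : D.E) : Prop :=
  ∃ p ∈ P, ∃ i ∈ p, ∃ j ∈ p, D.att (Sum.inr i) = e ∧ D.att (Sum.inr j) = e'

lemma glue_ends_aux (D : Diagram) (P : Finset (Finset D.L))
    (h2 : ∀ p ∈ P, p.card = 2) (hd : ∀ p ∈ P, ∀ q ∈ P, p ≠ q → Disjoint p q)
    (c : Quot (D.Meet P)) :
    {h : (D.V × Fin 3) ⊕ D.L |
      (∀ l, h = Sum.inr l → ∀ p ∈ P, l ∉ p) ∧ Quot.mk _ (D.att h) = c}.ncard = 2 ∨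
    {h : (D.V × Fin 3) ⊕ D.L |
      (∀ l, h = Sum.inr l → ∀ p ∈ P, l ∉ p) ∧ Quot.mk _ (D.att h) = c}.ncard = 0 := by
  induction P using Finset.induction_on with
  | empty =>
    induction c using Quot.inductionOn with
    | h e =>
    have hq : ∀ e', Quot.mk (D.Meet ∅) e' = Quot.mk _ e ↔ e' = e := by
      intro e'
      refine ⟨fun h => ?_, fun h => by rw [h]⟩
      have := Quot.eqvGen_exact h
      clear h
      induction this with
      | rel x y h => simp [Meet] at h
      | refl x => rfl
      | symm x y _ ih => exact ih.symm
      | trans x y z _ _ ih ih' => exact ih.trans ih'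
    have : {h : (D.V × Fin 3) ⊕ D.L | (∀ l, h = Sum.inr l → ∀ p ∈ (∅ : Finset (Finset D.L)), l ∉ p)
        ∧ Quot.mk (D.Meet ∅) (D.att h) = Quot.mk _ e} = {h | D.att h = e} := by
      ext h; simp [hq]
    rw [this]
    exact D.ends e
  | insert p P hpP ih =>
    have ih := ih (fun q hq => h2 q (Finset.mem_insert_of_mem hq))
      (fun q hq r hr => hd q (Finset.mem_insert_of_mem hq) r (Finset.mem_insert_of_mem hr))
    obtain ⟨e, rfl⟩ := Quot.exists_rep c
    obtain ⟨i, j, hij, rfl⟩ := Finset.card_eq_two.1 (h2 p (Finset.mem_insert_self _ _))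
    set P' := insert {i, j} P with hP'
    have hiP : ∀ q ∈ P, i ∉ q := by
      intro q hq hi
      have := hd q (Finset.mem_insert_of_mem hq) _ (Finset.mem_insert_self _ _)
        (fun h => hpP (h ▸ hq))
      exact Finset.disjoint_left.1 this hi (by simp)
    have hjP : ∀ q ∈ P, j ∉ q := by
      intro q hq hi
      have := hd q (Finset.mem_insert_of_mem hq) _ (Finset.mem_insert_self _ _)
        (fun h => hpP (h ▸ hq))
      exact Finset.disjoint_left.1 this hi (by simp)
    set α := Quot.mk (D.Meet P) (D.att (Sum.inr i)) with hα
    set β := Quot.mk (D.Meet P) (D.att (Sum.inr j)) with hβ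
    set F : Quot (D.Meet P) → Set ((D.V × Fin 3) ⊕ D.L) := fun c =>
      {h | (∀ l, h = Sum.inr l → ∀ p ∈ P, l ∉ p) ∧ Quot.mk _ (D.att h) = c} with hF
    have hq : ∀ e e', Quot.mk (D.Meet P') e = Quot.mk _ e' ↔
        (Quot.mk (D.Meet P) e = Quot.mk _ e' ∨
          ((Quot.mk (D.Meet P) e = α ∨ Quot.mk (D.Meet P) e = β) ∧
            (Quot.mk (D.Meet P) e' = α ∨ Quot.mk (D.Meet P) e' = β))) := by
      have mono : ∀ e e', Quot.mk (D.Meet P) e = Quot.mk _ e' →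
          Quot.mk (D.Meet P') e = Quot.mk _ e' := by
        intro e e' h
        have := Quot.eqvGen_exact h
        clear h
        induction this with
        | rel x y h =>
          obtain ⟨q, hq, h⟩ := h
          exact Quot.sound ⟨q, Finset.mem_insert_of_mem hq, h⟩
        | refl x => rfl
        | symm x y _ ih => exact ih.symm
        | trans x y z _ _ ih ih' => exact ih.trans ih'
      have hαβ : Quot.mk (D.Meet P') (D.att (Sum.inr i)) = Quot.mk _ (D.att (Sum.inr j)) :=
        Quot.sound ⟨{i, j}, Finset.mem_insert_self _ _, i, by simp, j, by simp, rfl, rfl⟩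
      intro e e'
      constructor
      · intro h
        have := Quot.eqvGen_exact h
        clear h
        induction this with
        | rel x y h =>
          obtain ⟨q, hq, k, hk, l, hl, rfl, rfl⟩ := h
          rcases Finset.mem_insert.1 hq with rfl | hq
          · right
            simp only [Finset.mem_insert, Finset.mem_singleton] at hk hl
            constructor
            · rcases hk with rfl | rfl
              · exact Or.inl rfl
              · exact Or.inr rfl
            · rcases hl with rfl | rfl
              · exact Or.inl rfl
              · exact Or.inr rfl
          · exact Or.inl (Quot.sound ⟨q, hq, k, hk, l, hl, rfl, rfl⟩)
        | refl x => exact Or.inl rfl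
        | symm x y _ ih =>
          rcases ih with ih | ⟨h, h'⟩
          · exact Or.inl ih.symm
          · exact Or.inr ⟨h', h⟩
        | trans x y z _ _ ih ih' =>
          rcases ih with ih | ⟨h, h'⟩
          · rw [ih]; exact ih'
          · rcases ih' with ih' | ⟨k, k'⟩
            · rw [← ih']; exact Or.inr ⟨h, h'⟩
            · exact Or.inr ⟨h, k'⟩
      · rintro (h | ⟨h, h'⟩)
        · exact mono _ _ h
        · have a1 : Quot.mk (D.Meet P') e = Quot.mk _ (D.att (Sum.inr i)) := by
            rcases h with h | h
            · exact mono _ _ h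
            · rw [hαβ]; exact mono _ _ h
          have a2 : Quot.mk (D.Meet P') e' = Quot.mk _ (D.att (Sum.inr i)) := by
            rcases h' with h' | h'
            · exact mono _ _ h'
            · rw [hαβ]; exact mono _ _ h'
          rw [a1, a2]
    have hact : ∀ h : (D.V × Fin 3) ⊕ D.L, (∀ l, h = Sum.inr l → ∀ p ∈ P', l ∉ p) ↔
        (∀ l, h = Sum.inr l → ∀ p ∈ P, l ∉ p) ∧ h ≠ Sum.inr i ∧ h ≠ Sum.inr j := by
      intro h
      rcases h with h | l
      · simp
      · rw [hP']
        constructor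
        · intro h
          have h' := h l rfl
          have hl := h' _ (Finset.mem_insert_self _ _)
          simp only [Finset.mem_insert, Finset.mem_singleton, not_or] at hl
          refine ⟨fun m hm q hq => ?_, by simpa using hl.1, by simpa using hl.2⟩
          cases hm
          exact h' q (Finset.mem_insert_of_mem hq)
        · rintro ⟨h, hi, hj⟩ m hm q hq
          cases hm
          rcases Finset.mem_insert.1 hq with rfl | hq
          · simp only [Finset.mem_insert, Finset.mem_singleton, not_or]
            exact ⟨fun h => hi (by rw [h]), fun h => hj (by rw [h])⟩
          · exact h l rfl q hq
    have hiF : Sum.inr i ∈ F α := ⟨fun l hl => by cases hl; exact hiP, rfl⟩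
    have hjF : Sum.inr j ∈ F β := ⟨fun l hl => by cases hl; exact hjP, rfl⟩
    have hα2 : (F α).ncard = 2 := (ih α).resolve_right (fun h => by
      exact absurd ((Set.ncard_eq_zero (Set.toFinite _)).1 h) (Set.nonempty_iff_ne_empty.1 ⟨_, hiF⟩))
    have hβ2 : (F β).ncard = 2 := (ih β).resolve_right (fun h => by
      exact absurd ((Set.ncard_eq_zero (Set.toFinite _)).1 h) (Set.nonempty_iff_ne_empty.1 ⟨_, hjF⟩))
    by_cases hc : Quot.mk (D.Meet P) e = α ∨ Quot.mk (D.Meet P) e = β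
    · have hset : {h : (D.V × Fin 3) ⊕ D.L | (∀ l, h = Sum.inr l → ∀ p ∈ P', l ∉ p) ∧
          Quot.mk (D.Meet P') (D.att h) = Quot.mk _ e} =
          (F α ∪ F β) \ {Sum.inr i, Sum.inr j} := by
        ext h
        simp only [Set.mem_ofPred_eq, hact, hq, Set.mem_sdiff, Set.mem_union, hF,
          Set.mem_insert_iff, Set.mem_singleton_iff, not_or]
        rcases hc with hc | hc <;> rw [hc] <;> tauto
      rw [hset, Set.ncard_sdiff (by
        rintro x (rfl | rfl)
        · exact Or.inl hiF
        · exact Or.inr hjF), Set.ncard_pair (by simpa using hij)]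
      by_cases hab : α = β
      · right
        rw [← hab, Set.union_self, hα2]
      · left
        rw [Set.ncard_union_eq, hα2, hβ2]
        rw [Set.disjoint_left]
        rintro x ⟨_, hx⟩ ⟨_, hx'⟩
        exact hab (hx.symm.trans hx')
    · have hset : {h : (D.V × Fin 3) ⊕ D.L | (∀ l, h = Sum.inr l → ∀ p ∈ P', l ∉ p) ∧
          Quot.mk (D.Meet P') (D.att h) = Quot.mk _ e} = F (Quot.mk _ e) := by
        ext h
        simp only [Set.mem_ofPred_eq, hact, hq, hF]
        constructor
        · rintro ⟨⟨h1, _⟩, h2 | h2⟩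
          · exact ⟨h1, h2⟩
          · exact absurd h2.2 hc
        · rintro ⟨h1, h2⟩
          refine ⟨⟨h1, ?_, ?_⟩, Or.inl h2⟩
          · rintro rfl
            exact hc (Or.inl h2.symm)
          · rintro rfl
            exact hc (Or.inr h2.symm)
      rw [hset]
      exact ih _

/-- The attaching map of `glue`. -/
def glueAtt (D : Diagram) (P : Finset (Finset D.L)) :
    (D.V × Fin 3) ⊕ {l : D.L // ∀ p ∈ P, l ∉ p} → Quot (D.Meet P) :=
  fun h => Quot.mk _ (D.att (Sum.map id Subtype.val h))

lemma glue_ends (D : Diagram) (P : D.Pairing) (c : Quot (D.Meet P.pairs)) :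
    Nat.card {h // glueAtt D P.pairs h = c} = 2 ∨ Nat.card {h // glueAtt D P.pairs h = c} = 0 := by
  have key : Nat.card {h // glueAtt D P.pairs h = c} =
      {h : (D.V × Fin 3) ⊕ D.L | (∀ l, h = Sum.inr l → ∀ p ∈ P.pairs, l ∉ p) ∧
        Quot.mk (D.Meet P.pairs) (D.att h) = c}.ncard := by
    refine Nat.card_congr (Equiv.ofBijective
      (fun h => ⟨Sum.map id Subtype.val h.1, ?_, h.2⟩) ⟨?_, ?_⟩)
    · intro l hl
      rcases h with ⟨x | x, hx⟩
      · simp at hl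
      · simp only [Sum.map_inr, Sum.inr.injEq] at hl
        exact hl ▸ x.2
    · rintro ⟨x, hx⟩ ⟨y, hy⟩ h
      have h' : Sum.map id Subtype.val x = Sum.map id Subtype.val y := congrArg Subtype.val h
      apply Subtype.ext
      exact Sum.map_injective.2 ⟨Function.injective_id, Subtype.val_injective⟩ h'
    · rintro ⟨x | x, hx, hx'⟩
      · exact ⟨⟨Sum.inl x, hx'⟩, rfl⟩
      · exact ⟨⟨Sum.inr ⟨x, hx x rfl⟩, hx'⟩, rfl⟩
  rw [key]
  exact glue_ends_aux D P.pairs P.card_two P.disj c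

/-- The legs of every pair are glued to each other: the two legs disappear and the edges that end
at them are joined. -/
def glue (D : Diagram) (P : D.Pairing) : Diagram where
  V := D.V
  L := {l : D.L // ∀ p ∈ P.pairs, l ∉ p}
  E := Quot (D.Meet P.pairs)
  label := fun l => D.label l.1
  att := glueAtt D P.pairs
  ends := glue_ends D P

/-- The pairing that consists of a single pair. -/
def Pairing.single (D : Diagram) (i j : D.L) (hij : i ≠ j)
    (hi : D.label i = Leg.bot) (hj : D.label j = Leg.bot) : D.Pairing where
  pairs := {{i, j}}
  card_two := by
    intro p hp
    rw [Finset.mem_singleton.1 hp, Finset.card_pair hij]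
  bot := by
    intro p hp l hl
    rw [Finset.mem_singleton.1 hp] at hl
    simp only [Finset.mem_insert, Finset.mem_singleton] at hl
    rcases hl with rfl | rfl
    · exact hi
    · exact hj
  disj := by
    intro p hp q hq hpq
    exact absurd ((Finset.mem_singleton.1 hp).trans (Finset.mem_singleton.1 hq).symm) hpq

/-- The number of intersections of full lines when the pairs are joined by arcs below the orienting
line and the other legs of grade one are carried straight down: two arcs meet if and only if their
ends interlace, and an arc meets the line of a leg if and only if the leg lies between the ends of
the arc. -/
def Pairing.crossings {D : Diagram} (P : D.Pairing) : ℕ :=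
  Nat.card {x : D.L × D.L × D.L × D.L // x.1 < x.2.1 ∧ x.2.1 < x.2.2.1 ∧ x.2.2.1 < x.2.2.2 ∧
      {x.1, x.2.2.1} ∈ P.pairs ∧ {x.2.1, x.2.2.2} ∈ P.pairs} +
    Nat.card {x : D.L × D.L × D.L // x.1 < x.2.1 ∧ x.2.1 < x.2.2 ∧ {x.1, x.2.2} ∈ P.pairs ∧
      (∀ p ∈ P.pairs, x.2.1 ∉ p) ∧ (D.label x.2.1).grade = 1}

/-- The coefficient with which the gluing along a pairing enters `λ`. -/
def Pairing.coeff {D : Diagram} (P : D.Pairing) : ℚ :=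
  (-1) ^ P.crossings * (1 / 2) ^ P.pairs.card

end Diagram

/-! ## The spaces of diagrams -/

open Diagram

/-- Formal finite rational combinations of diagrams, multiplied by juxtaposition. -/
abbrev Formal : Type 1 := MonoidAlgebra ℚ IsoClass

/-- A diagram as a formal combination. -/
def formal (D : Diagram) : Formal := MonoidAlgebra.of ℚ IsoClass D.isoClass

/-- The relations `x = y` between formal combinations. For `κ = 1` they are those of
`Ŵ_F[a,b]`, for `κ = 0` those of `Ŵ_∧[a,b]`. In both cases there are AS, IHX, the signed free
movement of the parameter and operator legs, the relation of STU type for two curvature legs and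
the commutation of curvature legs with `bot`-legs; two adjacent `bot`-legs satisfy the Clifford
relation for `κ = 1` and anticommute for `κ = 0`. Throughout, `i ⋖ j` says that the leg `j` is the
right-hand neighbour of the leg `i`. -/
inductive Rel (κ : ℚ) : Formal → Formal → Prop
  | as (D : Diagram) (v : D.V) :
      Rel κ (formal D) (-formal (D.flip v))
  | ihx (D : Diagram) (u v : D.V) (huv : u ≠ v)
      (h : D.att (Sum.inl (u, 0)) = D.att (Sum.inl (v, 0))) :
      Rel κ (formal D + formal (D.rotate u v) + formal ((D.rotate u v).rotate u v)) 0
  | move (D : Diagram) (i j : D.L) (hij : i ⋖ j)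
      (h : (D.label i).IsFormal ∨ (D.label j).IsFormal) :
      Rel κ (formal D)
        ((-1 : ℚ) ^ ((D.label i).grade * (D.label j).grade) • formal (D.swapLegs i j))
  | stu (D : Diagram) (i j : D.L) (hij : i ⋖ j)
      (hi : D.label i = Leg.curv) (hj : D.label j = Leg.curv) :
      Rel κ (formal D - formal (D.swapLegs i j)) (formal (D.fork i j hij.lt.ne))
  | comm (D : Diagram) (i j : D.L) (hij : i ⋖ j)
      (hi : D.label i = Leg.curv) (hj : D.label j = Leg.bot) :
      Rel κ (formal D) (formal (D.swapLegs i j))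
  | clifford (D : Diagram) (i j : D.L) (hij : i ⋖ j)
      (hi : D.label i = Leg.bot) (hj : D.label j = Leg.bot) :
      Rel κ (formal D + formal (D.swapLegs i j))
        (κ • formal (D.glue (Pairing.single D i j hij.lt.ne hi hj)))

/-- Combinations of diagrams modulo the relations. The relations are local and may be applied
inside any diagram, so that they span a two-sided ideal for juxtaposition. Operator legs are
allowed to stand anywhere: as they move freely past all legs, up to sign, every diagram is equal
up to sign to one whose operator legs stand at the far right. -/
abbrev Space (κ : ℚ) : Type 1 := RingQuot (Rel κ)

/-- The class of a diagram. -/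
def cls (κ : ℚ) (D : Diagram) : Space κ := RingQuot.mkAlgHom ℚ (Rel κ) (formal D)

/-- The subspace generated by the diagrams of type `t = (i, j)`. -/
def piece (κ : ℚ) (t : ℕ × ℕ) : Submodule ℚ (Space κ) :=
  Submodule.span ℚ {x | ∃ D : Diagram, D.bidegree = t ∧ cls κ D = x}

lemma cls_mem (κ : ℚ) (D : Diagram) {t : ℕ × ℕ} (h : D.bidegree = t) : cls κ D ∈ piece κ t :=
  Submodule.subset_span ⟨D, h, rfl⟩

lemma cls_mul (κ : ℚ) (D D' : Diagram) : cls κ D * cls κ D' = cls κ (juxt D D') := by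
  rw [cls, cls, ← map_mul, formal, formal, ← map_mul]
  rfl

lemma mul_mem_piece (κ : ℚ) {s t : ℕ × ℕ} {x y : Space κ} (hx : x ∈ piece κ s)
    (hy : y ∈ piece κ t) : x * y ∈ piece κ (s + t) := by
  have h := Submodule.mul_mem_mul hx hy
  rw [piece, piece, Submodule.span_mul_span] at h
  refine Submodule.span_mono ?_ h
  rintro _ ⟨_, ⟨D, hD, rfl⟩, _, ⟨D', hD', rfl⟩, rfl⟩
  exact ⟨juxt D D', by rw [bidegree_juxt, hD, hD'], (cls_mul κ D D').symm⟩

/-- Formal power series: a choice, for every type, of an element of that type. -/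
abbrev Series (κ : ℚ) : Type 1 := ∀ t : ℕ × ℕ, piece κ t

/-- `Ŵ_F[[a,b]]`. -/
abbrev WF : Type 1 := Series 1

/-- `Ŵ_∧[[a,b]]`. -/
abbrev WWedge : Type 1 := Series 0

namespace Series

variable {κ : ℚ}

/-- A diagram as a power series. -/
def of (κ : ℚ) (D : Diagram) : Series κ := Pi.single D.bidegree ⟨cls κ D, cls_mem κ D rfl⟩

/-- The product `#` of power series, which extends juxtaposition of diagrams. -/
def sharp (x y : Series κ) : Series κ := fun t =>
  ⟨∑ p ∈ Finset.HasAntidiagonal.antidiagonal t.1 ×ˢ Finset.HasAntidiagonal.antidiagonal t.2,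
      (x (p.1.1, p.2.1) : Space κ) * (y (p.1.2, p.2.2) : Space κ), by
    refine Submodule.sum_mem _ fun p hp => ?_
    obtain ⟨h1, h2⟩ := Finset.mem_product.1 hp
    have := mul_mem_piece κ (x (p.1.1, p.2.1)).2 (y (p.1.2, p.2.2)).2
    rwa [Prod.mk_add_mk, Finset.HasAntidiagonal.mem_antidiagonal.1 h1,
      Finset.HasAntidiagonal.mem_antidiagonal.1 h2] at this⟩

/-- The powers for the product `#`; the power with exponent `0` is the empty diagram. -/
def sharpPow (x : Series κ) : ℕ → Series κ
  | 0 => of κ empty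
  | n + 1 => sharp (sharpPow x n) x

/-- A family of power series is summable if for every type only finitely many of its members have a
nonzero piece of that type. -/
def FamilySummable {ι : Type*} (f : ι → Series κ) : Prop := ∀ t, {k | f k t ≠ 0}.Finite

/-- The sum of a summable family. -/
def familySum {ι : Type*} (f : ι → Series κ) : Series κ := fun t => ∑ᶠ k, f k t

/-- The terms of the exponential series for the product `#`. -/
def expTerm (x : Series κ) (n : ℕ) : Series κ := (n.factorial : ℚ)⁻¹ • sharpPow x n

/-- The exponential for the product `#`. -/
def expSharp (x : Series κ) : Series κ := familySum (expTerm x)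

end Series

/-! ## The map `λ` -/

/-- `lam t` is, for every type `t`, the linear extension of the map that glues the `bot`-legs of a
diagram to each other in all possible ways. -/
def IsLambda (lam : ∀ t : ℕ × ℕ, piece 1 t →ₗ[ℚ] piece 0 t) : Prop :=
  ∀ (t : ℕ × ℕ) (D : Diagram) (h : D.bidegree = t),
    (lam t ⟨cls 1 D, cls_mem 1 D h⟩ : Space 0) = ∑ P : D.Pairing, P.coeff • cls 0 (D.glue P)

/-- The extension to power series, type by type. -/
def onSeries (lam : ∀ t : ℕ × ℕ, piece 1 t →ₗ[ℚ] piece 0 t) (x : WF) : WWedge :=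
  fun t => lam t (x t)

/-! ## The two basic diagrams and the terms -/

/-- The tripod with one `a`-leg and two `bot`-legs. -/
def tripod : Diagram where
  V := Unit
  L := Fin 3
  E := Fin 3
  label := ![Leg.a, Leg.bot, Leg.bot]
  att := Sum.elim (fun h => h.2) id
  ends := fun e => by
    left
    rw [Nat.card_eq_fintype_card]
    revert e
    decide

/-- The edge with a `b`-leg on the left and a `bot`-leg on the right. -/
def strut : Diagram where
  V := Empty
  L := Fin 2
  E := Unit
  label := ![Leg.b, Leg.bot]
  att := fun _ => ()
  ends := fun e => by
    left
    rw [Nat.card_eq_fintype_card]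
    revert e
    decide

/-- The two symbols from which words are built. -/
inductive Letter
  | A | B

namespace Letter

/-- The diagram of a symbol. -/
def diagram : Letter → Diagram
  | A => tripod
  | B => strut

/-- The coefficient of the diagram of a symbol: the edge of `A` carries the label `a/2`. -/
def coeff : Letter → ℚ
  | A => 1 / 2
  | B => 1

end Letter

/-- The diagrams of the symbols of a word, placed along the orienting line. -/
def wordDiagram : List Letter → Diagram
  | [] => empty
  | x :: w => juxt x.diagram (wordDiagram w)

/-- A nonempty word together with a pairing of the `bot`-legs of its diagram. -/
structure GluingType where
  word : List Letter
  word_ne : word ≠ []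
  pairing : (wordDiagram word).Pairing

namespace GluingType

/-- The length of the word. -/
def length (τ : GluingType) : ℕ := τ.word.length

/-- The diagram of the word, glued along the pairing. -/
def diagram (τ : GluingType) : Diagram := (wordDiagram τ.word).glue τ.pairing

/-- The term `T_τ`. -/
def term (τ : GluingType) : WWedge :=
  ((τ.word.map Letter.coeff).prod * τ.pairing.coeff) • Series.of 0 τ.diagram

end GluingType

/-- The connected types. -/
abbrev ConnectedType : Type := {τ : GluingType // τ.diagram.Connected}

end Weil

end

/-!
The theorem has two halves: the formula for `λ` respects the relations, and `λ` turns the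
exponential of `A + B` into the exponential of the sum over the connected terms.

*Existence of `λ`.* Everything rests on one parity statement. If the legs of a diagram are permuted,
the number of crossings of a pairing changes, modulo two, by the number of inversions of odd legs
that involve a paired leg and are not the inversion of the two legs of a pair (`crossNum_reorder`).
The unpaired odd legs anticommute in `Ŵ_∧`. Hence the contribution `glueTerm P` of a pairing `P` is
multiplied by the sign of all inversions of odd legs, except that the two legs of a pair may be
exchanged freely (`glueTerm_reorder`). So under the exchange of two adjacent `⊥`-legs `i`, `j`
the contributions of the pairings without the pair `{i, j}` cancel, while the others are doubled;
the factor `2` absorbs the weight `1/2` of the pair, and what remains is the sum over the pairings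
of the glued diagram (`glueSum_clifford`). The other relations are compatible with each
pairing separately: at most one of the two legs that they exchange or join is a `⊥`-leg, and AS and
IHX happen away from the legs. As the relations are preserved by juxtaposition (`Rel.between`), the
sum over the pairings descends to the quotient (`gluingMap`). It is unique since diagrams span
(`existsUnique_isLambda`).

*The exponential formula.* The `n`-th power of `A + B` is the sum over all words of length `n`; the
diagram of a word is a family of connected blocks, each with an even number of legs of odd
grade. For such a family, and a partition of its index set into two parts, the contributions
of pairings of the two parts multiply, without a sign, to the contribution of their union
(`glueTerm_combine`): a block passes another one by an even number of inversions of odd legs. In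
particular all these contributions commute (`glueTerm_commute`). Splitting off the connected
component of a given block writes the sum over all pairings of a family as a sum, over the subsets
containing that block, of a connected part times the sum over all pairings of the rest
(`connected_glue_big`, `glueSum_big`).

Let `z` and `c` be the generating series of all and of the connected pairings, in one variable
that records the grade of the parameter legs, and let `θ` be the operator that multiplies a
coefficient by its degree. Weighting every block by the grade of its parameter leg and summing over
the choice of the block turns the splitting into `θ z = θ c · z` (`degreeOp_wordSeries`,
`degreeOp_wordSeries_fin`). As the coefficients of `c` commute, `exp c` satisfies the same equation,
which determines its solution (`exp_of_degreeOp_eq`, `eq_exp_of_recurrence`). Nothing is lost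
in passing to one variable, because all series involved are concentrated in the types `(i, 0)`
(`Series.toPowerSeries`, `sum_letter_pow`, `toPowerSeries_familySum`).
-/

noncomputable section

namespace Weil

open Relation
open Diagram

/-! ### The parity of the number of crossings -/

lemma even_card_of_involution {α : Type*} (s : Finset α) (g : α → α)
    (hs : ∀ a ∈ s, g a ∈ s) (hg : ∀ a ∈ s, g (g a) = a) (hne : ∀ a ∈ s, g a ≠ a) :
    Even s.card := by
  have h : ∑ a ∈ s, (1 : ZMod 2) = 0 :=
    Finset.sum_involution (fun a _ => g a) (fun a _ => by decide) (fun a ha _ => hne a ha)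
      hs hg
  rw [Finset.sum_const, nsmul_one] at h
  exact (ZMod.natCast_eq_zero_iff_even).1 h

/-- For an involution `s` all of whose two-element orbits are thought of as arcs: an auxiliary
ordering of the arcs, followed by the fixed points. -/
structure IsRank {L : Type*} (s : L → L) (r : L → ℕ) : Prop where
  arc : ∀ x, r (s x) = r x
  inj : ∀ x y, r x = r y → y = x ∨ y = s x
  fix : ∀ x l, s x ≠ x → s l = l → r x < r l

lemma exists_isRank {L : Type*} [Finite L] (s : L → L) (hs : ∀ x, s (s x) = x) :
    ∃ r, IsRank s r := by
  classical
  obtain ⟨n, ⟨e⟩⟩ := Finite.exists_equiv_fin L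
  refine ⟨fun x => if s x = x then n + (e x : ℕ) else min (e x : ℕ) (e (s x)), ?_, ?_, ?_⟩
  · intro x
    by_cases h : s x = x
    · simp [h]
    · have h' : x ≠ s x := fun h' => h h'.symm
      simp [h, hs, h', min_comm]
  · intro x y h
    have hx := (e x).2
    have hy := (e y).2
    have hsx := (e (s x)).2
    have hsy := (e (s y)).2
    have inj : ∀ a b : L, (e a : ℕ) = e b → a = b := fun a b hab => e.injective (Fin.ext hab)
    have i1 := inj y x
    have i2 := inj y (s x)
    have i3 := inj (s y) x
    have i4 := inj (s y) (s x)
    have h1 := hs x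
    have h2 := hs y
    by_cases ha : s x = x <;> by_cases hb : s y = y <;> simp only [ha, hb, if_true, if_false] at h
    · left; exact i1 (by omega)
    · omega
    · omega
    · rcases min_choice (e x : ℕ) (e (s x)) with h3 | h3 <;>
      rcases min_choice (e y : ℕ) (e (s y)) with h4 | h4 <;> rw [h3, h4] at h
      · left; exact i1 h.symm
      · right; rw [← i3 h.symm, hs]
      · right; exact i2 h.symm
      · left; rw [← hs y, i4 h.symm, hs]
  · intro x l hx hl
    simp only [hx, hl, if_true, if_false]
    have := (e x).2
    omega

section

variable {L : Type*} [LinearOrder L] [Fintype L]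

open Classical in
/-- The number of crossings of the arcs that join `x` and `s x` for `s x ≠ x`, with each other and
with the lines of the fixed points satisfying `O`. -/
def crossNum (s : L → L) (O : L → Prop) : ℕ :=
  (Finset.univ.filter fun x : L × L => x.1 < x.2 ∧ x.2 < s x.1 ∧ s x.1 < s x.2).card +
  (Finset.univ.filter fun x : L × L => x.1 < x.2 ∧ x.2 < s x.1 ∧ s x.2 = x.2 ∧ O x.2).card

open Classical in
/-- Up to parity, the number of crossings is a number of order relations between legs, where the
set of pairs of legs that are compared does not depend on the order of the legs. -/
lemma crossNum_modEq (s : L → L) (O : L → Prop) (hs : ∀ x, s (s x) = x)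
    (hO : ∀ x, s x ≠ x → O x) (r : L → ℕ) (hr : IsRank s r) :
    crossNum s O ≡ (Finset.univ.filter fun x : L × L =>
      s x.1 ≠ x.1 ∧ r x.1 < r x.2 ∧ O x.2 ∧ x.2 < x.1).card [MOD 2] := by
  obtain ⟨r1, r2, r3⟩ := hr
  set N := Finset.univ.filter fun x : L × L =>
      s x.1 ≠ x.1 ∧ r x.1 < r x.2 ∧ O x.2 ∧ x.2 < x.1 with hN
  -- The pairs with `x.2` on the same side of `x.1` and of `s x.1` cancel.
  have hA : Even (N.filter fun x => x.2 < s x.1).card := by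
    refine even_card_of_involution _ (fun x => (s x.1, x.2)) ?_ ?_ ?_
    · rintro ⟨x, l⟩ h
      simp only [hN, Finset.mem_filter, Finset.mem_univ, true_and, hs, r1] at h ⊢
      tauto
    · rintro ⟨x, l⟩ h
      simp [hs]
    · rintro ⟨x, l⟩ h
      simp only [hN, Finset.mem_filter, Finset.mem_univ, true_and] at h
      simp [h.1.1]
  set B := N.filter fun x => ¬ x.2 < s x.1 with hB
  have hmB : ∀ x l, (x, l) ∈ B ↔ r x < r l ∧ O l ∧ s x < l ∧ l < x := by
    intro x l
    simp only [hB, hN, Finset.mem_filter, Finset.mem_univ, true_and, not_lt]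
    constructor
    · rintro ⟨⟨h1, h2, h3, h4⟩, h5⟩
      refine ⟨h2, h3, lt_of_le_of_ne h5 ?_, h4⟩
      rintro rfl
      rw [r1] at h2
      exact lt_irrefl _ h2
    · rintro ⟨h1, h2, h3, h4⟩
      exact ⟨⟨(h3.trans h4).ne, h1, h2, h4⟩, h3.le⟩
  -- So do those for which both ends of a second arc lie between `s x.1` and `x.1`.
  have hC : Even (B.filter fun x => s x.2 ≠ x.2 ∧ s x.1 < s x.2 ∧ s x.2 < x.1).card := by
    refine even_card_of_involution _ (fun x => (x.1, s x.2)) ?_ ?_ ?_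
    · rintro ⟨x, l⟩ h
      simp only [Finset.mem_filter, hmB, hs, r1] at h ⊢
      obtain ⟨⟨h1, h2, h3, h4⟩, h5, h6, h7⟩ := h
      exact ⟨⟨h1, hO _ (by rw [hs]; exact h5.symm), h6, h7⟩, h5.symm, h3, h4⟩
    · rintro ⟨x, l⟩ h
      simp [hs]
    · rintro ⟨x, l⟩ h
      simp only [Finset.mem_filter] at h
      simp [h.2.1]
  set E := B.filter fun x => ¬ (s x.2 ≠ x.2 ∧ s x.1 < s x.2 ∧ s x.2 < x.1) with hE
  -- In the remaining pairs, `x.1` is the right end of an arc that passes over exactly one end `x.2`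
  -- of an arc or over a fixed odd leg `x.2`. The latter pairs are the crossings of arcs and lines.
  have h1 : (E.filter fun x => s x.2 = x.2).card =
      (Finset.univ.filter fun x : L × L =>
        x.1 < x.2 ∧ x.2 < s x.1 ∧ s x.2 = x.2 ∧ O x.2).card := by
    refine Finset.card_nbij' (fun x => (s x.1, x.2)) (fun x => (s x.1, x.2)) ?_ ?_ ?_ ?_
    · rintro ⟨x, l⟩ h
      simp only [Finset.coe_filter, Set.mem_ofPred_eq, Finset.mem_filter, hE, hmB, Finset.mem_univ,
        hs, true_and] at h ⊢
      tauto
    · rintro ⟨x, l⟩ h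
      simp only [Finset.coe_filter, Set.mem_ofPred_eq, Finset.mem_filter, hE, hmB, Finset.mem_univ,
        hs, true_and] at h ⊢
      have : r (s x) < r l := r3 _ _ (by rw [hs]; exact (h.1.trans h.2.1).ne) h.2.2.1
      tauto
    · rintro ⟨x, l⟩ h; simp [hs]
    · rintro ⟨x, l⟩ h; simp [hs]
  -- The former are the crossings of two arcs; the rank tells which of the two arcs contains `x.1`.
  have h2 : (E.filter fun x => ¬ s x.2 = x.2).card =
      (Finset.univ.filter fun x : L × L => x.1 < x.2 ∧ x.2 < s x.1 ∧ s x.1 < s x.2).card := by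
    refine Finset.card_nbij' (fun x => if x.1 < s x.2 then (s x.1, x.2) else (s x.2, s x.1))
      (fun x => if r x.1 < r x.2 then (s x.1, x.2) else (s x.2, s x.1)) ?_ ?_ ?_ ?_
    · rintro ⟨x, l⟩ h
      simp only [Finset.coe_filter, Set.mem_ofPred_eq, Finset.mem_filter, hE, hmB, Finset.mem_univ,
        true_and] at h ⊢
      obtain ⟨⟨⟨h1, h2, h3, h4⟩, h5⟩, h6⟩ := h
      split_ifs with hx
      · simp only [hs]; exact ⟨h3, h4, hx⟩
      · simp only [hs]
        have e1 : s l ≠ x := by rintro rfl; rw [r1] at h1; exact lt_irrefl _ h1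
        have e2 : s l ≠ s x := by
          intro e
          have : l = x := by rw [← hs l, e, hs]
          rw [this] at h1; exact lt_irrefl _ h1
        have e3 : s l < x := lt_of_le_of_ne (not_lt.1 hx) e1
        refine ⟨?_, h3, h4⟩
        by_contra h
        exact h5 ⟨h6, lt_of_le_of_ne (not_lt.1 h) e2.symm, e3⟩
    · rintro ⟨a, b⟩ h
      simp only [Finset.coe_filter, Set.mem_ofPred_eq, Finset.mem_filter, hE, hmB, Finset.mem_univ,
        true_and] at h ⊢
      obtain ⟨h1, h2, h3⟩ := h
      have e1 : r a ≠ r b := by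
        intro e
        rcases r2 _ _ e with rfl | rfl
        · exact lt_irrefl _ h1
        · exact lt_irrefl _ h2
      split_ifs with hx
      · simp only [hs, r1]
        exact ⟨⟨⟨hx, hO b (h2.trans h3).ne', h1, h2⟩, fun h => lt_asymm h.2.2 h3⟩,
          (h2.trans h3).ne'⟩
      · simp only [hs, r1]
        exact ⟨⟨⟨by omega, hO _ (by rw [hs]; exact (h1.trans h2).ne), h2, h3⟩,
          fun h => lt_asymm h.2.1 h1⟩, (h1.trans h2).ne⟩
    · rintro ⟨x, l⟩ h
      simp only [Finset.coe_filter, Set.mem_ofPred_eq, Finset.mem_filter, hE, hmB] at h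
      have h1 := h.1.1.1
      dsimp only
      split_ifs with hx hy hy
      · simp [hs]
      · simp only [r1] at hy; exact absurd h1 hy
      · simp only [r1] at hy; exact absurd h1 (by omega)
      · simp [hs]
    · rintro ⟨a, b⟩ h
      simp only [Finset.coe_filter, Set.mem_ofPred_eq, Finset.mem_univ, true_and] at h
      obtain ⟨h1, h2, h3⟩ := h
      dsimp only
      by_cases hx : r a < r b
      · simp only [if_pos hx, hs, if_pos h3]
      · simp only [if_neg hx, hs, if_neg (lt_asymm (h1.trans (h2.trans h3)))]
  have e1 := Finset.card_filter_add_card_filter_not (s := N) (fun x => x.2 < s x.1)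
  have e2 := Finset.card_filter_add_card_filter_not (s := B)
    (fun x => s x.2 ≠ x.2 ∧ s x.1 < s x.2 ∧ s x.2 < x.1)
  have e3 := Finset.card_filter_add_card_filter_not (s := E) (fun x => s x.2 = x.2)
  rw [← hB] at e1
  rw [← hE] at e2
  rw [h1, h2] at e3
  obtain ⟨u, hu⟩ := hA
  obtain ⟨v, hv⟩ := hC
  unfold crossNum
  rw [Nat.ModEq]
  omega

end

open Classical in
/-- The number of inversions of a map whose two elements are related by `Q`. -/
def invNum {L L' : Type*} [LinearOrder L] [Fintype L] [LinearOrder L'] (f : L → L')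
    (Q : L → L → Prop) : ℕ :=
  (Finset.univ.filter fun x : L × L => x.1 < x.2 ∧ f x.2 < f x.1 ∧ Q x.1 x.2).card

open Classical in
/-- If the legs are reordered, the parity of the number of crossings changes by the number of
inversions between odd legs that do not belong to the same arc and at least one of which belongs
to an arc. -/
lemma crossNum_reorder {L L' : Type*} [LinearOrder L] [Fintype L] [LinearOrder L'] [Fintype L']
    (f : L ≃ L') (s : L → L) (s' : L' → L') (O : L → Prop) (O' : L' → Prop)
    (hs : ∀ x, s (s x) = x) (hO : ∀ x, s x ≠ x → O x)
    (hf : ∀ x, s' (f x) = f (s x)) (hfO : ∀ x, O' (f x) ↔ O x) :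
    crossNum s O + crossNum s' O' ≡ invNum f (fun x y => O x ∧ O y ∧ y ≠ s x ∧
        ¬ (s x = x ∧ s y = y)) [MOD 2] := by
  suffices h : crossNum s O + crossNum s' O' ≡ (Finset.univ.filter fun x : L × L =>
      x.1 < x.2 ∧ f x.2 < f x.1 ∧ O x.1 ∧ O x.2 ∧ x.2 ≠ s x.1 ∧
        ¬ (s x.1 = x.1 ∧ s x.2 = x.2)).card [MOD 2] by
    unfold invNum
    convert h
  obtain ⟨r, hr⟩ := exists_isRank s hs
  have hs' : ∀ x, s' (s' x) = x := f.forall_congr_right.1 (fun x => by rw [hf, hf, hs])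
  have hO' : ∀ x, s' x ≠ x → O' x := f.forall_congr_right.1 (fun x hx => by
    rw [hfO]; exact hO x (fun h => hx (by rw [hf, h])))
  have hr' : IsRank s' (r ∘ f.symm) := by
    refine ⟨f.forall_congr_right.1 fun x => ?_, f.forall_congr_right.1 fun x =>
      f.forall_congr_right.1 fun y => ?_, f.forall_congr_right.1 fun x =>
      f.forall_congr_right.1 fun y => ?_⟩
    · simp [hf, hr.arc]
    · simpa [hf] using hr.inj x y
    · simpa [hf] using hr.fix x y
  have k1 := crossNum_modEq s O hs hO r hr
  have k2 := crossNum_modEq s' O' hs' hO' _ hr'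
  set N := Finset.univ.filter fun x : L × L =>
      s x.1 ≠ x.1 ∧ r x.1 < r x.2 ∧ O x.2 ∧ x.2 < x.1 with hN
  set N' := Finset.univ.filter fun x : L × L =>
      s x.1 ≠ x.1 ∧ r x.1 < r x.2 ∧ O x.2 ∧ f x.2 < f x.1 with hN'
  have k3 : (Finset.univ.filter fun x : L' × L' =>
      s' x.1 ≠ x.1 ∧ (r ∘ f.symm) x.1 < (r ∘ f.symm) x.2 ∧ O' x.2 ∧ x.2 < x.1).card = N'.card := by
    symm
    refine Finset.card_equiv (f.prodCongr f) ?_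
    rintro ⟨x, y⟩
    simp [hN', hf, hfO]
  rw [k3] at k2
  have e1 := Finset.card_sdiff_add_card_inter N N'
  have e2 := Finset.card_sdiff_add_card_inter N' N
  rw [Finset.inter_comm N' N] at e2
  -- An inversion of the kind that is counted, with the leg of lower rank put first, is a pair that
  -- belongs to exactly one of `N` and `N'`, and conversely.
  have e3 : (Finset.univ.filter fun x : L × L =>
      x.1 < x.2 ∧ f x.2 < f x.1 ∧ O x.1 ∧ O x.2 ∧ x.2 ≠ s x.1 ∧
        ¬ (s x.1 = x.1 ∧ s x.2 = x.2)).card = (N \ N').card + (N' \ N).card := by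
    rw [← Finset.card_union_of_disjoint disjoint_sdiff_sdiff]
    refine Finset.card_nbij'
      (fun x => if s x.1 ≠ x.1 ∧ r x.1 < r x.2 then (x.1, x.2) else (x.2, x.1))
      (fun x => if x.1 < x.2 then (x.1, x.2) else (x.2, x.1)) ?_ ?_ ?_ ?_
    · rintro ⟨x, y⟩ h
      simp only [Finset.coe_filter, Set.mem_ofPred_eq, Finset.mem_univ, true_and] at h
      obtain ⟨h1, h2, h3, h4, h5, h6⟩ := h
      have q : r x ≠ r y := fun e => (hr.inj _ _ e).elim h1.ne' h5
      dsimp only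
      split_ifs with hx
      · simp only [Finset.coe_union, Finset.coe_sdiff, Set.mem_union, Set.mem_sdiff,
          Finset.mem_coe, hN, hN', Finset.mem_filter, Finset.mem_univ, true_and]
        right
        exact ⟨⟨hx.1, hx.2, h4, h2⟩, fun h => lt_asymm h1 h.2.2.2⟩
      · have q1 : s y ≠ y := fun e => by
          by_cases ex : s x = x
          · exact h6 ⟨ex, e⟩
          · exact hx ⟨ex, hr.fix _ _ ex e⟩
        have q2 : r y < r x := by
          by_cases ex : s x = x
          · exact hr.fix _ _ q1 ex
          · have := not_and.1 hx ex
            omega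
        simp only [Finset.coe_union, Finset.coe_sdiff, Set.mem_union, Set.mem_sdiff,
          Finset.mem_coe, hN, hN', Finset.mem_filter, Finset.mem_univ, true_and]
        left
        exact ⟨⟨q1, q2, h3, h1⟩, fun h => lt_asymm h2 h.2.2.2⟩
    · rintro ⟨x, l⟩ h
      simp only [Finset.coe_union, Finset.coe_sdiff, Set.mem_union, Set.mem_sdiff,
          Finset.mem_coe, hN, hN', Finset.mem_filter, Finset.mem_univ, true_and] at h
      have q : ∀ x l, r x < r l → l ≠ x ∧ l ≠ s x := by
        intro x l hxl
        constructor
        · rintro rfl; exact lt_irrefl _ hxl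
        · rintro rfl; rw [hr.arc] at hxl; exact lt_irrefl _ hxl
      have q' : l ≠ s x → x ≠ s l := by
        rintro h1 rfl
        exact h1 (hs l).symm
      dsimp only
      rcases h with ⟨⟨h1, h2, h3, h4⟩, h5⟩ | ⟨⟨h1, h2, h3, h4⟩, h5⟩
      · obtain ⟨q1, q2⟩ := q _ _ h2
        rw [if_neg (lt_asymm h4)]
        have h6 : f x < f l := lt_of_le_of_ne (not_lt.1 fun h => h5 ⟨h1, h2, h3, h⟩)
          (fun e => q1 (f.injective e).symm)
        simp only [Finset.coe_filter, Set.mem_ofPred_eq, Finset.mem_univ, true_and]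
        exact ⟨h4, h6, h3, hO _ h1, q' q2, fun h => h1 h.2⟩
      · obtain ⟨q1, q2⟩ := q _ _ h2
        have h6 : x < l := lt_of_le_of_ne (not_lt.1 fun h => h5 ⟨h1, h2, h3, h⟩) (Ne.symm q1)
        rw [if_pos h6]
        simp only [Finset.coe_filter, Set.mem_ofPred_eq, Finset.mem_univ, true_and]
        exact ⟨h6, h4, hO _ h1, h3, q2, fun h => h1 h.1⟩
    · rintro ⟨x, y⟩ h
      simp only [Finset.coe_filter, Set.mem_ofPred_eq, Finset.mem_univ, true_and] at h
      dsimp only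
      split_ifs with h1 h2 h2
      · rfl
      · exact absurd h.1 h2
      · exact absurd h.1 (lt_asymm h2)
      · rfl
    · rintro ⟨x, l⟩ h
      simp only [Finset.coe_union, Finset.coe_sdiff, Set.mem_union, Set.mem_sdiff,
          Finset.mem_coe, hN, hN', Finset.mem_filter, Finset.mem_univ, true_and] at h
      have h1 : s x ≠ x ∧ r x < r l := by tauto
      have h2 : ¬ (s l ≠ l ∧ r l < r x) := by
        have := h1.2
        rintro ⟨_, h⟩
        omega
      dsimp only
      by_cases h3 : x < l
      · simp only [if_pos h1, if_pos h3]
      · simp only [if_neg h3, if_neg h2]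
  rw [e3]
  rw [Nat.ModEq] at *
  omega

instance (D : Diagram) : Fintype D.L := Fintype.ofFinite _

namespace Diagram

/-! ### Pairings as involutions -/

namespace Pairing

variable {D D' : Diagram}

lemma ext_pairs {P Q : D.Pairing} (h : P.pairs = Q.pairs) : P = Q := by
  cases P; cases Q; simpa using h

/-- A leg is free if it belongs to no pair. -/
def Free (P : D.Pairing) (x : D.L) : Prop := ∀ p ∈ P.pairs, x ∉ p

lemma eq_of_mem {P : D.Pairing} {p q : Finset D.L} (hp : p ∈ P.pairs) (hq : q ∈ P.pairs)
    {x : D.L} (hxp : x ∈ p) (hxq : x ∈ q) : p = q := by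
  by_contra h
  exact Finset.disjoint_left.1 (P.disj p hp q hq h) hxp hxq

lemma ne_of_mem {P : D.Pairing} {x y : D.L} (h : {x, y} ∈ P.pairs) : x ≠ y := by
  rintro rfl
  have := P.card_two _ h
  simp at this

lemma eq_pair {P : D.Pairing} {p : Finset D.L} (hp : p ∈ P.pairs) {x y : D.L} (hx : x ∈ p)
    (hy : y ∈ p) (hxy : x ≠ y) : p = {x, y} := by
  symm
  apply Finset.eq_of_subset_of_card_le
  · intro z hz
    rcases Finset.mem_insert.1 hz with rfl | hz
    · exact hx
    · rw [Finset.mem_singleton.1 hz]; exact hy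
  · rw [P.card_two _ hp, Finset.card_pair hxy]

lemma exists_partner {P : D.Pairing} {p : Finset D.L} (hp : p ∈ P.pairs) {x : D.L}
    (hx : x ∈ p) : ∃ y, x ≠ y ∧ p = {x, y} := by
  obtain ⟨a, b, hab, rfl⟩ := Finset.card_eq_two.1 (P.card_two p hp)
  rcases Finset.mem_insert.1 hx with rfl | hx
  · exact ⟨b, hab, rfl⟩
  · rw [Finset.mem_singleton.1 hx]
    exact ⟨a, hab.symm, Finset.pair_comm a b⟩

lemma ext_mem {P Q : D.Pairing} (h : ∀ x y, {x, y} ∈ P.pairs ↔ {x, y} ∈ Q.pairs) : P = Q := by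
  apply ext_pairs
  ext p
  constructor
  · intro hp
    obtain ⟨a, b, hab, rfl⟩ := Finset.card_eq_two.1 (P.card_two p hp)
    exact (h a b).1 hp
  · intro hp
    obtain ⟨a, b, hab, rfl⟩ := Finset.card_eq_two.1 (Q.card_two p hp)
    exact (h a b).2 hp

open Classical in
/-- The other leg of the pair of a paired leg; a free leg is its own partner. -/
def partner (P : D.Pairing) (x : D.L) : D.L :=
  if h : ∃ y, {x, y} ∈ P.pairs then h.choose else x

lemma partner_eq {P : D.Pairing} {x y : D.L} (h : {x, y} ∈ P.pairs) : P.partner x = y := by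
  have h' : ∃ y, {x, y} ∈ P.pairs := ⟨y, h⟩
  rw [partner, dif_pos h']
  have h2 := h'.choose_spec
  have := eq_of_mem h2 h (Finset.mem_insert_self _ _) (Finset.mem_insert_self _ _)
  have h3 : h'.choose ∈ ({x, y} : Finset D.L) := by rw [← this]; simp
  rcases Finset.mem_insert.1 h3 with h3 | h3
  · exact absurd h3.symm (ne_of_mem h2)
  · exact Finset.mem_singleton.1 h3

lemma partner_eq_self_iff {P : D.Pairing} {x : D.L} : P.partner x = x ↔ P.Free x := by
  constructor
  · intro h p hp hx
    obtain ⟨y, hxy, rfl⟩ := exists_partner hp hx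
    exact hxy (h.symm.trans (partner_eq hp))
  · intro h
    rw [partner, dif_neg]
    rintro ⟨y, hy⟩
    exact h _ hy (Finset.mem_insert_self _ _)

lemma partner_eq_iff {P : D.Pairing} {x y : D.L} (hxy : x ≠ y) :
    P.partner x = y ↔ {x, y} ∈ P.pairs := by
  refine ⟨fun h => ?_, partner_eq⟩
  by_contra hn
  have : ¬ P.Free x := fun hf => hxy ((partner_eq_self_iff.2 hf).symm.trans h)
  simp only [Free, not_forall, not_not] at this
  obtain ⟨p, hp, hx⟩ := this
  obtain ⟨z, hz, rfl⟩ := exists_partner hp hx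
  rw [partner_eq hp] at h
  exact hn (h ▸ hp)

lemma partner_partner (P : D.Pairing) (x : D.L) : P.partner (P.partner x) = x := by
  by_cases h : P.Free x
  · rw [partner_eq_self_iff.2 h, partner_eq_self_iff.2 h]
  · have h1 : x ≠ P.partner x := fun e => h (partner_eq_self_iff.1 e.symm)
    have h2 := (partner_eq_iff h1).1 rfl
    rw [Finset.pair_comm] at h2
    exact partner_eq h2

lemma label_eq_bot {P : D.Pairing} {x : D.L} (h : ¬ P.Free x) : D.label x = Leg.bot := by
  simp only [Free, not_forall, not_not] at h
  obtain ⟨p, hp, hx⟩ := h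
  exact P.bot p hp x hx

end Pairing

/-- The legs of grade one. -/
def IsOdd (D : Diagram) (x : D.L) : Prop := (D.label x).grade = 1

lemma Pairing.odd_of_not_free {D : Diagram} {P : D.Pairing} {x : D.L} (h : ¬ P.Free x) :
    D.IsOdd x := by
  rw [IsOdd, Pairing.label_eq_bot h]
  rfl

lemma Pairing.crossings_eq {D : Diagram} (P : D.Pairing) :
    P.crossings = crossNum P.partner D.IsOdd := by
  classical
  unfold Pairing.crossings crossNum
  congr 1
  · rw [Nat.card_eq_fintype_card, Fintype.card_subtype]
    refine Finset.card_nbij' (fun x => (x.1, x.2.1))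
      (fun x => (x.1, x.2, P.partner x.1, P.partner x.2)) ?_ ?_ ?_ ?_
    · rintro ⟨a, b, c, d⟩ h
      simp only [Finset.coe_filter, Set.mem_ofPred_eq, Finset.mem_univ, true_and] at h ⊢
      rw [Pairing.partner_eq h.2.2.2.1, Pairing.partner_eq h.2.2.2.2]
      exact ⟨h.1, h.2.1, h.2.2.1⟩
    · rintro ⟨a, b⟩ h
      simp only [Finset.coe_filter, Set.mem_ofPred_eq, Finset.mem_univ, true_and] at h ⊢
      exact ⟨h.1, h.2.1, h.2.2, (Pairing.partner_eq_iff (h.1.trans h.2.1).ne).1 rfl,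
        (Pairing.partner_eq_iff (h.2.1.trans h.2.2).ne).1 rfl⟩
    · rintro ⟨a, b, c, d⟩ h
      simp only [Finset.coe_filter, Set.mem_ofPred_eq, Finset.mem_univ, true_and] at h ⊢
      rw [Pairing.partner_eq h.2.2.2.1, Pairing.partner_eq h.2.2.2.2]
    · rintro ⟨a, b⟩ h
      rfl
  · rw [Nat.card_eq_fintype_card, Fintype.card_subtype]
    refine Finset.card_nbij' (fun x => (x.1, x.2.1))
      (fun x => (x.1, x.2, P.partner x.1)) ?_ ?_ ?_ ?_
    · rintro ⟨a, b, c⟩ h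
      simp only [Finset.coe_filter, Set.mem_ofPred_eq, Finset.mem_univ, true_and] at h ⊢
      rw [Pairing.partner_eq h.2.2.1]
      exact ⟨h.1, h.2.1, Pairing.partner_eq_self_iff.2 h.2.2.2.1, h.2.2.2.2⟩
    · rintro ⟨a, b⟩ h
      simp only [Finset.coe_filter, Set.mem_ofPred_eq, Finset.mem_univ, true_and] at h ⊢
      exact ⟨h.1, h.2.1, (Pairing.partner_eq_iff (h.1.trans h.2.1).ne).1 rfl,
        Pairing.partner_eq_self_iff.1 h.2.2.1, h.2.2.2⟩
    · rintro ⟨a, b, c⟩ h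
      simp only [Finset.coe_filter, Set.mem_ofPred_eq, Finset.mem_univ, true_and] at h ⊢
      rw [Pairing.partner_eq h.2.2.1]
    · rintro ⟨a, b⟩ h
      rfl

/-! ### Isomorphisms that do not preserve the order of the legs -/

/-- Isomorphisms of diagrams, except that the order of the legs need not be preserved. -/
structure WeakIso (D D' : Diagram) where
  onV : D.V ≃ D'.V
  rot : D.V → Fin 3
  onL : D.L ≃ D'.L
  onE : D.E ≃ D'.E
  label_eq : ∀ l, D'.label (onL l) = D.label l
  att_vertex : ∀ v k, D'.att (Sum.inl (onV v, k + rot v)) = onE (D.att (Sum.inl (v, k)))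
  att_leg : ∀ l, D'.att (Sum.inr (onL l)) = onE (D.att (Sum.inr l))

variable {D D' : Diagram}

def Iso.toWeakIso (f : Iso D D') : WeakIso D D' where
  onV := f.onV
  rot := f.rot
  onL := f.onL.toEquiv
  onE := f.onE
  label_eq := f.label_eq
  att_vertex := f.att_vertex
  att_leg := f.att_leg

def WeakIso.toIso (f : WeakIso D D') (hf : StrictMono f.onL) : Iso D D' where
  onV := f.onV
  rot := f.rot
  onL := ⟨f.onL, hf.le_iff_le⟩
  onE := f.onE
  label_eq := f.label_eq
  att_vertex := f.att_vertex
  att_leg := f.att_leg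

lemma WeakIso.odd_iff (f : WeakIso D D') (x : D.L) : D'.IsOdd (f.onL x) ↔ D.IsOdd x := by
  rw [IsOdd, f.label_eq, IsOdd]

/-- The image of a pairing under an injection of the legs. -/
def Pairing.mapEmb (P : D.Pairing) (f : D.L ↪ D'.L) (hf : ∀ l, D'.label (f l) = D.label l) :
    D'.Pairing where
  pairs := P.pairs.map ⟨Finset.map f, Finset.map_injective _⟩
  card_two := by
    intro p hp
    obtain ⟨q, hq, rfl⟩ := Finset.mem_map.1 hp
    simpa using P.card_two q hq
  bot := by
    intro p hp l hl
    obtain ⟨q, hq, rfl⟩ := Finset.mem_map.1 hp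
    obtain ⟨k, hk, rfl⟩ := Finset.mem_map.1 hl
    exact (hf k).trans (P.bot q hq k hk)
  disj := by
    intro p hp q hq hpq
    obtain ⟨p, hp', rfl⟩ := Finset.mem_map.1 hp
    obtain ⟨q, hq', rfl⟩ := Finset.mem_map.1 hq
    simp only [Function.Embedding.coeFn_mk, Finset.disjoint_map]
    exact P.disj p hp' q hq' (fun h => hpq (by rw [h]))

lemma Pairing.mem_mapEmb {P : D.Pairing} {f : D.L ↪ D'.L} {hf} {p : Finset D'.L} :
    p ∈ (P.mapEmb f hf).pairs ↔ ∃ q ∈ P.pairs, q.map f = p := by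
  simp [Pairing.mapEmb]

lemma Pairing.pair_mem_mapEmb {P : D.Pairing} {f : D.L ↪ D'.L} {hf} {x y : D.L} :
    {f x, f y} ∈ (P.mapEmb f hf).pairs ↔ {x, y} ∈ P.pairs := by
  have h : ({f x, f y} : Finset D'.L) = ({x, y} : Finset D.L).map f := by simp
  rw [Pairing.mem_mapEmb, h]
  constructor
  · rintro ⟨q, hq, e⟩
    rwa [← Finset.map_injective _ e]
  · intro h
    exact ⟨_, h, rfl⟩

open Classical in
/-- The restriction of a pairing along an injection of the legs: the pairs with both legs in the
image remain. -/
def Pairing.comap (P : D'.Pairing) (f : D.L ↪ D'.L) (hf : ∀ l, D'.label (f l) = D.label l) :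
    D.Pairing where
  pairs := Finset.univ.filter fun p => p.map f ∈ P.pairs
  card_two := by
    intro p hp
    have := P.card_two _ (Finset.mem_filter.1 hp).2
    rwa [Finset.card_map] at this
  bot := by
    intro p hp l hl
    rw [← hf]
    exact P.bot _ (Finset.mem_filter.1 hp).2 _ (Finset.mem_map_of_mem f hl)
  disj := by
    intro p hp q hq hpq
    have := P.disj _ (Finset.mem_filter.1 hp).2 _ (Finset.mem_filter.1 hq).2
      (fun h => hpq (Finset.map_injective _ h))
    rwa [Finset.disjoint_map] at this

lemma Pairing.mem_comap {P : D'.Pairing} {f : D.L ↪ D'.L} {hf} {p : Finset D.L} :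
    p ∈ (P.comap f hf).pairs ↔ p.map f ∈ P.pairs := by
  simp [Pairing.comap]

lemma Pairing.comap_mapEmb (P : D.Pairing) (f : D.L ↪ D'.L) (hf hf') :
    (P.mapEmb f hf).comap f hf' = P := by
  apply Pairing.ext_pairs
  ext p
  rw [Pairing.mem_comap, Pairing.mem_mapEmb]
  constructor
  · rintro ⟨q, hq, e⟩
    rwa [← Finset.map_injective _ e]
  · intro h
    exact ⟨_, h, rfl⟩

/-- The image of a pairing under a bijection of the legs. -/
abbrev Pairing.map (P : D.Pairing) (f : D.L ≃ D'.L) (hf : ∀ l, D'.label (f l) = D.label l) :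
    D'.Pairing := P.mapEmb f.toEmbedding hf

lemma Pairing.mem_map {P : D.Pairing} {f : D.L ≃ D'.L} {hf} {p : Finset D'.L} :
    p ∈ (P.map f hf).pairs ↔ ∃ q ∈ P.pairs, q.map f.toEmbedding = p := Pairing.mem_mapEmb

lemma Pairing.pair_mem_map {P : D.Pairing} {f : D.L ≃ D'.L} {hf} {x y : D.L} :
    {f x, f y} ∈ (P.map f hf).pairs ↔ {x, y} ∈ P.pairs :=
  Pairing.pair_mem_mapEmb (f := f.toEmbedding)

lemma Pairing.free_map {P : D.Pairing} {f : D.L ≃ D'.L} {hf} {x : D.L} :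
    (P.map f hf).Free (f x) ↔ P.Free x := by
  simp [Pairing.Free, Pairing.mem_mapEmb]

lemma Pairing.partner_map {P : D.Pairing} {f : D.L ≃ D'.L} {hf} (x : D.L) :
    (P.map f hf).partner (f x) = f (P.partner x) := by
  by_cases h : P.Free x
  · rw [Pairing.partner_eq_self_iff.2 h, Pairing.partner_eq_self_iff.2 (Pairing.free_map.2 h)]
  · have h1 : x ≠ P.partner x := fun e => h (Pairing.partner_eq_self_iff.1 e.symm)
    exact Pairing.partner_eq (Pairing.pair_mem_map.2 ((Pairing.partner_eq_iff h1).1 rfl))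

/-- A bijection of the legs induces a bijection of the pairings. -/
def Pairing.mapEquiv (f : D.L ≃ D'.L) (hf : ∀ l, D'.label (f l) = D.label l) :
    D.Pairing ≃ D'.Pairing where
  toFun P := P.map f hf
  invFun P := P.map f.symm (fun l => by rw [← hf, f.apply_symm_apply])
  left_inv P := by
    apply Pairing.ext_mem
    intro x y
    have h := Pairing.pair_mem_map (P := P.map f hf) (f := f.symm)
      (hf := fun l => by rw [← hf, f.apply_symm_apply]) (x := f x) (y := f y)
    rw [f.symm_apply_apply, f.symm_apply_apply, Pairing.pair_mem_map] at h
    exact h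
  right_inv P := by
    apply Pairing.ext_mem
    refine f.forall_congr_right.1 fun x => f.forall_congr_right.1 fun y => ?_
    rw [Pairing.pair_mem_map]
    have h := Pairing.pair_mem_map (P := P) (f := f.symm)
      (hf := fun l => by rw [← hf, f.apply_symm_apply]) (x := f x) (y := f y)
    rw [f.symm_apply_apply, f.symm_apply_apply] at h
    exact h

/-- The edges of a glued diagram only depend on the edges, the legs and how they are attached. -/
def meetEquiv (P : D.Pairing) (f : D.L ≃ D'.L) (hf : ∀ l, D'.label (f l) = D.label l)
    (g : D.E ≃ D'.E) (hg : ∀ l, D'.att (Sum.inr (f l)) = g (D.att (Sum.inr l))) :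
    Quot (D.Meet P.pairs) ≃ Quot (D'.Meet (P.map f hf).pairs) :=
  Quot.congr g (by
    intro e e'
    constructor
    · rintro ⟨p, hp, i, hi, j, hj, rfl, rfl⟩
      exact ⟨_, Pairing.mem_map.2 ⟨p, hp, rfl⟩, f i, by simpa using hi, f j, by simpa using hj,
        hg i, hg j⟩
    · rintro ⟨p, hp, i, hi, j, hj, h1, h2⟩
      obtain ⟨q, hq, rfl⟩ := Pairing.mem_map.1 hp
      obtain ⟨i, hi', rfl⟩ := Finset.mem_map.1 hi
      obtain ⟨j, hj', rfl⟩ := Finset.mem_map.1 hj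
      exact ⟨q, hq, i, hi', j, hj', g.injective ((hg i).symm.trans h1),
        g.injective ((hg j).symm.trans h2)⟩)

/-- A weak isomorphism of diagrams induces one of the glued diagrams. -/
def WeakIso.glue (f : WeakIso D D') (P : D.Pairing) :
    WeakIso (D.glue P) (D'.glue (P.map f.onL f.label_eq)) where
  onV := f.onV
  rot := f.rot
  onL := f.onL.subtypeEquiv (fun _ => Pairing.free_map.symm)
  onE := meetEquiv P f.onL f.label_eq f.onE f.att_leg
  label_eq := fun l => f.label_eq l.1
  att_vertex := fun v k => congrArg (Quot.mk _) (f.att_vertex v k)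
  att_leg := fun l => congrArg (Quot.mk _) (f.att_leg l.1)

end Diagram

/-! ### Inversions -/

section

variable {L L' : Type*} [LinearOrder L] [Fintype L] [LinearOrder L']

lemma invNum_congr {f : L → L'} {Q R : L → L → Prop}
    (h : ∀ x y, x < y → f y < f x → (Q x y ↔ R x y)) : invNum f Q = invNum f R := by
  unfold invNum
  congr 1
  ext ⟨x, y⟩
  simp only [Finset.mem_filter, Finset.mem_univ, true_and]
  have := h x y
  tauto

lemma invNum_eq_ncard (f : L → L') (Q : L → L → Prop) :
    invNum f Q = {x : L × L | x.1 < x.2 ∧ f x.2 < f x.1 ∧ Q x.1 x.2}.ncard := by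
  classical
  rw [Set.ncard_eq_toFinset_card', Set.toFinset_ofPred]
  unfold invNum
  congr!

lemma invNum_split (f : L → L') (Q R : L → L → Prop) :
    invNum f Q = invNum f (fun x y => Q x y ∧ R x y) + invNum f (fun x y => Q x y ∧ ¬ R x y) := by
  rw [invNum_eq_ncard, invNum_eq_ncard, invNum_eq_ncard,
    ← Set.ncard_union_eq _ (Set.toFinite _) (Set.toFinite _)]
  · congr 1
    ext ⟨x, y⟩
    simp only [Set.mem_union, Set.mem_ofPred_eq]
    tauto
  · rw [Set.disjoint_left]
    rintro ⟨x, y⟩ h h'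
    exact h'.2.2.2 h.2.2.2

lemma invNum_eq_zero_iff {f : L → L'} {Q : L → L → Prop} :
    invNum f Q = 0 ↔ ∀ x y, x < y → f y < f x → ¬ Q x y := by
  rw [invNum_eq_ncard, Set.ncard_eq_zero (Set.toFinite _), Set.eq_empty_iff_forall_notMem]
  constructor
  · exact fun h x y h1 h2 h3 => h (x, y) ⟨h1, h2, h3⟩
  · rintro h ⟨x, y⟩ ⟨h1, h2, h3⟩
    exact h x y h1 h2 h3

omit [Fintype L] in
open Classical in
lemma swap_lt_swap {i j x y : L} (hij : i ⋖ j) (hxy : x < y) (h : ¬ (x = i ∧ y = j)) :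
    Equiv.swap i j x < Equiv.swap i j y := by
  have h1 : ∀ z, i < z → z ≠ j → j < z := fun z hz hzj =>
    lt_of_le_of_ne (not_lt.1 fun h => hij.2 hz h) hzj.symm
  have h2 : ∀ z, z < j → z ≠ i → z < i := fun z hz hzi =>
    lt_of_le_of_ne (not_lt.1 fun h => hij.2 h hz) hzi
  have h3 := hij.lt
  by_cases x1 : x = i
  · subst x1
    have : y ≠ j := fun e => h ⟨rfl, e⟩
    rw [Equiv.swap_apply_left, Equiv.swap_apply_of_ne_of_ne hxy.ne' this]
    exact h1 y hxy this
  · by_cases x2 : x = j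
    · subst x2
      rw [Equiv.swap_apply_right, Equiv.swap_apply_of_ne_of_ne (h3.trans hxy).ne' hxy.ne']
      exact h3.trans hxy
    · rw [Equiv.swap_apply_of_ne_of_ne x1 x2]
      by_cases y1 : y = i
      · subst y1
        rw [Equiv.swap_apply_left]
        exact hxy.trans h3
      · by_cases y2 : y = j
        · subst y2
          rw [Equiv.swap_apply_right]
          exact h2 x hxy x1
        · rwa [Equiv.swap_apply_of_ne_of_ne y1 y2]

open Classical in
/-- The exchange of two neighbours that are inverted removes exactly this inversion. -/
lemma invNum_swap (f : L → L') (Q : L → L → Prop) {i j : L} (hij : i ⋖ j) (h : f j < f i) :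
    invNum f Q = invNum (f ∘ Equiv.swap i j)
      (fun x y => Q (Equiv.swap i j x) (Equiv.swap i j y)) + if Q i j then 1 else 0 := by
  unfold invNum
  rw [← Finset.card_filter_add_card_filter_not (fun x : L × L => ¬ (x.1 = i ∧ x.2 = j))]
  congr 1
  · refine Finset.card_nbij' (fun x => (Equiv.swap i j x.1, Equiv.swap i j x.2))
      (fun x => (Equiv.swap i j x.1, Equiv.swap i j x.2)) ?_ ?_ ?_ ?_
    · rintro ⟨x, y⟩ hx
      simp only [Finset.coe_filter, Set.mem_ofPred_eq, Finset.mem_univ, true_and,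
        Finset.mem_filter, Function.comp_apply, Equiv.swap_apply_self] at hx ⊢
      exact ⟨swap_lt_swap hij hx.1.1 hx.2, hx.1.2⟩
    · rintro ⟨x, y⟩ hx
      simp only [Finset.coe_filter, Set.mem_ofPred_eq, Finset.mem_univ, true_and,
        Finset.mem_filter, Function.comp_apply] at hx ⊢
      have hxy : ¬ (x = i ∧ y = j) := by
        rintro ⟨rfl, rfl⟩
        rw [Equiv.swap_apply_left, Equiv.swap_apply_right] at hx
        exact lt_asymm h hx.2.1
      refine ⟨⟨swap_lt_swap hij hx.1 hxy, hx.2⟩, ?_⟩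
      rintro ⟨h1, h2⟩
      rw [Equiv.swap_apply_eq_iff, Equiv.swap_apply_left] at h1
      rw [Equiv.swap_apply_eq_iff, Equiv.swap_apply_right] at h2
      subst h1 h2
      exact lt_asymm hij.lt hx.1
    · rintro ⟨x, y⟩ hx; simp
    · rintro ⟨x, y⟩ hx; simp
  · split_ifs with hq
    · rw [Finset.card_eq_one]
      refine ⟨(i, j), ?_⟩
      ext ⟨x, y⟩
      simp only [not_not, Finset.mem_filter, Finset.mem_univ, true_and, Finset.mem_singleton,
        Prod.mk.injEq]
      constructor
      · exact fun h => h.2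
      · rintro ⟨rfl, rfl⟩
        exact ⟨⟨hij.lt, h, hq⟩, rfl, rfl⟩
    · rw [Finset.card_eq_zero, Finset.filter_eq_empty_iff]
      rintro ⟨x, y⟩ hx h'
      simp only [not_not, Finset.mem_filter, Finset.mem_univ, true_and] at hx h'
      obtain ⟨rfl, rfl⟩ := h'
      exact hq hx.2.2

end

/-! ### Reordering the legs -/

lemma mk_eq_of_rel {κ : ℚ} {x y : Formal} (h : Rel κ x y) :
    RingQuot.mkAlgHom ℚ (Rel κ) x = RingQuot.mkAlgHom ℚ (Rel κ) y :=
  RingQuot.mkAlgHom_rel ℚ h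

lemma formal_congr {D D' : Diagram} (f : Iso D D') : formal D = formal D' := by
  have : D.isoClass = D'.isoClass := Quotient.sound ⟨f⟩
  rw [formal, formal, this]

lemma cls_congr (κ : ℚ) {D D' : Diagram} (f : Iso D D') : cls κ D = cls κ D' := by
  rw [cls, cls, formal_congr f]

open Classical in
/-- Two exchanges of the same legs cancel. -/
def swapSwap (D : Diagram) (i j : D.L) : Iso ((D.swapLegs i j).swapLegs i j) D where
  onV := Equiv.refl _
  rot := fun _ => 0
  onL := OrderIso.refl _
  onE := Equiv.refl _
  label_eq := fun l => congrArg D.label (Equiv.swap_apply_self i j l).symm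
  att_vertex := fun v k => by rw [add_zero]; rfl
  att_leg := fun l => congrArg (fun l => D.att (Sum.inr l)) (Equiv.swap_apply_self i j l).symm

open Classical in
/-- The exchange of two legs as a weak isomorphism. -/
def swapWeakIso (D : Diagram) (i j : D.L) : WeakIso D (D.swapLegs i j) where
  onV := Equiv.refl _
  rot := fun _ => 0
  onL := Equiv.swap i j
  onE := Equiv.refl _
  label_eq := fun l => congrArg D.label (Equiv.swap_apply_self i j l)
  att_vertex := fun v k => by rw [add_zero]; rfl
  att_leg := fun l => congrArg (fun l => D.att (Sum.inr l)) (Equiv.swap_apply_self i j l)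

lemma cls_swap_of_formal (κ : ℚ) (D : Diagram) {i j : D.L} (hij : i ⋖ j)
    (h : (D.label i).IsFormal ∨ (D.label j).IsFormal) :
    cls κ D = (-1 : ℚ) ^ ((D.label i).grade * (D.label j).grade) • cls κ (D.swapLegs i j) := by
  have := mk_eq_of_rel (Rel.move (κ := κ) D i j hij h)
  rwa [map_smul] at this

open Classical in
lemma neg_one_pow_grade (x y : Leg) : (-1 : ℚ) ^ (x.grade * y.grade) =
    (-1) ^ (if x.grade = 1 ∧ y.grade = 1 then 1 else 0) := by
  cases x <;> cases y <;> simp [Leg.grade] <;> norm_num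

lemma neg_one_smul_space {κ : ℚ} (x : Space κ) : (-1 : ℚ) • x = -x := neg_one_smul ℚ x

open Classical in
lemma cls_swap (D : Diagram) {i j : D.L} (hij : i ⋖ j)
    (h : ¬ (D.label i = Leg.curv ∧ D.label j = Leg.curv)) :
    cls 0 D = (-1 : ℚ) ^ (if D.IsOdd i ∧ D.IsOdd j then 1 else 0) • cls 0 (D.swapLegs i j) := by
  by_cases hf : (D.label i).IsFormal ∨ (D.label j).IsFormal
  · rw [cls_swap_of_formal 0 D hij hf, neg_one_pow_grade]
    congr!
  · simp only [Leg.IsFormal, not_or, not_and_or, not_not] at hf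
    rcases hf with ⟨hi | hi, hj | hj⟩
    · have h1 := mk_eq_of_rel (Rel.clifford (κ := 0) D i j hij hi hj)
      rw [zero_smul, map_zero, map_add] at h1
      have h2 : D.IsOdd i ∧ D.IsOdd j := by simp [IsOdd, hi, hj, Leg.grade]
      rw [if_pos h2, pow_one, neg_one_smul_space]
      exact eq_neg_of_add_eq_zero_left h1
    · have h2 : ¬ (D.IsOdd i ∧ D.IsOdd j) := by simp [IsOdd, hi, hj, Leg.grade]
      rw [if_neg h2, pow_zero, one_smul]
      have h1 := mk_eq_of_rel (Rel.comm (κ := 0) (D.swapLegs i j) i j hij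
        (by rw [← hj]; exact congrArg D.label (Equiv.swap_apply_left i j))
        (by rw [← hi]; exact congrArg D.label (Equiv.swap_apply_right i j)))
      rw [formal_congr (swapSwap D i j)] at h1
      exact h1.symm
    · have h2 : ¬ (D.IsOdd i ∧ D.IsOdd j) := by simp [IsOdd, hi, hj, Leg.grade]
      rw [if_neg h2, pow_zero, one_smul]
      exact mk_eq_of_rel (Rel.comm (κ := 0) D i j hij hi hj)
    · exact absurd ⟨hi, hj⟩ h

/-- In `Ŵ_∧`, the legs of a diagram may be reordered, as long as no curvature legs are interchanged,
with the sign given by the inversions among the legs of grade one. -/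
lemma cls_reorder {D D' : Diagram} (f : WeakIso D D')
    (hf : ∀ x y, x < y → f.onL y < f.onL x →
      ¬ (D.label x = Leg.curv ∧ D.label y = Leg.curv)) :
    cls 0 D = (-1 : ℚ) ^ invNum f.onL (fun x y => D.IsOdd x ∧ D.IsOdd y) • cls 0 D' := by
  classical
  induction hn : invNum f.onL (fun _ _ => True) generalizing D with
  | zero =>
    have hmono : StrictMono f.onL := by
      intro x y hxy
      refine lt_of_le_of_ne (not_lt.1 fun h => ?_) (fun h => hxy.ne (f.onL.injective h))
      exact invNum_eq_zero_iff.1 hn x y hxy h trivial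
    have h0 : invNum f.onL (fun x y => D.IsOdd x ∧ D.IsOdd y) = 0 :=
      invNum_eq_zero_iff.2 fun x y hxy h => absurd (hmono hxy) (lt_asymm h)
    rw [h0, pow_zero, one_smul]
    exact cls_congr 0 (f.toIso hmono)
  | succ n ih =>
    let _ : LocallyFiniteOrder D.L := Fintype.toLocallyFiniteOrder
    -- A map with an inversion inverts two neighbours; exchanging these removes one inversion.
    have : ∃ i j : D.L, i ⋖ j ∧ f.onL j < f.onL i := by
      by_contra hc
      push Not at hc
      have hmono : StrictMono f.onL := (strictMono_iff_forall_covBy _).2 fun i j hij =>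
        lt_of_le_of_ne (hc i j hij) (fun h => hij.lt.ne (f.onL.injective h))
      rw [invNum_eq_zero_iff.2 fun x y hxy h => absurd (hmono hxy) (lt_asymm h)] at hn
      exact absurd hn (by simp)
    obtain ⟨i, j, hij, hji⟩ := this
    let g : WeakIso (D.swapLegs i j) D' :=
      { onV := f.onV
        rot := f.rot
        onL := (Equiv.swap i j).trans f.onL
        onE := f.onE
        label_eq := fun l => f.label_eq _
        att_vertex := f.att_vertex
        att_leg := fun l => f.att_leg _ }
    have h1 := invNum_swap f.onL (fun _ _ => True) hij hji
    have h2 := invNum_swap f.onL (fun x y => D.IsOdd x ∧ D.IsOdd y) hij hji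
    rw [if_pos trivial, hn] at h1
    have key := ih g (by
      intro x y hxy hg
      have hxy' : ¬ (x = i ∧ y = j) := by
        rintro ⟨h3, h4⟩
        have : f.onL (Equiv.swap i j y) < f.onL (Equiv.swap i j x) := hg
        rw [h3, h4, Equiv.swap_apply_left, Equiv.swap_apply_right] at this
        exact lt_asymm this hji
      exact hf _ _ (swap_lt_swap hij hxy hxy') hg) (Nat.succ_injective h1.symm)
    rw [cls_swap D hij (hf i j hij.lt hji), key, smul_smul, ← pow_add, h2, add_comm]
    congr 3
    split_ifs <;> rfl

/-- The contribution of a pairing to the value of `λ` at a diagram. -/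
def glueTerm {D : Diagram} (P : D.Pairing) : Space 0 := P.coeff • cls 0 (D.glue P)

lemma Diagram.Pairing.coeff_reorder {D D' : Diagram} (f : WeakIso D D') (P : D.Pairing) :
    P.coeff = (-1) ^ invNum f.onL (fun x y => (D.IsOdd x ∧ D.IsOdd y) ∧ {x, y} ∉ P.pairs ∧
      ¬ (P.Free x ∧ P.Free y)) * (P.map f.onL f.label_eq).coeff := by
  have h := crossNum_reorder f.onL P.partner (P.map f.onL f.label_eq).partner D.IsOdd D'.IsOdd
    P.partner_partner (fun x hx => Pairing.odd_of_not_free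
      (fun hF => hx (Pairing.partner_eq_self_iff.2 hF))) Pairing.partner_map f.odd_iff
  rw [← Pairing.crossings_eq, ← Pairing.crossings_eq] at h
  have h2 : invNum f.onL (fun x y => (D.IsOdd x ∧ D.IsOdd y) ∧ {x, y} ∉ P.pairs ∧
      ¬ (P.Free x ∧ P.Free y)) = invNum f.onL (fun x y => D.IsOdd x ∧ D.IsOdd y ∧ y ≠ P.partner x ∧
        ¬ (P.partner x = x ∧ P.partner y = y)) := by
    refine invNum_congr fun x y hxy _ => ?_
    rw [Pairing.partner_eq_self_iff, Pairing.partner_eq_self_iff, and_assoc,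
      ← Pairing.partner_eq_iff hxy.ne, eq_comm, ne_eq]
  rw [h2]
  unfold Pairing.coeff
  have hc : (P.map f.onL f.label_eq).pairs.card = P.pairs.card := by simp [Pairing.mapEmb]
  rw [hc, ← mul_assoc, ← pow_add]
  congr 1
  refine neg_one_pow_congr ?_
  rw [← Nat.not_odd_iff_even, ← Nat.not_odd_iff_even, Nat.odd_iff, Nat.odd_iff]
  rw [Nat.ModEq] at h
  omega

/-- The contribution of a pairing when the legs are reordered: the sign is given by the inversions
among all legs of grade one, except that the inversions of the two legs of a pair do not count. -/
lemma glueTerm_reorder {D D' : Diagram} (f : WeakIso D D') (P : D.Pairing)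
    (hf : ∀ x y, x < y → f.onL y < f.onL x →
      ¬ (D.label x = Leg.curv ∧ D.label y = Leg.curv)) :
    glueTerm P = (-1 : ℚ) ^ (invNum f.onL (fun x y => D.IsOdd x ∧ D.IsOdd y) +
      invNum f.onL (fun x y => {x, y} ∈ P.pairs)) • glueTerm (P.map f.onL f.label_eq) := by
  classical
  have h1 := P.coeff_reorder f
  have h2 := cls_reorder (f.glue P) (fun x y hxy h => hf x.1 y.1 hxy h)
  have h3 : invNum (f.glue P).onL (fun x y => (D.glue P).IsOdd x ∧ (D.glue P).IsOdd y) =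
      invNum f.onL (fun x y => (D.IsOdd x ∧ D.IsOdd y) ∧ (P.Free x ∧ P.Free y)) := by
    unfold invNum
    refine Finset.card_nbij (fun x => (x.1.1, x.2.1)) ?_ ?_ ?_
    · rintro ⟨x, y⟩ h
      simp only [Finset.coe_filter, Set.mem_ofPred_eq, Finset.mem_univ, true_and] at h ⊢
      exact ⟨h.1, h.2.1, h.2.2, x.2, y.2⟩
    · rintro ⟨x, y⟩ _ ⟨x', y'⟩ _ h
      simp only [Prod.mk.injEq] at h
      rw [Prod.mk.injEq]
      exact ⟨Subtype.ext h.1, Subtype.ext h.2⟩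
    · rintro ⟨x, y⟩ h
      simp only [Finset.coe_filter, Set.mem_ofPred_eq, Finset.mem_univ, true_and] at h
      refine ⟨(⟨x, h.2.2.2.1⟩, ⟨y, h.2.2.2.2⟩), ?_, rfl⟩
      simp only [Finset.coe_filter, Set.mem_ofPred_eq, Finset.mem_univ, true_and]
      exact ⟨h.1, h.2.1, h.2.2.1⟩
  have h4 := invNum_split f.onL (fun x y => D.IsOdd x ∧ D.IsOdd y) (fun x y => P.Free x ∧ P.Free y)
  have h5 := invNum_split f.onL (fun x y => (D.IsOdd x ∧ D.IsOdd y) ∧ ¬ (P.Free x ∧ P.Free y))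
    (fun x y => {x, y} ∈ P.pairs)
  have h6 : invNum f.onL (fun x y => ((D.IsOdd x ∧ D.IsOdd y) ∧ ¬ (P.Free x ∧ P.Free y)) ∧
      {x, y} ∈ P.pairs) = invNum f.onL (fun x y => {x, y} ∈ P.pairs) := by
    refine invNum_congr fun x y _ _ => ⟨fun h => h.2, fun h => ⟨⟨⟨?_, ?_⟩, ?_⟩, h⟩⟩
    · exact Pairing.odd_of_not_free fun hF => hF _ h (by simp)
    · exact Pairing.odd_of_not_free fun hF => hF _ h (by simp)
    · exact fun hF => hF.1 _ h (by simp)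
  have h7 : invNum f.onL (fun x y => ((D.IsOdd x ∧ D.IsOdd y) ∧ ¬ (P.Free x ∧ P.Free y)) ∧
      ¬ {x, y} ∈ P.pairs) = invNum f.onL (fun x y => (D.IsOdd x ∧ D.IsOdd y) ∧ {x, y} ∉ P.pairs ∧
      ¬ (P.Free x ∧ P.Free y)) := by
    refine invNum_congr fun x y _ _ => by tauto
  rw [h6, h7] at h5
  unfold glueTerm
  rw [h2, h3, h1, smul_smul, smul_smul]
  congr 1
  rw [mul_right_comm, ← pow_add]
  congr 1
  refine neg_one_pow_congr ?_
  rw [← Nat.not_odd_iff_even, ← Nat.not_odd_iff_even, Nat.odd_iff, Nat.odd_iff]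
  omega

/-! ### Crossings and the addition or removal of legs -/

/-- The number of crossings is not affected by legs whose arcs and lines meet nothing. -/
lemma crossNum_of_strictMono {L L' : Type*} [LinearOrder L] [Fintype L] [LinearOrder L']
    [Fintype L'] (g : L' → L) (hg : StrictMono g) {s : L → L} {s' : L' → L'} {O : L → Prop}
    {O' : L' → Prop} (hs : ∀ x, s (g x) = g (s' x)) (hO : ∀ x, O (g x) ↔ O' x)
    (h1 : ∀ x ∉ Set.range g, ∀ y, x < y → ¬ y < s x)
    (h2 : ∀ x ∉ Set.range g, s x = x → ¬ O x) : crossNum s O = crossNum s' O' := by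
  classical
  unfold crossNum
  congr 1
  · symm
    refine Finset.card_nbij (Prod.map g g) ?_ (hg.injective.prodMap hg.injective).injOn ?_
    · rintro ⟨x, y⟩ h
      simp only [Finset.coe_filter, Set.mem_ofPred_eq, Finset.mem_univ, true_and,
        Prod.map_apply, hs, hg.lt_iff_lt] at h ⊢
      exact h
    · rintro ⟨x, y⟩ h
      simp only [Finset.coe_filter, Set.mem_ofPred_eq, Finset.mem_univ, true_and] at h
      have hx : x ∈ Set.range g := by
        by_contra hx
        exact h1 x hx y h.1 h.2.1
      have hy : y ∈ Set.range g := by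
        by_contra hy
        exact h1 y hy _ h.2.1 h.2.2
      obtain ⟨x, rfl⟩ := hx
      obtain ⟨y, rfl⟩ := hy
      refine ⟨(x, y), ?_, rfl⟩
      simpa [hs, hg.lt_iff_lt] using h
  · symm
    refine Finset.card_nbij (Prod.map g g) ?_ (hg.injective.prodMap hg.injective).injOn ?_
    · rintro ⟨x, y⟩ h
      simp only [Finset.coe_filter, Set.mem_ofPred_eq, Finset.mem_univ, true_and,
        Prod.map_apply, hs, hg.lt_iff_lt, hO, hg.injective.eq_iff] at h ⊢
      exact h
    · rintro ⟨x, y⟩ h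
      simp only [Finset.coe_filter, Set.mem_ofPred_eq, Finset.mem_univ, true_and] at h
      have hx : x ∈ Set.range g := by
        by_contra hx
        exact h1 x hx y h.1 h.2.1
      have hy : y ∈ Set.range g := by
        by_contra hy
        exact h2 y hy h.2.2.1 h.2.2.2
      obtain ⟨x, rfl⟩ := hx
      obtain ⟨y, rfl⟩ := hy
      refine ⟨(x, y), ?_, rfl⟩
      simpa [hs, hg.lt_iff_lt, hO, hg.injective.eq_iff] using h

lemma crossNum_eq_ncard {L : Type*} [LinearOrder L] [Fintype L] (s : L → L) (O : L → Prop) :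
    crossNum s O = {x : L × L | x.1 < x.2 ∧ x.2 < s x.1 ∧ s x.1 < s x.2}.ncard +
      {x : L × L | x.1 < x.2 ∧ x.2 < s x.1 ∧ s x.2 = x.2 ∧ O x.2}.ncard := by
  classical
  rw [Set.ncard_eq_toFinset_card', Set.ncard_eq_toFinset_card', Set.toFinset_ofPred,
    Set.toFinset_ofPred]
  unfold crossNum
  congr!

lemma ncard_pairs_of_cover {A B C : Type*} [Finite A] [Finite B] (f : A ↪ C) (g : B ↪ C)
    (hfg : ∀ x y, f x ≠ g y) (hcov : ∀ z, (∃ x, z = f x) ∨ ∃ y, z = g y) (p : C → C → Prop)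
    (h1 : ∀ x y, ¬ p (f x) (g y)) (h2 : ∀ x y, ¬ p (g y) (f x)) :
    {x : C × C | p x.1 x.2}.ncard = {x : A × A | p (f x.1) (f x.2)}.ncard +
      {x : B × B | p (g x.1) (g x.2)}.ncard := by
  rw [← Set.ncard_image_of_injective _ (f.injective.prodMap f.injective),
    ← Set.ncard_image_of_injective _ (g.injective.prodMap g.injective),
    ← Set.ncard_union_eq _ ((Set.toFinite _).image _) ((Set.toFinite _).image _)]
  · congr 1
    ext ⟨x, y⟩
    simp only [Set.mem_ofPred_eq, Set.mem_union, Set.mem_image, Prod.exists, Prod.map_apply,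
      Prod.mk.injEq]
    constructor
    · intro h
      rcases hcov x with ⟨x, rfl⟩ | ⟨x, rfl⟩ <;> rcases hcov y with ⟨y, rfl⟩ | ⟨y, rfl⟩
      · exact Or.inl ⟨x, y, h, rfl, rfl⟩
      · exact absurd h (h1 x y)
      · exact absurd h (h2 y x)
      · exact Or.inr ⟨x, y, h, rfl, rfl⟩
    · rintro (⟨a, b, h, rfl, rfl⟩ | ⟨a, b, h, rfl, rfl⟩) <;> exact h
  · rw [Set.disjoint_left]
    rintro _ ⟨⟨x, y⟩, _, rfl⟩ ⟨⟨x', y'⟩, _, h⟩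
    simp only [Prod.map_apply, Prod.mk.injEq] at h
    exact hfg x x' h.1.symm

namespace Diagram

/-! ### Juxtaposition and gluing -/

section

variable (D D' : Diagram)

/-- The legs of the left-hand factor of a juxtaposition. -/
def inlL : D.L ↪ (juxt D D').L :=
  ⟨fun x => toLex (Sum.inl x), fun _ _ h => Sum.inl_injective (toLex.injective h)⟩

/-- The legs of the right-hand factor of a juxtaposition. -/
def inrL : D'.L ↪ (juxt D D').L :=
  ⟨fun x => toLex (Sum.inr x), fun _ _ h => Sum.inr_injective (toLex.injective h)⟩

variable {D D'}

lemma inlL_lt_inlL {x y : D.L} : inlL D D' x < inlL D D' y ↔ x < y := Sum.Lex.inl_lt_inl_iff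

lemma inrL_lt_inrL {x y : D'.L} : inrL D D' x < inrL D D' y ↔ x < y := Sum.Lex.inr_lt_inr_iff

lemma inlL_lt_inrL (x : D.L) (y : D'.L) : inlL D D' x < inrL D D' y := Sum.Lex.inl_lt_inr _ _

lemma inlL_ne_inrL (x : D.L) (y : D'.L) : inlL D D' x ≠ inrL D D' y := (inlL_lt_inrL x y).ne

lemma juxt_cases (x : (juxt D D').L) : (∃ y, x = inlL D D' y) ∨ ∃ y, x = inrL D D' y := by
  obtain ⟨x, rfl⟩ := toLex.surjective x
  rcases x with x | x
  · exact Or.inl ⟨x, rfl⟩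
  · exact Or.inr ⟨x, rfl⟩

end

variable {D D' : Diagram}

lemma Pairing.exists_of_mem_mapEmb {P : D.Pairing} {f : D.L ↪ D'.L} {hf} {p : Finset D'.L}
    (hp : p ∈ (P.mapEmb f hf).pairs) {x : D'.L} (hx : x ∈ p) :
    ∃ q ∈ P.pairs, ∃ y ∈ q, f y = x ∧ q.map f = p := by
  obtain ⟨q, hq, rfl⟩ := Pairing.mem_mapEmb.1 hp
  obtain ⟨y, hy, rfl⟩ := Finset.mem_map.1 hx
  exact ⟨q, hq, y, hy, rfl, rfl⟩

open Classical in
/-- The union of a pairing of the left-hand factor and a pairing of the right-hand factor of a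
juxtaposition. -/
def Pairing.union (P : D.Pairing) (P' : D'.Pairing) : (juxt D D').Pairing where
  pairs := (P.mapEmb (D' := juxt D D') (inlL D D') (fun _ => rfl)).pairs ∪
    (P'.mapEmb (D' := juxt D D') (inrL D D') (fun _ => rfl)).pairs
  card_two := by
    intro p hp
    rcases Finset.mem_union.1 hp with hp | hp
    · exact Pairing.card_two _ p hp
    · exact Pairing.card_two _ p hp
  bot := by
    intro p hp
    rcases Finset.mem_union.1 hp with hp | hp
    · exact Pairing.bot _ p hp
    · exact Pairing.bot _ p hp
  disj := by
    intro p hp q hq hpq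
    rcases Finset.mem_union.1 hp with hp | hp <;> rcases Finset.mem_union.1 hq with hq | hq
    · exact Pairing.disj _ p hp q hq hpq
    · rw [Finset.disjoint_left]
      intro x hx hx'
      obtain ⟨_, _, a, _, h, _⟩ := Pairing.exists_of_mem_mapEmb hp hx
      obtain ⟨_, _, b, _, h', _⟩ := Pairing.exists_of_mem_mapEmb hq hx'
      exact inlL_ne_inrL a b (h.trans h'.symm)
    · rw [Finset.disjoint_left]
      intro x hx hx'
      obtain ⟨_, _, a, _, h, _⟩ := Pairing.exists_of_mem_mapEmb hp hx
      obtain ⟨_, _, b, _, h', _⟩ := Pairing.exists_of_mem_mapEmb hq hx'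
      exact inlL_ne_inrL b a (h'.trans h.symm)
    · exact Pairing.disj _ p hp q hq hpq

section

variable {P : D.Pairing} {P' : D'.Pairing}

lemma Pairing.mem_union {p : Finset (juxt D D').L} : p ∈ (P.union P').pairs ↔
    (∃ q ∈ P.pairs, q.map (inlL D D') = p) ∨ ∃ q ∈ P'.pairs, q.map (inrL D D') = p := by
  classical
  simp only [Pairing.union, Finset.mem_union]
  exact or_congr Pairing.mem_mapEmb Pairing.mem_mapEmb

lemma map_inlL_ne_map_inrL {p : Finset D.L} (hp : p.Nonempty) (q : Finset D'.L) :
    p.map (inlL D D') ≠ q.map (inrL D D') := by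
  intro h
  obtain ⟨x, hx⟩ := hp
  have := Finset.mem_map_of_mem (inlL D D') hx
  rw [h] at this
  obtain ⟨y, _, e⟩ := Finset.mem_map.1 this
  exact inlL_ne_inrL x y e.symm

lemma Pairing.nonempty_of_mem {p : Finset D.L} (hp : p ∈ P.pairs) : p.Nonempty := by
  rw [← Finset.card_pos, P.card_two p hp]; norm_num

lemma Pairing.map_inlL_mem_union {p : Finset D.L} :
    p.map (inlL D D') ∈ (P.union P').pairs ↔ p ∈ P.pairs := by
  rw [Pairing.mem_union]
  constructor
  · rintro (⟨q, hq, e⟩ | ⟨q, hq, e⟩)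
    · rwa [← Finset.map_injective _ e]
    · by_cases hp : p.Nonempty
      · exact absurd e.symm (map_inlL_ne_map_inrL hp q)
      · rw [Finset.not_nonempty_iff_eq_empty.1 hp, Finset.map_empty, Finset.map_eq_empty] at e
        exact absurd (Pairing.nonempty_of_mem hq) (by rw [e]; simp)
  · exact fun h => Or.inl ⟨p, h, rfl⟩

lemma Pairing.map_inrL_mem_union {p : Finset D'.L} :
    p.map (inrL D D') ∈ (P.union P').pairs ↔ p ∈ P'.pairs := by
  rw [Pairing.mem_union]
  constructor
  · rintro (⟨q, hq, e⟩ | ⟨q, hq, e⟩)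
    · exact absurd e (map_inlL_ne_map_inrL (Pairing.nonempty_of_mem hq) p)
    · rwa [← Finset.map_injective _ e]
  · exact fun h => Or.inr ⟨p, h, rfl⟩

lemma Pairing.inl_mem_union {x y : D.L} :
    {inlL D D' x, inlL D D' y} ∈ (P.union P').pairs ↔ {x, y} ∈ P.pairs := by
  rw [← Pairing.map_inlL_mem_union (P := P) (P' := P'), Finset.map_insert, Finset.map_singleton]

lemma Pairing.inr_mem_union {x y : D'.L} :
    {inrL D D' x, inrL D D' y} ∈ (P.union P').pairs ↔ {x, y} ∈ P'.pairs := by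
  rw [← Pairing.map_inrL_mem_union (P := P) (P' := P'), Finset.map_insert, Finset.map_singleton]

lemma Pairing.inl_inr_notMem_union {x : D.L} {y : D'.L} :
    {inlL D D' x, inrL D D' y} ∉ (P.union P').pairs := by
  intro h
  rcases Pairing.mem_union.1 h with ⟨q, _, e⟩ | ⟨q, _, e⟩
  · have : inrL D D' y ∈ q.map (inlL D D') := by rw [e]; simp
    obtain ⟨z, _, e⟩ := Finset.mem_map.1 this
    exact inlL_ne_inrL z y e
  · have : inlL D D' x ∈ q.map (inrL D D') := by rw [e]; simp
    obtain ⟨z, _, e⟩ := Finset.mem_map.1 this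
    exact inlL_ne_inrL x z e.symm

lemma Pairing.free_union_inl {x : D.L} : (P.union P').Free (inlL D D' x) ↔ P.Free x := by
  constructor
  · intro h p hp hx
    exact h _ (Pairing.map_inlL_mem_union.2 hp) (Finset.mem_map_of_mem _ hx)
  · intro h p hp hx
    rcases Pairing.mem_union.1 hp with ⟨q, hq, rfl⟩ | ⟨q, hq, rfl⟩
    · exact h q hq (by simpa using hx)
    · obtain ⟨z, _, e⟩ := Finset.mem_map.1 hx
      exact inlL_ne_inrL x z e.symm

lemma Pairing.free_union_inr {x : D'.L} : (P.union P').Free (inrL D D' x) ↔ P'.Free x := by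
  constructor
  · intro h p hp hx
    exact h _ (Pairing.map_inrL_mem_union.2 hp) (Finset.mem_map_of_mem _ hx)
  · intro h p hp hx
    rcases Pairing.mem_union.1 hp with ⟨q, hq, rfl⟩ | ⟨q, hq, rfl⟩
    · obtain ⟨z, _, e⟩ := Finset.mem_map.1 hx
      exact inlL_ne_inrL z x e
    · exact h q hq (by simpa using hx)

lemma Pairing.partner_union_inl (x : D.L) :
    (P.union P').partner (inlL D D' x) = inlL D D' (P.partner x) := by
  by_cases h : P.Free x
  · rw [Pairing.partner_eq_self_iff.2 h,
      Pairing.partner_eq_self_iff.2 (Pairing.free_union_inl.2 h)]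
  · have h1 : x ≠ P.partner x := fun e => h (Pairing.partner_eq_self_iff.1 e.symm)
    exact Pairing.partner_eq (Pairing.inl_mem_union.2 ((Pairing.partner_eq_iff h1).1 rfl))

lemma Pairing.partner_union_inr (x : D'.L) :
    (P.union P').partner (inrL D D' x) = inrL D D' (P'.partner x) := by
  by_cases h : P'.Free x
  · rw [Pairing.partner_eq_self_iff.2 h,
      Pairing.partner_eq_self_iff.2 (Pairing.free_union_inr.2 h)]
  · have h1 : x ≠ P'.partner x := fun e => h (Pairing.partner_eq_self_iff.1 e.symm)
    exact Pairing.partner_eq (Pairing.inr_mem_union.2 ((Pairing.partner_eq_iff h1).1 rfl))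

lemma Pairing.crossings_union : (P.union P').crossings = P.crossings + P'.crossings := by
  have hl := Pairing.partner_union_inl (P := P) (P' := P')
  have hr := Pairing.partner_union_inr (P := P) (P' := P')
  have hol : ∀ x, (juxt D D').IsOdd (inlL D D' x) ↔ D.IsOdd x := fun _ => Iff.rfl
  have hor : ∀ x, (juxt D D').IsOdd (inrL D D' x) ↔ D'.IsOdd x := fun _ => Iff.rfl
  rw [Pairing.crossings_eq, Pairing.crossings_eq, Pairing.crossings_eq, crossNum_eq_ncard,
    crossNum_eq_ncard, crossNum_eq_ncard]
  rw [ncard_pairs_of_cover (inlL D D') (inrL D D') inlL_ne_inrL juxt_cases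
      (fun x y => x < y ∧ y < (P.union P').partner x ∧
        (P.union P').partner x < (P.union P').partner y)
      (fun x y h => by rw [hl] at h; exact lt_asymm h.2.1 (inlL_lt_inrL _ _))
      (fun x y h => lt_asymm h.1 (inlL_lt_inrL _ _)),
    ncard_pairs_of_cover (inlL D D') (inrL D D') inlL_ne_inrL juxt_cases
      (fun x y => x < y ∧ y < (P.union P').partner x ∧
        (P.union P').partner y = y ∧ (juxt D D').IsOdd y)
      (fun x y h => by rw [hl] at h; exact lt_asymm h.2.1 (inlL_lt_inrL _ _))
      (fun x y h => lt_asymm h.1 (inlL_lt_inrL _ _))]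
  simp only [hl, hr, inlL_lt_inlL, inrL_lt_inrL, EmbeddingLike.apply_eq_iff_eq, hol, hor]
  omega

lemma Pairing.coeff_union : (P.union P').coeff = P.coeff * P'.coeff := by
  classical
  have : (P.union P').pairs.card = P.pairs.card + P'.pairs.card := by
    unfold Pairing.union
    simp only
    rw [Finset.card_union_of_disjoint]
    · simp [Pairing.mapEmb]
    · rw [Finset.disjoint_left]
      intro p hp hp'
      obtain ⟨q, hq, rfl⟩ := Pairing.mem_mapEmb.1 hp
      obtain ⟨q', hq', e⟩ := Pairing.mem_mapEmb.1 hp'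
      exact map_inlL_ne_map_inrL (Pairing.nonempty_of_mem hq) _ e.symm
  unfold Pairing.coeff
  rw [this, Pairing.crossings_union, pow_add, pow_add]
  ring

end

/-- The edges of a glued juxtaposition. -/
def juxtMeetEquiv (P : D.Pairing) (P' : D'.Pairing) :
    Quot (D.Meet P.pairs) ⊕ Quot (D'.Meet P'.pairs) ≃
      Quot ((juxt D D').Meet (P.union P').pairs) where
  toFun := Sum.elim
    (Quot.map Sum.inl (by
      rintro _ _ ⟨p, hp, i, hi, j, hj, rfl, rfl⟩
      exact ⟨_, Pairing.map_inlL_mem_union.2 hp, _, Finset.mem_map_of_mem _ hi, _,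
        Finset.mem_map_of_mem _ hj, rfl, rfl⟩))
    (Quot.map Sum.inr (by
      rintro _ _ ⟨p, hp, i, hi, j, hj, rfl, rfl⟩
      exact ⟨_, Pairing.map_inrL_mem_union.2 hp, _, Finset.mem_map_of_mem _ hi, _,
        Finset.mem_map_of_mem _ hj, rfl, rfl⟩))
  invFun := Quot.lift (Sum.map (Quot.mk _) (Quot.mk _)) (by
    rintro _ _ ⟨p, hp, i, hi, j, hj, rfl, rfl⟩
    rcases Pairing.mem_union.1 hp with ⟨q, hq, rfl⟩ | ⟨q, hq, rfl⟩
    · obtain ⟨i, hi', rfl⟩ := Finset.mem_map.1 hi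
      obtain ⟨j, hj', rfl⟩ := Finset.mem_map.1 hj
      exact congrArg Sum.inl (Quot.sound ⟨q, hq, i, hi', j, hj', rfl, rfl⟩)
    · obtain ⟨i, hi', rfl⟩ := Finset.mem_map.1 hi
      obtain ⟨j, hj', rfl⟩ := Finset.mem_map.1 hj
      exact congrArg Sum.inr (Quot.sound ⟨q, hq, i, hi', j, hj', rfl, rfl⟩))
  left_inv := by
    rintro (x | x)
    · induction x using Quot.ind; rfl
    · induction x using Quot.ind; rfl
  right_inv := by
    intro x
    induction x using Quot.ind with
    | mk x => rcases x with x | x <;> rfl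

/-- The legs of a glued juxtaposition. -/
def juxtGlueLegs (P : D.Pairing) (P' : D'.Pairing) :
    (juxt (D.glue P) (D'.glue P')).L ≃ ((juxt D D').glue (P.union P')).L :=
  ofLex.trans
  { toFun := Sum.elim (fun x => ⟨inlL D D' x.1, Pairing.free_union_inl.2 x.2⟩)
      (fun x => ⟨inrL D D' x.1, Pairing.free_union_inr.2 x.2⟩)
    invFun := fun x => match x with
      | ⟨Sum.inl y, h⟩ => Sum.inl ⟨y, Pairing.free_union_inl.1 h⟩
      | ⟨Sum.inr y, h⟩ => Sum.inr ⟨y, Pairing.free_union_inr.1 h⟩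
    left_inv := by rintro (x | x) <;> rfl
    right_inv := by rintro ⟨x | x, h⟩ <;> rfl }

/-- Gluing is compatible with juxtaposition. -/
def juxtGlue (P : D.Pairing) (P' : D'.Pairing) :
    Iso (juxt (D.glue P) (D'.glue P')) ((juxt D D').glue (P.union P')) :=
  WeakIso.toIso
  { onV := Equiv.refl _
    rot := fun _ => 0
    onL := juxtGlueLegs P P'
    onE := juxtMeetEquiv P P'
    label_eq := by
      intro (l : _ ⊕ _)
      rcases l with l | l <;> rfl
    att_vertex := by
      rintro (v | v) k <;> rw [add_zero] <;> rfl
    att_leg := by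
      intro (l : _ ⊕ _)
      rcases l with l | l <;> rfl }
  (by
    intro x y hxy
    rcases juxt_cases x with ⟨x, rfl⟩ | ⟨x, rfl⟩ <;> rcases juxt_cases y with ⟨y, rfl⟩ | ⟨y, rfl⟩
    · exact (inlL_lt_inlL (D' := D')).2 (inlL_lt_inlL.1 hxy : x < y)
    · exact inlL_lt_inrL _ _
    · exact absurd hxy (lt_asymm (inlL_lt_inrL _ _))
    · exact (inrL_lt_inrL (D := D)).2 (inrL_lt_inrL.1 hxy : x < y))

end Diagram

/-- Arcs in different factors of a juxtaposition do not cross, nor do they cross the lines of the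
other factor, so that no sign occurs. -/
lemma glueTerm_union {D D' : Diagram} (P : D.Pairing) (P' : D'.Pairing) :
    glueTerm (P.union P') = glueTerm P * glueTerm P' := by
  unfold glueTerm
  rw [Pairing.coeff_union, smul_mul_smul_comm, cls_mul, cls_congr 0 (juxtGlue P P')]

namespace Diagram

variable {D D' : Diagram}

/-! ### Gluing and the operations on diagrams -/

lemma Pairing.coeff_map_of_strictMono (P : D.Pairing) (f : D.L ≃ D'.L) (hf)
    (hm : StrictMono f) : (P.map f hf).coeff = P.coeff := by
  unfold Pairing.coeff
  rw [Pairing.crossings_eq, Pairing.crossings_eq,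
    crossNum_of_strictMono f hm Pairing.partner_map (O' := D.IsOdd) (fun x => by
      rw [IsOdd, hf, IsOdd]) (fun x hx => absurd (f.surjective x) hx)
      (fun x hx => absurd (f.surjective x) hx)]
  simp [Pairing.mapEmb]

/-- Gluing commutes with the permutation of the half-edges at the vertices. -/
def permGlue (D : Diagram) (s : Equiv.Perm (D.V × Fin 3)) (P : D.Pairing) :
    Iso ((D.glue P).permVertices s)
      ((D.permVertices s).glue (P.map (D' := D.permVertices s) (Equiv.refl D.L) fun _ => rfl)) :=
  WeakIso.toIso
  { onV := Equiv.refl _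
    rot := fun _ => 0
    onL := (Equiv.refl D.L).subtypeEquiv (fun x =>
      (Pairing.free_map (D' := D.permVertices s) (f := Equiv.refl D.L) (hf := fun _ => rfl)).symm)
    onE := meetEquiv (D' := D.permVertices s) P (Equiv.refl D.L) (fun _ => rfl) (Equiv.refl _)
      (fun _ => rfl)
    label_eq := fun _ => rfl
    att_vertex := fun v k => by rw [add_zero]; rfl
    att_leg := fun l => rfl }
  (fun x y hxy => hxy)

lemma glueTerm_perm (D : Diagram) (s : Equiv.Perm (D.V × Fin 3)) (P : D.Pairing) :
    glueTerm (P.map (D' := D.permVertices s) (Equiv.refl D.L) fun _ => rfl) =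
      P.coeff • cls 0 ((D.glue P).permVertices s) := by
  exact congrArg₂ (fun (a : ℚ) (b : Space 0) => a • b)
    (Pairing.coeff_map_of_strictMono (D' := D.permVertices s) P (Equiv.refl D.L) (fun _ => rfl)
      (fun x y hxy => hxy)) (cls_congr 0 (permGlue D s P)).symm

/-- Two successive permutations of the half-edges at the vertices. -/
def permPerm (D : Diagram) (s t : Equiv.Perm (D.V × Fin 3)) :
    Iso ((D.permVertices s).permVertices t) (D.permVertices (s * t)) where
  onV := Equiv.refl _
  rot := fun _ => 0
  onL := OrderIso.refl _
  onE := Equiv.refl _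
  label_eq := fun _ => rfl
  att_vertex := fun v k => by rw [add_zero]; rfl
  att_leg := fun _ => rfl

/-! #### Forks -/

section

variable (D) {i j : D.L} (hij : i ≠ j)

/-- The legs that remain when a leg is joined to another one. -/
def forkL : (D.fork i j hij).L ↪ D.L := ⟨Subtype.val, Subtype.val_injective⟩

/-- A pairing of a diagram with a fork as a pairing of the original diagram. -/
def Pairing.ofFork (P : (D.fork i j hij).Pairing) : D.Pairing :=
  P.mapEmb (D' := D) (forkL D hij) (fun _ => rfl)

variable {D hij}

lemma Pairing.free_ofFork {P : (D.fork i j hij).Pairing} {x : D.L} (hx : x ≠ j) :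
    (P.ofFork D hij).Free x ↔ P.Free ⟨x, hx⟩ := by
  constructor
  · intro h p hp hxp
    exact h _ (Pairing.mem_mapEmb.2 ⟨p, hp, rfl⟩) (Finset.mem_map_of_mem (forkL D hij) hxp)
  · intro h p hp hxp
    obtain ⟨q, hq, y, hy, rfl, rfl⟩ := Pairing.exists_of_mem_mapEmb hp hxp
    exact h q hq hy

lemma Pairing.free_ofFork_right (P : (D.fork i j hij).Pairing) : (P.ofFork D hij).Free j := by
  intro p hp hjp
  obtain ⟨q, hq, y, hy, e, rfl⟩ := Pairing.exists_of_mem_mapEmb hp hjp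
  exact y.2 e

lemma Pairing.free_of_label_ne {P : D.Pairing} {x : D.L} (h : D.label x ≠ Leg.bot) : P.Free x :=
  fun p hp hx => h (P.bot p hp x hx)

lemma Pairing.coeff_ofFork (P : (D.fork i j hij).Pairing) (hj : D.label j = Leg.curv) :
    (P.ofFork D hij).coeff = P.coeff := by
  have hr : ∀ x ∉ Set.range (forkL D hij), x = j := by
    intro x hx
    by_contra h
    exact hx ⟨⟨x, h⟩, rfl⟩
  have hs : ∀ x, (P.ofFork D hij).partner (forkL D hij x) = forkL D hij (P.partner x) := by
    intro x
    by_cases h : P.Free x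
    · rw [Pairing.partner_eq_self_iff.2 h]
      exact Pairing.partner_eq_self_iff.2 ((Pairing.free_ofFork x.2).2 h)
    · have h1 : x ≠ P.partner x := fun e => h (Pairing.partner_eq_self_iff.1 e.symm)
      exact Pairing.partner_eq (Pairing.pair_mem_mapEmb.2 ((Pairing.partner_eq_iff h1).1 rfl))
  have hfj := Pairing.partner_eq_self_iff.2 (Pairing.free_ofFork_right P)
  unfold Pairing.coeff
  rw [Pairing.crossings_eq, Pairing.crossings_eq,
    crossNum_of_strictMono (forkL D hij) (fun x y h => h) hs (O' := (D.fork i j hij).IsOdd)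
      (fun x => Iff.rfl)
      (fun x hx y h h' => by rw [hr x hx] at h h'; rw [hfj] at h'; exact lt_asymm h h')
      (fun x hx _ => by rw [hr x hx, IsOdd, hj]; decide)]
  simp [Pairing.ofFork, Pairing.mapEmb]

lemma forkAtt_of_eq (D : Diagram) {i j : D.L} {l : {l : D.L // l ≠ j}} (h : l.1 = i) :
    forkAtt D i j (Sum.inr l) = none := by simp [forkAtt, h]

lemma forkAtt_of_ne (D : Diagram) {i j : D.L} {l : {l : D.L // l ≠ j}} (h : l.1 ≠ i) :
    forkAtt D i j (Sum.inr l) = some (D.att (Sum.inr l.1)) := by simp [forkAtt, h]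

/-- The edges of a diagram that is glued and forked at legs that are not glued. -/
def forkMeetEquiv (P : (D.fork i j hij).Pairing) (hi : D.label i = Leg.curv) :
    Option (Quot (D.Meet (P.ofFork D hij).pairs)) ≃ Quot ((D.fork i j hij).Meet P.pairs) where
  toFun := fun x => x.elim (Quot.mk _ none) (Quot.map some (by
    rintro _ _ ⟨p, hp, k, hk, l, hl, rfl, rfl⟩
    obtain ⟨q, hq, rfl⟩ := Pairing.mem_mapEmb.1 hp
    obtain ⟨k, hk', rfl⟩ := Finset.mem_map.1 hk
    obtain ⟨l, hl', rfl⟩ := Finset.mem_map.1 hl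
    have h : ∀ k ∈ q, k.1 ≠ i := by
      intro k hk e
      have : D.label k.1 = Leg.bot := P.bot q hq k hk
      rw [e, hi] at this
      exact absurd this (by decide)
    exact ⟨q, hq, k, hk', l, hl', forkAtt_of_ne D (h k hk'), forkAtt_of_ne D (h l hl')⟩))
  invFun := Quot.lift (Option.map (Quot.mk _)) (by
    rintro _ _ ⟨q, hq, k, hk, l, hl, rfl, rfl⟩
    have h : ∀ k ∈ q, k.1 ≠ i := by
      intro k hk e
      have : D.label k.1 = Leg.bot := P.bot q hq k hk
      rw [e, hi] at this
      exact absurd this (by decide)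
    have hk' : (D.fork i j hij).att (Sum.inr k) = some (D.att (Sum.inr k.1)) :=
      forkAtt_of_ne D (h k hk)
    have hl' : (D.fork i j hij).att (Sum.inr l) = some (D.att (Sum.inr l.1)) :=
      forkAtt_of_ne D (h l hl)
    rw [hk', hl']
    exact congrArg some (Quot.sound ⟨_, Pairing.mem_mapEmb.2 ⟨q, hq, rfl⟩, k.1,
      Finset.mem_map_of_mem (forkL D hij) hk, l.1, Finset.mem_map_of_mem (forkL D hij) hl, rfl,
      rfl⟩))
  left_inv := by
    rintro (_ | x)
    · rfl
    · induction x using Quot.ind; rfl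
  right_inv := by
    intro x
    induction x using Quot.ind with
    | mk x => rcases x with _ | x <;> rfl

/-- Gluing commutes with forking two legs that are not glued. -/
def forkGlue (P : (D.fork i j hij).Pairing) (hi : D.label i = Leg.curv)
    (hfi : (P.ofFork D hij).Free i) (hij' : (⟨i, hfi⟩ : (D.glue (P.ofFork D hij)).L) ≠
      ⟨j, P.free_ofFork_right⟩) :
    Iso ((D.glue (P.ofFork D hij)).fork ⟨i, hfi⟩ ⟨j, P.free_ofFork_right⟩ hij')
      ((D.fork i j hij).glue P) :=
  WeakIso.toIso
  { onV := Equiv.refl _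
    rot := fun _ => 0
    onL :=
      { toFun := fun x => ⟨⟨x.1.1, fun h => x.2 (Subtype.ext h)⟩,
          (Pairing.free_ofFork (fun h => x.2 (Subtype.ext h))).1 x.1.2⟩
        invFun := fun x => ⟨⟨x.1.1, (Pairing.free_ofFork x.1.2).2 x.2⟩,
          fun h => x.1.2 (congrArg Subtype.val h)⟩
        left_inv := fun _ => rfl
        right_inv := fun _ => rfl }
    onE := forkMeetEquiv P hi
    label_eq := fun _ => rfl
    att_vertex := by
      rintro (_ | v) k
      · rw [add_zero]
        fin_cases k <;> rfl
      · rw [add_zero]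
        rfl
    att_leg := by
      intro l
      by_cases h : l.1.1 = i
      · have h1 : ((D.glue (P.ofFork D hij)).fork ⟨i, hfi⟩ ⟨j, P.free_ofFork_right⟩ hij').att
            (Sum.inr l) = none := forkAtt_of_eq _ (Subtype.ext h)
        rw [h1]
        exact congrArg (Quot.mk _) (forkAtt_of_eq D (l := ⟨l.1.1, fun h => l.2 (Subtype.ext h)⟩) h)
      · have h1 : ((D.glue (P.ofFork D hij)).fork ⟨i, hfi⟩ ⟨j, P.free_ofFork_right⟩ hij').att
            (Sum.inr l) = some ((D.glue (P.ofFork D hij)).att (Sum.inr l.1)) :=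
          forkAtt_of_ne _ (fun e => h (congrArg Subtype.val e))
        rw [h1]
        exact congrArg (Quot.mk _)
          (forkAtt_of_ne D (l := ⟨l.1.1, fun h => l.2 (Subtype.ext h)⟩) h) }
  (fun x y hxy => hxy)

end

/-! #### Successive gluing -/

section

variable (Q : D.Pairing)

/-- The legs that remain after gluing. -/
def glueL : (D.glue Q).L ↪ D.L := ⟨Subtype.val, Subtype.val_injective⟩

variable {Q}

open Classical in
/-- A pairing of a glued diagram, together with the pairs that are already glued. -/
def Pairing.join (Q : D.Pairing) (P : (D.glue Q).Pairing) : D.Pairing where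
  pairs := Q.pairs ∪ (P.mapEmb (D' := D) (glueL Q) (fun _ => rfl)).pairs
  card_two := by
    intro p hp
    rcases Finset.mem_union.1 hp with hp | hp
    · exact Q.card_two p hp
    · exact Pairing.card_two _ p hp
  bot := by
    intro p hp
    rcases Finset.mem_union.1 hp with hp | hp
    · exact Q.bot p hp
    · exact Pairing.bot _ p hp
  disj := by
    intro p hp q hq hpq
    rcases Finset.mem_union.1 hp with hp | hp <;> rcases Finset.mem_union.1 hq with hq | hq
    · exact Q.disj p hp q hq hpq
    · rw [Finset.disjoint_left]
      intro x hx hx'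
      obtain ⟨_, _, y, _, rfl, _⟩ := Pairing.exists_of_mem_mapEmb hq hx'
      exact y.2 p hp hx
    · rw [Finset.disjoint_left]
      intro x hx hx'
      obtain ⟨_, _, y, _, rfl, _⟩ := Pairing.exists_of_mem_mapEmb hp hx
      exact y.2 q hq hx'
    · exact Pairing.disj _ p hp q hq hpq

variable {P : (D.glue Q).Pairing}

lemma Pairing.mem_join {p : Finset D.L} :
    p ∈ (Q.join P).pairs ↔ p ∈ Q.pairs ∨ ∃ q ∈ P.pairs, q.map (glueL Q) = p := by
  classical
  simp only [Pairing.join, Finset.mem_union]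
  exact or_congr Iff.rfl Pairing.mem_mapEmb

lemma Pairing.free_join {x : D.L} : (Q.join P).Free x ↔ ∃ h : Q.Free x, P.Free ⟨x, h⟩ := by
  constructor
  · intro h
    refine ⟨fun p hp => h p (Pairing.mem_join.2 (Or.inl hp)), fun p hp hx => ?_⟩
    exact h _ (Pairing.mem_join.2 (Or.inr ⟨p, hp, rfl⟩)) (Finset.mem_map_of_mem (glueL Q) hx)
  · rintro ⟨h, h'⟩ p hp hx
    rcases Pairing.mem_join.1 hp with hp | ⟨q, hq, rfl⟩
    · exact h p hp hx
    · obtain ⟨y, hy, rfl⟩ := Finset.mem_map.1 hx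
      exact h' q hq hy

lemma Pairing.partner_join (x : (D.glue Q).L) :
    (Q.join P).partner (glueL Q x) = glueL Q (P.partner x) := by
  by_cases h : P.Free x
  · rw [Pairing.partner_eq_self_iff.2 h]
    exact Pairing.partner_eq_self_iff.2 (Pairing.free_join.2 ⟨x.2, h⟩)
  · have h1 : x ≠ P.partner x := fun e => h (Pairing.partner_eq_self_iff.1 e.symm)
    refine Pairing.partner_eq (Pairing.mem_join.2 (Or.inr
      ⟨_, (Pairing.partner_eq_iff h1).1 rfl, ?_⟩))
    rw [Finset.map_insert, Finset.map_singleton]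

lemma Pairing.comap_join (hf) : (Q.join P).comap (glueL Q) hf = P := by
  apply Pairing.ext_pairs
  ext p
  rw [Pairing.mem_comap, Pairing.mem_join]
  constructor
  · rintro (h | ⟨q, hq, e⟩)
    · obtain ⟨x, hx⟩ := Pairing.nonempty_of_mem h
      obtain ⟨y, hy, rfl⟩ := Finset.mem_map.1 hx
      exact absurd hx (y.2 _ h)
    · rwa [← Finset.map_injective _ e]
  · exact fun h => Or.inr ⟨p, h, rfl⟩

lemma Pairing.join_comap {R : D.Pairing} (h : Q.pairs ⊆ R.pairs) (hf) :
    Q.join (R.comap (D := D.glue Q) (glueL Q) hf) = R := by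
  apply Pairing.ext_pairs
  ext p
  rw [Pairing.mem_join]
  constructor
  · rintro (hp | ⟨q, hq, rfl⟩)
    · exact h hp
    · exact Pairing.mem_comap.1 hq
  · intro hp
    by_cases hpQ : p ∈ Q.pairs
    · exact Or.inl hpQ
    · right
      have hfree : ∀ x ∈ p, Q.Free x := by
        intro x hx q hq hxq
        rw [Pairing.eq_of_mem (h hq) hp hxq hx] at hq
        exact hpQ hq
      obtain ⟨a, b, hab, rfl⟩ := Finset.card_eq_two.1 (R.card_two p hp)
      obtain ⟨a, rfl⟩ : ∃ a', glueL Q a' = a := ⟨⟨a, hfree a (by simp)⟩, rfl⟩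
      obtain ⟨b, rfl⟩ : ∃ b', glueL Q b' = b := ⟨⟨b, hfree b (by simp)⟩, rfl⟩
      refine ⟨{a, b}, ?_, ?_⟩
      · rw [Pairing.mem_comap, Finset.map_insert, Finset.map_singleton]
        exact hp
      · rw [Finset.map_insert, Finset.map_singleton]

/-- The edges of a diagram that is glued twice. -/
def glueMeetEquiv (P : (D.glue Q).Pairing) :
    Quot ((D.glue Q).Meet P.pairs) ≃ Quot (D.Meet (Q.join P).pairs) where
  toFun := Quot.lift (Quot.map id (by
      rintro _ _ ⟨p, hp, i, hi, j, hj, rfl, rfl⟩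
      exact ⟨p, Pairing.mem_join.2 (Or.inl hp), i, hi, j, hj, rfl, rfl⟩)) (by
    rintro _ _ ⟨p, hp, i, hi, j, hj, rfl, rfl⟩
    exact Quot.sound ⟨_, Pairing.mem_join.2 (Or.inr ⟨p, hp, rfl⟩), i.1,
      Finset.mem_map_of_mem (glueL Q) hi, j.1, Finset.mem_map_of_mem (glueL Q) hj, rfl, rfl⟩)
  invFun := Quot.lift (fun e => Quot.mk _ (Quot.mk _ e)) (by
    rintro _ _ ⟨p, hp, i, hi, j, hj, rfl, rfl⟩
    rcases Pairing.mem_join.1 hp with hp | ⟨q, hq, rfl⟩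
    · exact congrArg _ (Quot.sound ⟨p, hp, i, hi, j, hj, rfl, rfl⟩)
    · obtain ⟨i, hi', rfl⟩ := Finset.mem_map.1 hi
      obtain ⟨j, hj', rfl⟩ := Finset.mem_map.1 hj
      exact Quot.sound ⟨q, hq, i, hi', j, hj', rfl, rfl⟩)
  left_inv := by
    intro x
    induction x using Quot.ind with
    | mk x => induction x using Quot.ind; rfl
  right_inv := by
    intro x
    induction x using Quot.ind; rfl

/-- Two successive gluings are one. -/
def glueGlue (P : (D.glue Q).Pairing) : Iso ((D.glue Q).glue P) (D.glue (Q.join P)) :=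
  WeakIso.toIso
  { onV := Equiv.refl _
    rot := fun _ => 0
    onL :=
      { toFun := fun x => ⟨x.1.1, Pairing.free_join.2 ⟨x.1.2, x.2⟩⟩
        invFun := fun x => ⟨⟨x.1, (Pairing.free_join.1 x.2).1⟩, (Pairing.free_join.1 x.2).2⟩
        left_inv := fun _ => rfl
        right_inv := fun _ => rfl }
    onE := glueMeetEquiv P
    label_eq := fun _ => rfl
    att_vertex := fun v k => by rw [add_zero]; rfl
    att_leg := fun l => rfl }
  (fun x y hxy => hxy)

end

lemma Pairing.coeff_join_single {i j : D.L} (hij : i ⋖ j) (Q : D.Pairing)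
    (hQ : Q.pairs = {{i, j}}) (P : (D.glue Q).Pairing) : (Q.join P).coeff = 1 / 2 * P.coeff := by
  have hmem : {i, j} ∈ (Q.join P).pairs :=
    Pairing.mem_join.2 (Or.inl (by rw [hQ]; exact Finset.mem_singleton_self _))
  have hpi : (Q.join P).partner i = j := Pairing.partner_eq hmem
  have hpj : (Q.join P).partner j = i := by rw [← hpi, Pairing.partner_partner]
  have hr : ∀ x ∉ Set.range (glueL Q), x = i ∨ x = j := by
    intro x hx
    by_contra h
    refine hx ⟨⟨x, fun p hp hxp => h ?_⟩, rfl⟩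
    rw [hQ, Finset.mem_singleton] at hp
    simpa [hp] using hxp
  have hcard : (Q.join P).pairs.card = P.pairs.card + 1 := by
    classical
    unfold Pairing.join
    simp only
    rw [Finset.card_union_of_disjoint]
    · simp [Pairing.mapEmb, hQ, add_comm]
    · rw [Finset.disjoint_left]
      intro p hp hp'
      obtain ⟨x, hx⟩ := Pairing.nonempty_of_mem hp
      obtain ⟨_, _, y, _, rfl, _⟩ := Pairing.exists_of_mem_mapEmb hp' hx
      exact y.2 p hp hx
  unfold Pairing.coeff
  rw [Pairing.crossings_eq, Pairing.crossings_eq,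
    crossNum_of_strictMono (glueL Q) (fun x y h => h) Pairing.partner_join (O' := (D.glue Q).IsOdd)
      (fun x => Iff.rfl)
      (fun x hx y h h' => by
        rcases hr x hx with e | e
        · rw [e, hpi] at h'
          rw [e] at h
          exact hij.2 h h'
        · rw [e, hpj] at h'
          rw [e] at h
          exact lt_asymm (h.trans h') hij.lt)
      (fun x hx h => by
        rcases hr x hx with e | e
        · rw [e, hpi] at h
          exact absurd h hij.lt.ne'
        · rw [e, hpj] at h
          exact absurd h hij.lt.ne), hcard, pow_succ]
  ring

end Diagram

/-! ### The gluing sum respects the relations -/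

/-- The sum over all pairings that defines `λ` on diagrams. -/
def glueSum (D : Diagram) : Space 0 := ∑ P : D.Pairing, glueTerm P

lemma glueTerm_iso {D D' : Diagram} (f : Iso D D') (P : D.Pairing) :
    glueTerm (P.map f.toWeakIso.onL f.toWeakIso.label_eq) = glueTerm P := by
  have hm : ∀ x y, x < y → ¬ f.toWeakIso.onL y < f.toWeakIso.onL x := fun x y h h' =>
    lt_asymm h' (f.onL.strictMono h)
  rw [glueTerm_reorder f.toWeakIso P (fun x y h h' => absurd h' (hm x y h)),
    invNum_eq_zero_iff.2 (fun x y h h' => absurd h' (hm x y h)),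
    invNum_eq_zero_iff.2 (fun x y h h' => absurd h' (hm x y h)), add_zero, pow_zero, one_smul]

lemma glueSum_map {D D' : Diagram} (f : D.L ≃ D'.L) (hf : ∀ l, D'.label (f l) = D.label l) :
    glueSum D' = ∑ P : D.Pairing, glueTerm (P.map f hf) :=
  ((Pairing.mapEquiv f hf).sum_comp (fun P => glueTerm P)).symm

lemma glueSum_congr {D D' : Diagram} (f : Iso D D') : glueSum D = glueSum D' := by
  rw [glueSum_map f.toWeakIso.onL f.toWeakIso.label_eq]
  exact Finset.sum_congr rfl fun P _ => (glueTerm_iso f P).symm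

lemma glueSum_perm (D : Diagram) (s : Equiv.Perm (D.V × Fin 3)) :
    glueSum (D.permVertices s) = ∑ P : D.Pairing, P.coeff • cls 0 ((D.glue P).permVertices s) := by
  rw [glueSum_map (D := D) (D' := D.permVertices s) (Equiv.refl D.L) (fun _ => rfl)]
  exact Finset.sum_congr rfl fun P _ => glueTerm_perm D s P

lemma glueSum_perm_perm (D : Diagram) (s : Equiv.Perm (D.V × Fin 3)) :
    glueSum ((D.permVertices s).permVertices s) =
      ∑ P : D.Pairing, P.coeff • cls 0 (((D.glue P).permVertices s).permVertices s) := by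
  rw [glueSum_congr (permPerm D s s), glueSum_perm]
  exact Finset.sum_congr rfl fun P _ => congrArg _ (cls_congr 0 (permPerm (D.glue P) s s)).symm

lemma glueSum_flip (D : Diagram) (v : D.V) : glueSum D = -glueSum (D.flip v) := by
  have h1 : glueSum (D.flip v) = ∑ P : D.Pairing, P.coeff • cls 0 ((D.glue P).flip v) :=
    glueSum_perm D _
  rw [h1, ← Finset.sum_neg_distrib]
  refine Finset.sum_congr rfl fun P _ => ?_
  have h := mk_eq_of_rel (Rel.as (κ := 0) (D.glue P) v)
  rw [map_neg] at h
  exact (congrArg (P.coeff • ·) h).trans (smul_neg _ _)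

lemma glueSum_rotate (D : Diagram) (u v : D.V) (huv : u ≠ v)
    (h : D.att (Sum.inl (u, 0)) = D.att (Sum.inl (v, 0))) :
    glueSum D + glueSum (D.rotate u v) + glueSum ((D.rotate u v).rotate u v) = 0 := by
  have h1 : glueSum (D.rotate u v) = ∑ P : D.Pairing, P.coeff • cls 0 ((D.glue P).rotate u v) :=
    glueSum_perm D _
  have h2 : glueSum ((D.rotate u v).rotate u v) =
      ∑ P : D.Pairing, P.coeff • cls 0 (((D.glue P).rotate u v).rotate u v) :=
    glueSum_perm_perm D _
  rw [h1, h2, glueSum, ← Finset.sum_add_distrib, ← Finset.sum_add_distrib]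
  refine Finset.sum_eq_zero fun P _ => ?_
  have h1 := mk_eq_of_rel (Rel.ihx (κ := 0) (D.glue P) u v huv (congrArg (Quot.mk _) h))
  rw [map_zero, map_add, map_add] at h1
  rw [glueTerm, ← smul_add, ← smul_add]
  exact (congrArg _ h1).trans (smul_zero _)

open Classical in
lemma invNum_swap_covBy {L : Type*} [LinearOrder L] [Fintype L] {i j : L} (hij : i ⋖ j)
    (Q : L → L → Prop) : invNum (Equiv.swap i j) Q = if Q i j then 1 else 0 := by
  rw [invNum_swap _ Q hij (by simpa using hij.lt), invNum_eq_zero_iff.2, zero_add]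
  intro x y hxy h
  simp only [Function.comp_apply, Equiv.swap_apply_self] at h
  exact absurd hxy (lt_asymm h)

open Classical in
/-- The contribution of a pairing under the exchange of two adjacent legs. -/
lemma glueTerm_swap {D : Diagram} {i j : D.L} (hij : i ⋖ j)
    (h : ¬ (D.label i = Leg.curv ∧ D.label j = Leg.curv)) (P : D.Pairing) :
    glueTerm P = (-1 : ℚ) ^ ((if D.IsOdd i ∧ D.IsOdd j then 1 else 0) +
      (if {i, j} ∈ P.pairs then 1 else 0)) •
        glueTerm (P.map (swapWeakIso D i j).onL (swapWeakIso D i j).label_eq) := by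
  have h1 : ∀ Q : D.L → D.L → Prop, invNum (swapWeakIso D i j).onL Q = if Q i j then 1 else 0 :=
    fun Q => invNum_swap_covBy hij Q
  rw [glueTerm_reorder (swapWeakIso D i j) P, h1, h1]
  · congr!
  · intro x y hxy hs
    by_cases he : x = i ∧ y = j
    · rw [he.1, he.2]
      exact h
    · exact absurd hs (lt_asymm (swap_lt_swap hij hxy he))

lemma Diagram.Pairing.pair_notMem_of_label {D : Diagram} {P : D.Pairing} {i j : D.L}
    (h : D.label i ≠ Leg.bot ∨ D.label j ≠ Leg.bot) : {i, j} ∉ P.pairs := by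
  intro hp
  rcases h with h | h
  · exact h (P.bot _ hp _ (by simp))
  · exact h (P.bot _ hp _ (by simp))

lemma glueSum_move (D : Diagram) {i j : D.L} (hij : i ⋖ j)
    (h : (D.label i).IsFormal ∨ (D.label j).IsFormal) :
    glueSum D = (-1 : ℚ) ^ ((D.label i).grade * (D.label j).grade) •
      glueSum (D.swapLegs i j) := by
  classical
  rw [glueSum_map (swapWeakIso D i j).onL (swapWeakIso D i j).label_eq, Finset.smul_sum]
  refine Finset.sum_congr rfl fun P _ => ?_
  have hc : ¬ (D.label i = Leg.curv ∧ D.label j = Leg.curv) := by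
    rintro ⟨h1, h2⟩
    rw [h1, h2] at h
    exact h.elim (fun h => h.2 rfl) (fun h => h.2 rfl)
  rw [glueTerm_swap hij hc P, if_neg (Pairing.pair_notMem_of_label (h.imp (·.1) (·.1))), add_zero,
    neg_one_pow_grade]
  congr!

lemma glueSum_comm (D : Diagram) {i j : D.L} (hij : i ⋖ j) (hi : D.label i = Leg.curv)
    (hj : D.label j = Leg.bot) : glueSum D = glueSum (D.swapLegs i j) := by
  classical
  rw [glueSum_map (swapWeakIso D i j).onL (swapWeakIso D i j).label_eq]
  refine Finset.sum_congr rfl fun P _ => ?_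
  rw [glueTerm_swap hij (by rw [hj]; simp) P,
    if_neg (Pairing.pair_notMem_of_label (by rw [hi]; simp)),
    if_neg (by simp [IsOdd, hi, Leg.grade]), pow_zero, one_smul]

/-- The contributions of the pairings that do not contain `{i, j}` cancel. The other pairings are
the pairings of the diagram with `i` and `j` glued, extended by the pair `{i, j}`; they contribute
twice, which compensates the weight `1 / 2` of that pair. -/
lemma glueSum_clifford (D : Diagram) {i j : D.L} (hij : i ⋖ j) (hi : D.label i = Leg.bot)
    (hj : D.label j = Leg.bot) : glueSum D + glueSum (D.swapLegs i j) =
      glueSum (D.glue (Pairing.single D i j hij.lt.ne hi hj)) := by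
  classical
  obtain ⟨Q, hQ⟩ : ∃ Q, Q = Pairing.single D i j hij.lt.ne hi hj := ⟨_, rfl⟩
  have hQ' : Q.pairs = {{i, j}} := by rw [hQ]; rfl
  rw [← hQ, glueSum_map (swapWeakIso D i j).onL (swapWeakIso D i j).label_eq, glueSum, glueSum,
    ← Finset.sum_add_distrib]
  have hodd : D.IsOdd i ∧ D.IsOdd j := by simp [IsOdd, hi, hj, Leg.grade]
  have h1 : ∀ P : D.Pairing, glueTerm P +
      glueTerm (P.map (swapWeakIso D i j).onL (swapWeakIso D i j).label_eq) =
        if {i, j} ∈ P.pairs then (2 : ℚ) • glueTerm P else 0 := by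
    intro P
    rw [glueTerm_swap hij (by rw [hi]; simp) P, if_pos hodd]
    split_ifs with h
    · rw [show ((-1 : ℚ) ^ (1 + 1)) = 1 by norm_num, one_smul, two_smul]
    · rw [add_zero, pow_one, neg_one_smul_space, neg_add_cancel]
  rw [Finset.sum_congr rfl fun P _ => h1 P, ← Finset.sum_filter]
  refine Finset.sum_bij' (fun P _ => P.comap (D := D.glue Q) (glueL Q) (fun _ => rfl))
    (fun P _ => Q.join P) (fun _ _ => Finset.mem_univ _) ?_ ?_ ?_ ?_
  · intro P _
    rw [Finset.mem_filter]
    exact ⟨Finset.mem_univ _, Pairing.mem_join.2 (Or.inl (by rw [hQ']; simp))⟩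
  · intro P hP
    refine Pairing.join_comap ?_ _
    rw [hQ', Finset.singleton_subset_iff]
    exact (Finset.mem_filter.1 hP).2
  · intro P _
    exact Pairing.comap_join _
  · intro P hP
    have h2 : Q.join (P.comap (D := D.glue Q) (glueL Q) (fun _ => rfl)) = P := by
      refine Pairing.join_comap ?_ _
      rw [hQ', Finset.singleton_subset_iff]
      exact (Finset.mem_filter.1 hP).2
    generalize P.comap (D := D.glue Q) (glueL Q) (fun _ => rfl) = R at h2 ⊢
    subst h2
    rw [glueTerm, glueTerm, Pairing.coeff_join_single hij Q hQ', cls_congr 0 (glueGlue R), smul_smul]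
    congr 1
    ring

/-- Gluing commutes with the exchange of two legs that are not glued. -/
def swapGlue (D : Diagram) {i j : D.L} (P : D.Pairing) (hi : P.Free i) (hj : P.Free j) :
    Iso ((D.glue P).swapLegs ⟨i, hi⟩ ⟨j, hj⟩) ((D.swapLegs i j).glue
      (P.map (swapWeakIso D i j).onL (swapWeakIso D i j).label_eq)) :=
  have hsw : ∀ x, glueL P (Equiv.swap ⟨i, hi⟩ ⟨j, hj⟩ x) = Equiv.swap i j (glueL P x) := fun x =>
    (glueL P).injective.map_swap ⟨i, hi⟩ ⟨j, hj⟩ x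
  let g := (swapWeakIso D i j).glue P
  WeakIso.toIso
  { onV := g.onV
    rot := g.rot
    onL := (Equiv.swap (⟨i, hi⟩ : (D.glue P).L) ⟨j, hj⟩).trans g.onL
    onE := g.onE
    label_eq := fun l => g.label_eq _
    att_vertex := g.att_vertex
    att_leg := fun l => g.att_leg _ }
  (by
    intro x y hxy
    have : ∀ z : (D.glue P).L, (g.onL (Equiv.swap ⟨i, hi⟩ ⟨j, hj⟩ z)).1 = z.1 := fun z => by
      change Equiv.swap i j (glueL P _) = _
      rw [hsw, Equiv.swap_apply_self]
      rfl
    exact (this x).trans_lt (lt_of_lt_of_eq hxy (this y).symm))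

/-- As curvature legs are never paired, the three diagrams have the same pairings, and the relation
holds in the target for each of them. -/
lemma glueSum_stu (D : Diagram) {i j : D.L} (hij : i ⋖ j) (hi : D.label i = Leg.curv)
    (hj : D.label j = Leg.curv) :
    glueSum D - glueSum (D.swapLegs i j) = glueSum (D.fork i j hij.lt.ne) := by
  classical
  rw [glueSum_map (swapWeakIso D i j).onL (swapWeakIso D i j).label_eq, glueSum, glueSum,
    ← Finset.sum_sub_distrib]
  have hfree : ∀ {x : D.L}, D.label x = Leg.curv → ∀ P : D.Pairing, P.Free x := fun h P =>
    Pairing.free_of_label_ne (by rw [h]; simp)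
  symm
  refine Finset.sum_bij' (fun P _ => P.ofFork D hij.lt.ne)
    (fun P _ => P.comap (D := D.fork i j hij.lt.ne) (forkL D hij.lt.ne) (fun _ => rfl))
    (fun _ _ => Finset.mem_univ _) (fun _ _ => Finset.mem_univ _) ?_ ?_ ?_
  · intro P _
    exact Pairing.comap_mapEmb _ _ _ _
  · intro P _
    apply Pairing.ext_pairs
    ext p
    constructor
    · intro hp
      obtain ⟨q, hq, rfl⟩ := Pairing.mem_mapEmb.1 hp
      exact Pairing.mem_comap.1 hq
    · intro hp
      obtain ⟨a, b, hab, rfl⟩ := Finset.card_eq_two.1 (P.card_two p hp)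
      obtain ⟨a, rfl⟩ : ∃ a', forkL D hij.lt.ne a' = a :=
        ⟨⟨a, by rintro rfl; exact hfree hj P _ hp (by simp)⟩, rfl⟩
      obtain ⟨b, rfl⟩ : ∃ b', forkL D hij.lt.ne b' = b :=
        ⟨⟨b, by rintro rfl; exact hfree hj P _ hp (by simp)⟩, rfl⟩
      refine Pairing.mem_mapEmb.2 ⟨{a, b}, ?_, ?_⟩
      · refine (Pairing.mem_comap (D := D.fork i j hij.lt.ne) (f := forkL D hij.lt.ne)).2 ?_
        rw [Finset.map_insert, Finset.map_singleton]
        exact hp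
      · rw [Finset.map_insert, Finset.map_singleton]
  · intro P _
    have hfi := hfree hi (P.ofFork D hij.lt.ne)
    have hfj := hfree hj (P.ofFork D hij.lt.ne)
    have hcov : (⟨i, hfi⟩ : (D.glue (P.ofFork D hij.lt.ne)).L) ⋖ ⟨j, hfj⟩ :=
      ⟨hij.lt, fun x h h' => hij.2 (c := x.1) h h'⟩
    have hrel := mk_eq_of_rel (Rel.stu (κ := 0) (D.glue (P.ofFork D hij.lt.ne)) ⟨i, hfi⟩ ⟨j, hfj⟩
      hcov hi hj)
    rw [map_sub] at hrel
    have hcoeff : ((P.ofFork D hij.lt.ne).map (swapWeakIso D i j).onL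
        (swapWeakIso D i j).label_eq).coeff = (P.ofFork D hij.lt.ne).coeff := by
      have h1 : ∀ Q : D.L → D.L → Prop,
          invNum (swapWeakIso D i j).onL Q = if Q i j then 1 else 0 :=
        fun Q => invNum_swap_covBy hij Q
      rw [Pairing.coeff_reorder (swapWeakIso D i j) (P.ofFork D hij.lt.ne), h1,
        if_neg (by simp [IsOdd, hi, Leg.grade]), pow_zero, one_mul]
    rw [glueTerm, glueTerm, glueTerm, hcoeff, Pairing.coeff_ofFork P hj,
      ← cls_congr 0 (swapGlue D (P.ofFork D hij.lt.ne) hfi hfj),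
      ← cls_congr 0 (forkGlue P hi hfi hcov.lt.ne)]
    exact (congrArg (P.coeff • ·) hrel.symm).trans (smul_sub _ _ _)

namespace Diagram

/-! ### The relations inside a larger diagram -/

section

variable (C D C' : Diagram)

/-- The diagram `D` with `C` on its left and `C'` on its right. -/
def between : Diagram := juxt (juxt C D) C'

/-- The legs of the diagram in the middle. -/
def midL : D.L ↪ (between C D C').L := (inrL C D).trans (inlL (juxt C D) C')

/-- The vertices of the diagram in the middle. -/
def midV (v : D.V) : (between C D C').V := Sum.inl (Sum.inr v)

/-- The half-edges at the vertices of the diagram in the middle. -/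
def midH : D.V × Fin 3 → (between C D C').V × Fin 3 := Prod.map (midV C D C') id

variable {C D C'}

lemma midV_injective : Function.Injective (midV C D C') :=
  Sum.inl_injective.comp Sum.inr_injective

lemma midH_injective : Function.Injective (midH C D C') :=
  midV_injective.prodMap Function.injective_id

lemma midL_covBy {i j : D.L} (hij : i ⋖ j) : midL C D C' i ⋖ midL C D C' j := by
  refine ⟨inlL_lt_inlL.2 (inrL_lt_inrL.2 hij.lt), fun x h1 h2 => ?_⟩
  rcases juxt_cases x with ⟨x, rfl⟩ | ⟨x, rfl⟩
  · replace h1 := inlL_lt_inlL.1 h1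
    replace h2 := inlL_lt_inlL.1 h2
    rcases juxt_cases x with ⟨x, rfl⟩ | ⟨x, rfl⟩
    · exact lt_asymm h1 (inlL_lt_inrL _ _)
    · exact hij.2 (inrL_lt_inrL.1 h1) (inrL_lt_inrL.1 h2)
  · exact lt_asymm h2 (inlL_lt_inrL _ _)

/-- A permutation of half-edges that takes place in the middle diagram. -/
def betweenPerm (s : Equiv.Perm (D.V × Fin 3)) (t : Equiv.Perm ((between C D C').V × Fin 3))
    (h1 : ∀ h, t (midH C D C' h) = midH C D C' (s h))
    (h2 : ∀ h ∉ Set.range (midH C D C'), t h = h) :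
    Iso (between C (D.permVertices s) C') ((between C D C').permVertices t) where
  onV := Equiv.refl _
  rot := fun _ => 0
  onL := OrderIso.refl _
  onE := Equiv.refl _
  label_eq := by
    intro (l : (C.L ⊕ D.L) ⊕ C'.L)
    rcases l with (l | l) | l <;> rfl
  att_vertex := by
    rintro ((v | v) | v) k
    · rw [add_zero]
      refine congrArg (fun h => (between C D C').att (Sum.inl h)) (h2 (Sum.inl (Sum.inl v), k) ?_)
      rintro ⟨⟨w, l⟩, h⟩
      cases congrArg Prod.fst h
    · rw [add_zero]
      exact congrArg (fun h => (between C D C').att (Sum.inl h)) (h1 (v, k))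
    · rw [add_zero]
      refine congrArg (fun h => (between C D C').att (Sum.inl h)) (h2 (Sum.inr v, k) ?_)
      rintro ⟨⟨w, l⟩, h⟩
      cases congrArg Prod.fst h
  att_leg := by
    intro (l : (C.L ⊕ D.L) ⊕ C'.L)
    rcases l with (l | l) | l <;> rfl

lemma swap_apply_of_injective {X Y : Type*} [DecidableEq X] [DecidableEq Y] {f : X → Y}
    (hf : Function.Injective f) (x y : X) :
    (∀ z, Equiv.swap (f x) (f y) (f z) = f (Equiv.swap x y z)) ∧
      ∀ z ∉ Set.range f, Equiv.swap (f x) (f y) z = z :=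
  ⟨fun z => (hf.map_swap x y z).symm, fun _ hz => Equiv.swap_apply_of_ne_of_ne
    (fun h => hz ⟨x, h.symm⟩) (fun h => hz ⟨y, h.symm⟩)⟩

/-- An exchange of legs that takes place in the middle diagram. -/
def betweenSwap (i j : D.L) : Iso (between C (D.swapLegs i j) C')
    ((between C D C').swapLegs (midL C D C' i) (midL C D C' j)) :=
  have h1 := (swap_apply_of_injective (midL C D C').injective i j).1
  have h2 := (swap_apply_of_injective (midL C D C').injective i j).2
  have h3 : ∀ l : (between C (D.swapLegs i j) C').L,
      (between C D C').label (Equiv.swap (midL C D C' i) (midL C D C' j) l) =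
        (between C (D.swapLegs i j) C').label l ∧
      (between C D C').att (Sum.inr (Equiv.swap (midL C D C' i) (midL C D C' j) l)) =
        (between C (D.swapLegs i j) C').att (Sum.inr l) := by
    intro (l : (C.L ⊕ D.L) ⊕ C'.L)
    rcases l with (l | l) | l
    · have := h2 (inlL (juxt C D) C' (inlL C D l)) (by
        rintro ⟨y, h⟩
        exact inlL_ne_inrL _ _ ((inlL (juxt C D) C').injective h).symm)
      exact ⟨congrArg (between C D C').label this,
        congrArg (fun l => (between C D C').att (Sum.inr l)) this⟩
    · have := h1 l
      exact ⟨congrArg (between C D C').label this,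
        congrArg (fun l => (between C D C').att (Sum.inr l)) this⟩
    · have := h2 (inrL (juxt C D) C' l) (by
        rintro ⟨y, h⟩
        exact inlL_ne_inrL _ _ h)
      exact ⟨congrArg (between C D C').label this,
        congrArg (fun l => (between C D C').att (Sum.inr l)) this⟩
  { onV := Equiv.refl _
    rot := fun _ => 0
    onL := OrderIso.refl _
    onE := Equiv.refl _
    label_eq := fun l => (h3 l).1
    att_vertex := by rintro ((v | v) | v) k <;> rw [add_zero] <;> rfl
    att_leg := fun l => (h3 l).2 }

/-- The new element of the middle summand becomes the new element of the sum. -/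
def sumOptionEquiv (X Y Z : Type*) : (X ⊕ Option Y) ⊕ Z ≃ Option ((X ⊕ Y) ⊕ Z) where
  toFun v := match v with
    | Sum.inl (Sum.inl v) => some (Sum.inl (Sum.inl v))
    | Sum.inl (Sum.inr none) => none
    | Sum.inl (Sum.inr (some v)) => some (Sum.inl (Sum.inr v))
    | Sum.inr v => some (Sum.inr v)
  invFun v := match v with
    | some (Sum.inl (Sum.inl v)) => Sum.inl (Sum.inl v)
    | none => Sum.inl (Sum.inr none)
    | some (Sum.inl (Sum.inr v)) => Sum.inl (Sum.inr (some v))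
    | some (Sum.inr v) => Sum.inr v
  left_inv := by rintro ((v | _ | v) | v) <;> rfl
  right_inv := by rintro (_ | (v | v) | v) <;> rfl

/-- The legs that remain when a leg of the middle diagram is joined to another one. -/
def betweenForkLegs (i j : D.L) (hij : i ≠ j) (hij' : midL C D C' i ≠ midL C D C' j) :
    (between C (D.fork i j hij) C').L ≃
      ((between C D C').fork (midL C D C' i) (midL C D C' j) hij').L where
  toFun := fun l => match l with
    | Sum.inl (Sum.inl l) => ⟨Sum.inl (Sum.inl l), by rintro ⟨⟩⟩
    | Sum.inl (Sum.inr l) => ⟨Sum.inl (Sum.inr l.1), fun h => l.2 ((midL C D C').injective h)⟩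
    | Sum.inr l => ⟨Sum.inr l, by rintro ⟨⟩⟩
  invFun := fun l => match l with
    | ⟨Sum.inl (Sum.inl l), _⟩ => Sum.inl (Sum.inl l)
    | ⟨Sum.inl (Sum.inr l), h⟩ => Sum.inl (Sum.inr ⟨l, by rintro rfl; exact h rfl⟩)
    | ⟨Sum.inr l, _⟩ => Sum.inr l
  left_inv := by
    intro (l : (C.L ⊕ (D.fork i j hij).L) ⊕ C'.L)
    rcases l with (l | l) | l <;> rfl
  right_inv := by
    intro l
    obtain ⟨l, h⟩ := l
    change (C.L ⊕ D.L) ⊕ C'.L at l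
    rcases l with (l | l) | l <;> rfl

/-- A fork that takes place in the middle diagram. -/
def betweenFork (i j : D.L) (hij : i ≠ j) (hij' : midL C D C' i ≠ midL C D C' j) :
    Iso (between C (D.fork i j hij) C')
      ((between C D C').fork (midL C D C' i) (midL C D C' j) hij') :=
  WeakIso.toIso
  { onV := sumOptionEquiv C.V D.V C'.V
    rot := fun _ => 0
    onL := betweenForkLegs i j hij hij'
    onE := sumOptionEquiv C.E D.E C'.E
    label_eq := by
      intro (l : (C.L ⊕ (D.fork i j hij).L) ⊕ C'.L)
      rcases l with (l | l) | l <;> rfl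
    att_vertex := by
      rintro ((v | _ | v) | v) k <;> rw [add_zero]
      · rfl
      · fin_cases k <;> rfl
      · rfl
      · rfl
    att_leg := by
      intro (l : (C.L ⊕ (D.fork i j hij).L) ⊕ C'.L)
      rcases l with (l | l) | l
      · exact forkAtt_of_ne (between C D C') (i := midL C D C' i) (j := midL C D C' j)
          (l := betweenForkLegs i j hij hij' (Sum.inl (Sum.inl l))) (by rintro ⟨⟩)
      · by_cases h : l.1 = i
        · have h1 : (D.fork i j hij).att (Sum.inr l) = none := forkAtt_of_eq D h
          have h2 := forkAtt_of_eq (between C D C') (i := midL C D C' i) (j := midL C D C' j)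
            (l := betweenForkLegs i j hij hij' (Sum.inl (Sum.inr l)))
            (congrArg (midL C D C') h)
          exact h2.trans (congrArg (fun e => sumOptionEquiv C.E D.E C'.E (Sum.inl (Sum.inr e)))
            h1).symm
        · have h1 : (D.fork i j hij).att (Sum.inr l) = some (D.att (Sum.inr l.1)) :=
            forkAtt_of_ne D h
          have h2 := forkAtt_of_ne (between C D C') (i := midL C D C' i) (j := midL C D C' j)
            (l := betweenForkLegs i j hij hij' (Sum.inl (Sum.inr l)))
            (fun e => h ((midL C D C').injective e))
          exact h2.trans (congrArg (fun e => sumOptionEquiv C.E D.E C'.E (Sum.inl (Sum.inr e)))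
            h1).symm
      · exact forkAtt_of_ne (between C D C') (i := midL C D C' i) (j := midL C D C' j)
          (l := betweenForkLegs i j hij hij' (Sum.inr l)) (by rintro ⟨⟩) }
  (by
    intro x y hxy
    rcases juxt_cases x with ⟨x, rfl⟩ | ⟨x, rfl⟩ <;> rcases juxt_cases y with ⟨y, rfl⟩ | ⟨y, rfl⟩
    · replace hxy := inlL_lt_inlL.1 hxy
      rcases juxt_cases x with ⟨x, rfl⟩ | ⟨x, rfl⟩ <;>
        rcases juxt_cases y with ⟨y, rfl⟩ | ⟨y, rfl⟩
      · exact (inlL_lt_inlL (D := juxt C D) (D' := C') (x := inlL C D x) (y := inlL C D y)).2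
          (inlL_lt_inlL.2 (inlL_lt_inlL.1 hxy))
      · exact (inlL_lt_inlL (D := juxt C D) (D' := C') (x := inlL C D x)
          (y := inrL C D y.1)).2 (inlL_lt_inrL _ _)
      · exact absurd hxy (lt_asymm (inlL_lt_inrL _ _))
      · exact (inlL_lt_inlL (D := juxt C D) (D' := C') (x := inrL C D x.1)
          (y := inrL C D y.1)).2 (inrL_lt_inrL.2 (inrL_lt_inrL.1 hxy : x < y))
    · rcases juxt_cases x with ⟨x, rfl⟩ | ⟨x, rfl⟩
      · exact inlL_lt_inrL (D := juxt C D) (D' := C') (inlL C D x) y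
      · exact inlL_lt_inrL (D := juxt C D) (D' := C') (inrL C D x.1) y
    · exact absurd hxy (lt_asymm (inlL_lt_inrL _ _))
    · exact (inrL_lt_inrL (D := juxt C D) (D' := C') (x := x) (y := y)).2
        (inrL_lt_inrL.1 hxy))

/-- The empty pairing. -/
def Pairing.empty (D : Diagram) : D.Pairing where
  pairs := ∅
  card_two := by simp
  bot := by simp
  disj := by simp

/-- Gluing along the empty pairing does nothing. -/
def glueEmpty (D : Diagram) : Iso D (D.glue (Pairing.empty D)) :=
  WeakIso.toIso
  { onV := Equiv.refl _
    rot := fun _ => 0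
    onL :=
      { toFun := fun x => ⟨x, fun p hp => absurd hp (Finset.notMem_empty p)⟩
        invFun := fun x => x.1
        left_inv := fun _ => rfl
        right_inv := fun _ => rfl }
    onE :=
      { toFun := Quot.mk _
        invFun := Quot.lift id (by
          rintro _ _ ⟨p, hp, _⟩
          exact absurd hp (Finset.notMem_empty p))
        left_inv := fun _ => rfl
        right_inv := by
          intro x
          induction x using Quot.ind; rfl }
    label_eq := fun _ => rfl
    att_vertex := fun v k => by rw [add_zero]; rfl
    att_leg := fun _ => rfl }
  (fun _ _ h => h)

end

end Diagram

lemma formal_mul (D D' : Diagram) : formal D * formal D' = formal (juxt D D') := by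
  rw [formal, formal, ← map_mul]
  rfl

lemma formal_between (C D C' : Diagram) :
    formal C * formal D * formal C' = formal (between C D C') := by
  rw [formal_mul, formal_mul, between]

open Classical in
lemma formal_between_rotate (C D C' : Diagram) (u v : D.V) :
    formal (between C (D.rotate u v) C') =
        formal ((between C D C').rotate (midV C D C' u) (midV C D C' v)) ∧
      formal (between C ((D.rotate u v).rotate u v) C') =
        formal (((between C D C').rotate (midV C D C' u) (midV C D C' v)).rotate
          (midV C D C' u) (midV C D C' v)) := by
  have hs := fun x y => swap_apply_of_injective (midH_injective (C := C) (D := D) (C' := C')) x y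
  obtain ⟨s, hs'⟩ : ∃ s : Equiv.Perm (D.V × Fin 3),
    s = Equiv.swap (u, 1) (u, 2) * Equiv.swap (u, 2) (v, 1) := ⟨_, rfl⟩
  obtain ⟨t, ht'⟩ : ∃ t : Equiv.Perm ((between C D C').V × Fin 3),
    t = Equiv.swap (midV C D C' u, 1) (midV C D C' u, 2) *
      Equiv.swap (midV C D C' u, 2) (midV C D C' v, 1) := ⟨_, rfl⟩
  have h1 : ∀ h, t (midH C D C' h) = midH C D C' (s h) := by
    intro h
    rw [ht', hs', Equiv.Perm.mul_apply, Equiv.Perm.mul_apply, ← (hs (u, 1) (u, 2)).1,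
      ← (hs (u, 2) (v, 1)).1]
    rfl
  have h2 : ∀ h ∉ Set.range (midH C D C'), t h = h := by
    intro h hh
    rw [ht', Equiv.Perm.mul_apply]
    have e1 := (hs (u, 1) (u, 2)).2 h hh
    have e2 := (hs (u, 2) (v, 1)).2 h hh
    exact (congrArg _ e2).trans e1
  have e1 : D.rotate u v = D.permVertices s := by rw [hs']; rfl
  have e2 : (between C D C').rotate (midV C D C' u) (midV C D C' v) =
    (between C D C').permVertices t := by rw [ht']; rfl
  have e3 : (D.rotate u v).rotate u v = (D.permVertices s).permVertices s := by rw [hs']; rfl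
  have e4 : ((between C D C').rotate (midV C D C' u) (midV C D C' v)).rotate
      (midV C D C' u) (midV C D C' v) = ((between C D C').permVertices t).permVertices t := by
    rw [ht']; rfl
  constructor
  · exact (congrArg (fun X => formal (between C X C')) e1).trans
      ((formal_congr (betweenPerm s t h1 h2)).trans (congrArg formal e2.symm))
  · refine (congrArg (fun X => formal (between C X C')) e3).trans
      (Eq.trans ?_ (congrArg formal e4.symm))
    rw [formal_congr (permPerm _ t t), ← formal_congr (betweenPerm (s * s) (t * t) (fun h => ?_)
      (fun h hh => ?_)), ← formal_between, ← formal_between, formal_congr (permPerm D s s)]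
    · rw [Equiv.Perm.mul_apply, Equiv.Perm.mul_apply, h1, h1]
    · rw [Equiv.Perm.mul_apply, h2 h hh, h2 h hh]

/-- The relations may be applied to a part of a diagram. -/
lemma Rel.between {κ : ℚ} {x y : Formal} (h : Rel κ x y) (C C' : Diagram) :
    Rel κ (formal C * x * formal C') (formal C * y * formal C') := by
  classical
  have hcomm : ∀ (q : ℚ) (z : Formal), formal C * (q • z) * formal C' =
      q • (formal C * z * formal C') := by
    intro q z
    rw [mul_smul_comm, smul_mul_assoc]
  cases h with
  | as D v =>
    rw [mul_neg, neg_mul, formal_between, formal_between]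
    have hs := swap_apply_of_injective (midH_injective (C := C) (D := D) (C' := C')) (v, 1) (v, 2)
    have e := formal_congr (betweenPerm (C := C) (C' := C') _ _ hs.1 hs.2)
    have e' : formal (Diagram.between C (D.flip v) C') =
        formal ((Diagram.between C D C').flip (midV C D C' v)) := by
      refine Eq.trans ?_ (e.trans ?_)
      · unfold Diagram.flip
        congr!
      · unfold Diagram.flip
        congr!
    rw [e']
    exact Rel.as (Diagram.between C D C') (midV C D C' v)
  | ihx D u v huv h =>
    rw [mul_add, mul_add, add_mul, add_mul, mul_zero, zero_mul, formal_between, formal_between,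
      formal_between, (formal_between_rotate C D C' u v).1, (formal_between_rotate C D C' u v).2]
    exact Rel.ihx _ _ _ (fun h => huv (midV_injective h))
      (congrArg (fun e => Sum.inl (Sum.inr e)) h)
  | move D i j hij h =>
    rw [hcomm, formal_between, formal_between, formal_congr (betweenSwap i j)]
    exact Rel.move (Diagram.between C D C') _ _ (midL_covBy hij) h
  | stu D i j hij hi hj =>
    rw [mul_sub, sub_mul, formal_between, formal_between, formal_between,
      formal_congr (betweenSwap i j),
      formal_congr (betweenFork i j hij.lt.ne (midL_covBy hij).lt.ne)]
    exact Rel.stu (Diagram.between C D C') _ _ (midL_covBy hij) hi hj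
  | comm D i j hij hi hj =>
    rw [formal_between, formal_between, formal_congr (betweenSwap i j)]
    exact Rel.comm (Diagram.between C D C') _ _ (midL_covBy hij) hi hj
  | clifford D i j hij hi hj =>
    have h1 : Pairing.single (Diagram.between C D C') (midL C D C' i) (midL C D C' j)
        (midL_covBy hij).lt.ne hi hj = Pairing.union (Pairing.union (Pairing.empty C)
          (Pairing.single D i j hij.lt.ne hi hj)) (Pairing.empty C') := by
      apply Pairing.ext_pairs
      ext p
      have hm : ∀ q : Finset (C.juxt D).L,
          q ∈ (Pairing.union (Pairing.empty C) (Pairing.single D i j hij.lt.ne hi hj)).pairs ↔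
            q = ({i, j} : Finset D.L).map (inrL C D) := by
        intro q
        rw [Pairing.mem_union]
        simp [Pairing.single, Pairing.empty, eq_comm]
      refine Iff.trans ?_ (Pairing.mem_union (D := juxt C D) (D' := C')).symm
      simp only [hm]
      have e : ((({i, j} : Finset D.L).map (inrL C D)).map (inlL (juxt C D) C')) =
          {midL C D C' i, midL C D C' j} := by
        rw [Finset.map_map, Finset.map_insert, Finset.map_singleton]
        rfl
      constructor
      · intro h
        exact Or.inl ⟨_, rfl, e.trans (Finset.mem_singleton.1 h).symm⟩
      · rintro (⟨q, rfl, h⟩ | ⟨q, hq, _⟩)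
        · exact Finset.mem_singleton.2 (h.symm.trans e)
        · exact absurd hq (Finset.notMem_empty _)
    have h2 : formal (Diagram.between C (D.glue (Pairing.single D i j hij.lt.ne hi hj)) C') =
        formal ((Diagram.between C D C').glue (Pairing.single (Diagram.between C D C')
          (midL C D C' i) (midL C D C' j) (midL_covBy hij).lt.ne hi hj)) := by
      rw [h1, ← formal_between, formal_congr (glueEmpty C), formal_congr (glueEmpty C'),
        formal_mul, formal_congr (juxtGlue _ _), formal_mul, formal_congr (juxtGlue _ _)]
      rfl
    rw [mul_add, add_mul, hcomm, formal_between, formal_between, formal_between,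
      formal_congr (betweenSwap i j), h2]
    exact Rel.clifford (Diagram.between C D C') _ _ (midL_covBy hij) hi hj

/-! ### The gluing map -/

/-- An additive map that respects a relation inside all products factors through the quotient of
the ring by this relation. -/
lemma eq_of_mkRingHom_eq {R T : Type*} [Ring R] [AddCommGroup T] {r : R → R → Prop} (f : R →+ T)
    (hf : ∀ x y, r x y → ∀ c d, f (c * x * d) = f (c * y * d)) {x y : R}
    (h : RingQuot.mkRingHom r x = RingQuot.mkRingHom r y) : f x = f y := by
  have key : ∀ x y, RingQuot.Rel r x y → ∀ c d, f (c * x * d) = f (c * y * d) := by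
    intro x y h
    induction h with
    | of h => exact hf _ _ h
    | add_left _ ih =>
      intro c d
      rw [mul_add, mul_add, add_mul, add_mul, map_add, map_add, ih]
    | mul_left _ ih =>
      intro c d
      rw [← mul_assoc, ← mul_assoc, mul_assoc _ _ d, mul_assoc _ _ d, ih]
    | mul_right _ ih =>
      intro c d
      rw [← mul_assoc, ← mul_assoc, ih]
  rw [RingQuot.mkRingHom_def] at h
  have h' : EqvGen (RingQuot.Rel r) x y := Quot.eqvGen_exact (congrArg RingQuot.toQuot h)
  clear h
  induction h' with
  | rel x y h => simpa using key x y h 1 1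
  | refl => rfl
  | symm _ _ _ ih => exact ih.symm
  | trans _ _ _ _ _ ih1 ih2 => exact ih1.trans ih2

/-- The gluing sum of an isomorphism class. -/
def classGlueSum : IsoClass → Space 0 :=
  Quotient.lift glueSum (s := isoSetoid) fun _ _ h => glueSum_congr h.some

/-- The linear extension of `glueSum` to formal combinations of diagrams. -/
def formalGlue : Formal →ₗ[ℚ] Space 0 :=
  (Finsupp.linearCombination ℚ classGlueSum).comp
    (MonoidAlgebra.coeffLinearEquiv ℚ).toLinearMap

lemma formalGlue_formal (D : Diagram) : formalGlue (formal D) = glueSum D := by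
  have h : (MonoidAlgebra.coeffLinearEquiv ℚ) (formal D) = Finsupp.single D.isoClass 1 := rfl
  rw [formalGlue, LinearMap.comp_apply, LinearEquiv.coe_coe, h, Finsupp.linearCombination_single,
    one_smul]
  rfl

@[elab_as_elim]
lemma formal_induction {p : Formal → Prop} (x : Formal) (hf : ∀ D, p (formal D))
    (ha : ∀ x y, p x → p y → p (x + y)) (hs : ∀ (q : ℚ) x, p x → p (q • x)) : p x :=
  MonoidAlgebra.induction_on x (fun m => Quotient.inductionOn m hf) ha hs

/-- The sum over the pairings respects the relations of `Ŵ_F`. -/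
lemma formalGlue_rel {x y : Formal} (h : Rel 1 x y) : formalGlue x = formalGlue y := by
  cases h with
  | as D v => rw [map_neg, formalGlue_formal, formalGlue_formal, glueSum_flip D v]
  | ihx D u v huv h =>
    rw [map_add, map_add, map_zero, formalGlue_formal, formalGlue_formal, formalGlue_formal,
      glueSum_rotate D u v huv h]
  | move D i j hij h =>
    rw [map_smul, formalGlue_formal, formalGlue_formal, glueSum_move D hij h]
  | stu D i j hij hi hj =>
    rw [map_sub, formalGlue_formal, formalGlue_formal, formalGlue_formal, glueSum_stu D hij hi hj]
  | comm D i j hij hi hj =>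
    rw [formalGlue_formal, formalGlue_formal, glueSum_comm D hij hi hj]
  | clifford D i j hij hi hj =>
    rw [map_add, one_smul, formalGlue_formal, formalGlue_formal, formalGlue_formal,
      glueSum_clifford D hij hi hj]

lemma formalGlue_mul_rel {x y : Formal} (h : Rel 1 x y) (c d : Formal) :
    formalGlue (c * x * d) = formalGlue (c * y * d) := by
  refine formal_induction c (fun C => ?_) (fun c c' h h' => ?_) (fun q c h => ?_)
  · refine formal_induction d (fun C' => ?_) (fun d d' h h' => ?_) (fun q d h => ?_)
    · exact formalGlue_rel (h.between C C')
    · rw [mul_add, mul_add, map_add, map_add, h, h']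
    · rw [mul_smul_comm, mul_smul_comm, map_smul, map_smul, h]
  · rw [add_mul, add_mul, add_mul, add_mul, map_add, map_add, h, h']
  · rw [smul_mul_assoc, smul_mul_assoc, smul_mul_assoc, smul_mul_assoc, map_smul, map_smul, h]

lemma mkAlgHom_eq_mkRingHom (κ : ℚ) (x : Formal) :
    RingQuot.mkAlgHom ℚ (Rel κ) x = RingQuot.mkRingHom (Rel κ) x := by
  rw [← RingQuot.mkAlgHom_coe ℚ]
  rfl

lemma formalGlue_eq_of_mk_eq {x y : Formal}
    (h : RingQuot.mkAlgHom ℚ (Rel 1) x = RingQuot.mkAlgHom ℚ (Rel 1) y) :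
    formalGlue x = formalGlue y := by
  rw [mkAlgHom_eq_mkRingHom, mkAlgHom_eq_mkRingHom] at h
  exact eq_of_mkRingHom_eq formalGlue.toAddMonoidHom
    (fun x y h c d => formalGlue_mul_rel h c d) h

/-- The map `λ`, on finite combinations of diagrams of all types. -/
def gluingMap : Space 1 →ₗ[ℚ] Space 0 :=
  have hs := RingQuot.mkAlgHom_surjective ℚ (Rel 1)
  have hm : ∀ x, formalGlue (Function.surjInv hs (RingQuot.mkAlgHom ℚ (Rel 1) x)) = formalGlue x :=
    fun x => formalGlue_eq_of_mk_eq (Function.surjInv_eq hs _)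
  { toFun := fun x => formalGlue (Function.surjInv hs x)
    map_add' := fun x y => by
      obtain ⟨x, rfl⟩ := hs x
      obtain ⟨y, rfl⟩ := hs y
      rw [← map_add, hm, hm, hm, map_add]
    map_smul' := fun q x => by
      obtain ⟨x, rfl⟩ := hs x
      rw [← map_smul, hm, hm, map_smul, RingHom.id_apply] }

lemma gluingMap_cls (D : Diagram) : gluingMap (cls 1 D) = glueSum D :=
  (formalGlue_eq_of_mk_eq (Function.surjInv_eq (RingQuot.mkAlgHom_surjective ℚ (Rel 1))
    (cls 1 D))).trans (formalGlue_formal D)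

/-- Gluing `bot`-legs does not change the type. -/
lemma bidegree_glue {D : Diagram} (P : D.Pairing) : (D.glue P).bidegree = D.bidegree := by
  classical
  have key : ∀ g : Leg → ℕ, g Leg.bot = 0 →
      ∑ᶠ l, g ((D.glue P).label l) = ∑ᶠ l, g (D.label l) := by
    intro g hg
    have h : ∑ᶠ l, g ((D.glue P).label l) =
        ∑ᶠ l : {l : D.L // ∀ p ∈ P.pairs, l ∉ p}, g (D.label l) := rfl
    rw [h, finsum_subtype_eq_finsum_cond (f := fun l => g (D.label l))]
    refine finsum_congr fun l => ?_
    by_cases hl : ∀ p ∈ P.pairs, l ∉ p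
    · exact finsum_eq_if.trans (if_pos hl)
    · refine finsum_eq_if.trans ((if_neg hl).trans ?_)
      push Not at hl
      obtain ⟨p, hp, hl⟩ := hl
      rw [P.bot p hp l hl, hg]
  exact Prod.ext (key _ rfl) (key _ rfl)

lemma glueTerm_mem_piece {D : Diagram} (P : D.Pairing) : glueTerm P ∈ piece 0 D.bidegree :=
  Submodule.smul_mem _ _ (cls_mem 0 _ (bidegree_glue P))

lemma glueSum_mem_piece (D : Diagram) : glueSum D ∈ piece 0 D.bidegree :=
  Submodule.sum_mem _ fun P _ => glueTerm_mem_piece P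

lemma gluingMap_mem_piece {t : ℕ × ℕ} {x : Space 1} (hx : x ∈ piece 1 t) :
    gluingMap x ∈ piece 0 t := by
  have h : piece 1 t ≤ (piece 0 t).comap gluingMap := by
    rw [piece, Submodule.span_le]
    rintro _ ⟨D, rfl, rfl⟩
    change gluingMap (cls 1 D) ∈ piece 0 D.bidegree
    rw [gluingMap_cls]
    exact glueSum_mem_piece D
  exact h hx

lemma IsLambda.apply_eq {lam : ∀ t : ℕ × ℕ, piece 1 t →ₗ[ℚ] piece 0 t} (h : IsLambda lam)
    {t : ℕ × ℕ} (x : piece 1 t) : (lam t x : Space 0) = gluingMap x := by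
  have h' : (piece 0 t).subtype.comp (lam t) = gluingMap.comp (piece 1 t).subtype := by
    refine LinearMap.ext_on (s := {x : piece 1 t | ∃ D, D.bidegree = t ∧ cls 1 D = x}) ?_ ?_
    · apply Submodule.map_injective_of_injective (piece 1 t).injective_subtype
      rw [Submodule.map_span, Submodule.map_top, Submodule.range_subtype]
      conv_rhs => rw [piece]
      congr 1
      ext y
      constructor
      · rintro ⟨x, ⟨D, hD, hx⟩, rfl⟩
        exact ⟨D, hD, hx⟩
      · rintro ⟨D, hD, rfl⟩
        exact ⟨⟨cls 1 D, cls_mem 1 D hD⟩, ⟨D, hD, rfl⟩, rfl⟩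
    · rintro ⟨_, hx⟩ ⟨D, hD, rfl⟩
      exact (h t D hD).trans (gluingMap_cls D).symm
  exact LinearMap.congr_fun h' x

/-- The sum over the pairings is well defined modulo the relations, and it is determined by its
values on diagrams, as these span. -/
lemma existsUnique_isLambda :
    ∃! lam : ∀ t : ℕ × ℕ, piece 1 t →ₗ[ℚ] piece 0 t, IsLambda lam := by
  refine ⟨fun t => gluingMap.restrict fun x hx => gluingMap_mem_piece hx,
    fun t D h => gluingMap_cls D, fun lam h => ?_⟩
  funext t
  ext x
  exact h.apply_eq x

/-! ### Families of blocks -/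

/-- Two maps with complementary images decompose a family. -/
def sumSigma {I J K : Type*} {f : J → I} {g : K → I} (h : Function.Bijective (Sum.elim f g))
    (X : I → Type*) : (Σ j, X (f j)) ⊕ (Σ k, X (g k)) ≃ Σ i, X i :=
  Equiv.ofBijective (Sum.elim (fun x => ⟨f x.1, x.2⟩) (fun x => ⟨g x.1, x.2⟩)) (by
    constructor
    · rintro (⟨j, x⟩ | ⟨j, x⟩) (⟨k, y⟩ | ⟨k, y⟩) e
      · have hjk : j = k := Sum.inl_injective (h.1 (congrArg Sigma.fst e : f j = f k))
        subst hjk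
        simpa using e
      · exact absurd (h.1 (a₁ := Sum.inl j) (a₂ := Sum.inr k) (congrArg Sigma.fst e)) (by simp)
      · exact absurd (h.1 (a₁ := Sum.inr j) (a₂ := Sum.inl k) (congrArg Sigma.fst e)) (by simp)
      · have hjk : j = k := Sum.inr_injective (h.1 (congrArg Sigma.fst e : g j = g k))
        subst hjk
        simpa using e
    · rintro ⟨i, x⟩
      obtain ⟨j | k, rfl⟩ := h.2 i
      · exact ⟨Sum.inl ⟨j, x⟩, rfl⟩
      · exact ⟨Sum.inr ⟨k, x⟩, rfl⟩)

namespace Diagram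

section

variable {I J K : Type} [Finite I] [LinearOrder I] [Finite J] [LinearOrder J] [Finite K]
  [LinearOrder K]

/-- The diagrams of a family that is indexed by a finite linear order, placed along the orienting
line in this order. -/
def big (d : I → Diagram) : Diagram where
  V := Σ i, (d i).V
  L := Σₗ i, (d i).L
  E := Σ i, (d i).E
  finL := inferInstanceAs (Finite (Σ i, (d i).L))
  label := fun l => (d (ofLex l).1).label (ofLex l).2
  att := Sum.elim (fun h => ⟨h.1.1, (d h.1.1).att (Sum.inl (h.1.2, h.2))⟩)
    (fun l => ⟨(ofLex l).1, (d (ofLex l).1).att (Sum.inr (ofLex l).2)⟩)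
  ends := by
    rintro ⟨i, e⟩
    rw [← Nat.card_congr (Equiv.ofBijective (α := {h // (d i).att h = e})
      (fun h => ⟨Sum.map (fun x => (⟨i, x.1⟩, x.2)) (fun x => toLex ⟨i, x⟩) h.1, by
        obtain ⟨(⟨v, k⟩ | l), rfl⟩ := h <;> rfl⟩) ⟨?_, ?_⟩)]
    · exact (d i).ends e
    · rintro ⟨x, hx⟩ ⟨y, hy⟩ h
      have h' := congrArg Subtype.val h
      apply Subtype.ext
      rcases x with ⟨v, k⟩ | l <;> rcases y with ⟨v', k'⟩ | l'
      · simpa using h'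
      · cases h'
      · cases h'
      · have := toLex.injective (Sum.inr_injective h')
        simpa using this
    · rintro ⟨⟨⟨i', v⟩, k⟩ | ⟨i', l⟩, hx⟩
      · obtain rfl : i' = i := congrArg Sigma.fst hx
        exact ⟨⟨Sum.inl (v, k), eq_of_heq (Sigma.mk.inj hx).2⟩, rfl⟩
      · obtain rfl : i' = i := congrArg Sigma.fst hx
        exact ⟨⟨Sum.inr l, eq_of_heq (Sigma.mk.inj hx).2⟩, rfl⟩

/-- The legs of a block. -/
def blockL (d : I → Diagram) (i : I) : (d i).L ↪ (big d).L :=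
  ⟨fun x => toLex ⟨i, x⟩, fun _ _ h => eq_of_heq (Sigma.mk.inj (toLex.injective h)).2⟩

lemma big_cases {d : I → Diagram} (x : (big d).L) : ∃ i y, x = blockL d i y :=
  ⟨(ofLex x).1, (ofLex x).2, rfl⟩

lemma blockL_inj {d : I → Diagram} {i j : I} {x : (d i).L} {y : (d j).L}
    (h : blockL d i x = blockL d j y) : i = j :=
  congrArg Sigma.fst (toLex.injective h)

lemma blockL_lt_of_lt {d : I → Diagram} {i j : I} (h : i < j) (x : (d i).L) (y : (d j).L) :
    blockL d i x < blockL d j y := Sigma.Lex.left _ _ h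

lemma blockL_lt_blockL {d : I → Diagram} {i : I} {x y : (d i).L} :
    blockL d i x < blockL d i y ↔ x < y := by
  constructor
  · intro h
    rcases Sigma.lex_iff.1 h with h | ⟨_, h⟩
    · exact absurd h (lt_irrefl _)
    · exact h
  · intro h
    exact Sigma.Lex.right _ _ h

lemma le_of_blockL_lt {d : I → Diagram} {i j : I} {x : (d i).L} {y : (d j).L}
    (h : blockL d i x < blockL d j y) : i ≤ j := by
  by_contra hij
  exact lt_asymm h (blockL_lt_of_lt (not_le.1 hij) y x)

section

variable {f : J → I} {g : K → I}

/-- Two complementary subfamilies, placed next to each other. -/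
def juxtBig (h : Function.Bijective (Sum.elim f g)) (d : I → Diagram) :
    WeakIso (juxt (big fun j => d (f j)) (big fun k => d (g k))) (big d) where
  onV := sumSigma h fun i => (d i).V
  rot := fun _ => 0
  onL := sumSigma h fun i => (d i).L
  onE := sumSigma h fun i => (d i).E
  label_eq := by
    intro (l : (Σ j, (d (f j)).L) ⊕ (Σ k, (d (g k)).L))
    rcases l with l | l <;> rfl
  att_vertex := by
    rintro (v | v) k <;> rw [add_zero] <;> rfl
  att_leg := by
    intro (l : (Σ j, (d (f j)).L) ⊕ (Σ k, (d (g k)).L))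
    rcases l with l | l <;> rfl

variable (h : Function.Bijective (Sum.elim f g)) {d : I → Diagram}

lemma juxtBig_inl (j : J) (x : (d (f j)).L) :
    (juxtBig h d).onL (inlL _ _ (blockL (fun j => d (f j)) j x)) = blockL d (f j) x := rfl

lemma juxtBig_inr (k : K) (x : (d (g k)).L) :
    (juxtBig h d).onL (inrL _ _ (blockL (fun k => d (g k)) k x)) = blockL d (g k) x := rfl

lemma big_lt_of_strictMono {f : J → I} (hf : StrictMono f) {j j' : J} {x : (d (f j)).L}
    {y : (d (f j')).L} (hxy : blockL (fun j => d (f j)) j x < blockL (fun j => d (f j)) j' y) :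
    blockL d (f j) x < blockL d (f j') y := by
  rcases (le_of_blockL_lt hxy).lt_or_eq with hj | rfl
  · exact blockL_lt_of_lt (hf hj) _ _
  · exact blockL_lt_blockL.2 ((blockL_lt_blockL (d := fun j => d (f j))).1 hxy)

/-- The inversions between two complementary subfamilies are between a leg of the first and a leg
of the second one. -/
lemma juxtBig_inversion (hf : StrictMono f) (hg : StrictMono g)
    {x y : (juxt (big fun j => d (f j)) (big fun k => d (g k))).L} (hxy : x < y)
    (hyx : (juxtBig h d).onL y < (juxtBig h d).onL x) :
    ∃ j l k m, x = inlL _ _ (blockL (fun j => d (f j)) j l) ∧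
      y = inrL _ _ (blockL (fun k => d (g k)) k m) ∧ g k < f j := by
  rcases juxt_cases x with ⟨x, rfl⟩ | ⟨x, rfl⟩ <;> rcases juxt_cases y with ⟨y, rfl⟩ | ⟨y, rfl⟩ <;>
    obtain ⟨j, l, rfl⟩ := big_cases x <;> obtain ⟨k, m, rfl⟩ := big_cases y
  · exact absurd hyx (lt_asymm (big_lt_of_strictMono hf (inlL_lt_inlL.1 hxy)))
  · refine ⟨j, l, k, m, rfl, rfl, lt_of_le_of_ne (le_of_blockL_lt hyx) fun e => ?_⟩
    exact absurd (h.1 (a₁ := Sum.inl j) (a₂ := Sum.inr k) e.symm) (by simp)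
  · exact absurd hxy (lt_asymm (inlL_lt_inrL _ _))
  · exact absurd hyx (lt_asymm (big_lt_of_strictMono hg (inrL_lt_inrL.1 hxy)))

/-- A diagram is balanced if it has no curvature legs and its legs of odd grade can be matched in
pairs; in particular their number is even. -/
def Balanced (D : Diagram) : Prop :=
  (∀ l, D.label l ≠ Leg.curv) ∧
    ∃ s : D.L → D.L, ∀ l, D.IsOdd l → D.IsOdd (s l) ∧ s (s l) = l ∧ s l ≠ l

/-- As every block contains an even number of odd legs, exchanging blocks causes an even number of
inversions. -/
lemma even_invNum_juxtBig (hf : StrictMono f) (hg : StrictMono g) (hd : ∀ i, (d i).Balanced) :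
    Even (invNum (juxtBig h d).onL
      (fun x y => IsOdd _ x ∧ IsOdd _ y)) := by
  classical
  choose hc s hs using hd
  let D₁ := big fun j => d (f j)
  let D₂ := big fun k => d (g k)
  let t : (juxt D₁ D₂).L → (juxt D₁ D₂).L := fun x => match x with
    | Sum.inl ⟨j, l⟩ => inlL D₁ D₂ (blockL (fun j => d (f j)) j (s _ l))
    | Sum.inr y => inrL D₁ D₂ y
  have ht : ∀ j l, t (inlL D₁ D₂ (blockL (fun j => d (f j)) j l)) =
    inlL D₁ D₂ (blockL (fun j => d (f j)) j (s _ l)) := fun _ _ => rfl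
  unfold invNum
  refine even_card_of_involution _ (fun x => (t x.1, x.2)) ?_ ?_ ?_
  · rintro ⟨x, y⟩ hxy
    simp only [Finset.mem_filter, Finset.mem_univ, true_and] at hxy ⊢
    obtain ⟨h1, h2, h3, h4⟩ := hxy
    obtain ⟨j, l, k, m, rfl, rfl, hjk⟩ := juxtBig_inversion h hf hg h1 h2
    rw [ht]
    exact ⟨inlL_lt_inrL _ _, blockL_lt_of_lt hjk _ _, (hs (f j) l h3).1, h4⟩
  · rintro ⟨x, y⟩ hxy
    simp only [Finset.mem_filter, Finset.mem_univ, true_and] at hxy ⊢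
    obtain ⟨h1, h2, h3, h4⟩ := hxy
    obtain ⟨j, l, k, m, rfl, rfl, hjk⟩ := juxtBig_inversion h hf hg h1 h2
    rw [ht, ht, (hs (f j) l h3).2.1]
  · rintro ⟨x, y⟩ hxy
    simp only [Finset.mem_filter, Finset.mem_univ, true_and] at hxy ⊢
    obtain ⟨h1, h2, h3, h4⟩ := hxy
    obtain ⟨j, l, k, m, rfl, rfl, hjk⟩ := juxtBig_inversion h hf hg h1 h2
    rw [ht]
    intro e
    exact (hs (f j) l h3).2.2
      ((blockL _ j).injective ((inlL D₁ D₂).injective (congrArg Prod.fst e)))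

/-- The union of pairings of two complementary subfamilies. -/
def Pairing.combine (P : (big fun j => d (f j)).Pairing) (P' : (big fun k => d (g k)).Pairing) :
    (big d).Pairing :=
  (P.union P').map (juxtBig h d).onL (juxtBig h d).label_eq

/-- The legs of a subfamily. -/
def subL (hf : Function.Injective f) (d : I → Diagram) : (big fun j => d (f j)).L ↪ (big d).L :=
  ⟨fun x => toLex ⟨f (ofLex x).1, (ofLex x).2⟩, by
    intro x y e
    obtain ⟨i, x, rfl⟩ := big_cases x
    obtain ⟨j, y, rfl⟩ := big_cases y
    obtain rfl : i = j := hf (blockL_inj e)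
    exact congrArg (blockL _ i) ((blockL d (f i)).injective e)⟩

lemma Pairing.mem_combine {P : (big fun j => d (f j)).Pairing}
    {P' : (big fun k => d (g k)).Pairing} (hf : Function.Injective f) (hg : Function.Injective g)
    {p : Finset (big d).L} : p ∈ (P.combine h P').pairs ↔
      (∃ q ∈ P.pairs, q.map (subL hf d) = p) ∨ ∃ q ∈ P'.pairs, q.map (subL hg d) = p := by
  have h1 : ∀ q : Finset (big fun j => d (f j)).L,
      (q.map (inlL _ _)).map (juxtBig h d).onL.toEmbedding = q.map (subL hf d) := fun q =>
    Finset.map_map _ _ q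
  have h2 : ∀ q : Finset (big fun k => d (g k)).L,
      (q.map (inrL _ _)).map (juxtBig h d).onL.toEmbedding = q.map (subL hg d) := fun q =>
    Finset.map_map _ _ q
  rw [Pairing.combine, Pairing.mem_map]
  constructor
  · rintro ⟨r, hr, rfl⟩
    rcases Pairing.mem_union.1 hr with ⟨q, hq, rfl⟩ | ⟨q, hq, rfl⟩
    · exact Or.inl ⟨q, hq, (h1 q).symm⟩
    · exact Or.inr ⟨q, hq, (h2 q).symm⟩
  · rintro (⟨q, hq, rfl⟩ | ⟨q, hq, rfl⟩)
    · exact ⟨_, Pairing.map_inlL_mem_union.2 hq, h1 q⟩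
    · exact ⟨_, Pairing.map_inrL_mem_union.2 hq, h2 q⟩

lemma Pairing.pair_inl_mem_combine {P : (big fun j => d (f j)).Pairing}
    {P' : (big fun k => d (g k)).Pairing} {j j' : J} {x : (d (f j)).L} {y : (d (f j')).L} :
    {blockL d (f j) x, blockL d (f j') y} ∈ (P.combine h P').pairs ↔
      {blockL (fun j => d (f j)) j x, blockL (fun j => d (f j)) j' y} ∈ P.pairs := by
  rw [← juxtBig_inl h, ← juxtBig_inl h, Pairing.combine, Pairing.pair_mem_map,
    Pairing.inl_mem_union]

lemma Pairing.pair_inr_mem_combine {P : (big fun j => d (f j)).Pairing}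
    {P' : (big fun k => d (g k)).Pairing} {j j' : K} {x : (d (g j)).L} {y : (d (g j')).L} :
    {blockL d (g j) x, blockL d (g j') y} ∈ (P.combine h P').pairs ↔
      {blockL (fun j => d (g j)) j x, blockL (fun j => d (g j)) j' y} ∈ P'.pairs := by
  rw [← juxtBig_inr h, ← juxtBig_inr h, Pairing.combine, Pairing.pair_mem_map,
    Pairing.inr_mem_union]

lemma Pairing.pair_notMem_combine {P : (big fun j => d (f j)).Pairing}
    {P' : (big fun k => d (g k)).Pairing} {j : J} {k : K} {x : (d (f j)).L} {y : (d (g k)).L} :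
    {blockL d (f j) x, blockL d (g k) y} ∉ (P.combine h P').pairs := by
  rw [← juxtBig_inl h, ← juxtBig_inr h, Pairing.combine, Pairing.pair_mem_map]
  exact Pairing.inl_inr_notMem_union

end

end

end Diagram

/-- The terms of complementary subfamilies multiply. -/
lemma glueTerm_combine {I J K : Type} [Finite I] [LinearOrder I] [Finite J] [LinearOrder J]
    [Finite K] [LinearOrder K] {f : J → I} {g : K → I} (h : Function.Bijective (Sum.elim f g))
    (hf : StrictMono f) (hg : StrictMono g) {d : I → Diagram} (hd : ∀ i, (d i).Balanced)
    (P : (big fun j => d (f j)).Pairing) (P' : (big fun k => d (g k)).Pairing) :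
    glueTerm (P.combine h P') = glueTerm P * glueTerm P' := by
  rw [← glueTerm_union, glueTerm_reorder (juxtBig h d) (P.union P')]
  · have h1 : invNum (juxtBig h d).onL (fun x y => {x, y} ∈ (P.union P').pairs) = 0 := by
      rw [invNum_eq_zero_iff]
      intro x y hxy hyx
      obtain ⟨j, l, k, m, rfl, rfl, _⟩ := juxtBig_inversion h hf hg hxy hyx
      exact Pairing.inl_inr_notMem_union
    rw [h1, add_zero, (even_invNum_juxtBig h hf hg hd).neg_one_pow, one_smul]
    rfl
  · rintro x y hxy hyx ⟨h1, _⟩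
    obtain ⟨j, l, k, m, rfl, rfl, _⟩ := juxtBig_inversion h hf hg hxy hyx
    exact (hd (f j)).1 l h1

/-! ### Connected components -/

namespace Diagram

/-- Being connected does not depend on the order of the legs. -/
lemma Connected.of_weakIso {D D' : Diagram} (f : WeakIso D D') (h : D.Connected) :
    D'.Connected := by
  obtain ⟨⟨e⟩, h⟩ := h
  refine ⟨⟨f.onE e⟩, f.onE.forall_congr_right.1 fun x => f.onE.forall_congr_right.1 fun y => ?_⟩
  induction h x y with
  | rel x y h =>
    obtain ⟨v, k, k', rfl, rfl⟩ := h
    exact EqvGen.rel _ _ ⟨f.onV v, k + f.rot v, k' + f.rot v, f.att_vertex v k, f.att_vertex v k'⟩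
  | refl x => exact EqvGen.refl _
  | symm _ _ _ ih => exact ih.symm
  | trans _ _ _ _ _ ih ih' => exact ih.trans _ _ _ ih'

section

variable {I J K : Type} [Finite I] [LinearOrder I] [Finite J] [LinearOrder J] [Finite K]
  [LinearOrder K]

/-- Two blocks are linked by a pairing if one of the pairs consists of a leg of the first and a leg
of the second block. -/
def Pairing.Link {d : I → Diagram} (P : (big d).Pairing) (i j : I) : Prop :=
  ∃ x y, {blockL d i x, blockL d j y} ∈ P.pairs

/-- Connected blocks that are glued along a pairing form a connected diagram if and only if the
links of the pairing connect the blocks. -/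
lemma connected_glue_big {d : I → Diagram} (hd : ∀ i, (d i).Connected) (P : (big d).Pairing) :
    ((big d).glue P).Connected ↔ Nonempty I ∧ ∀ i j, EqvGen P.Link i j := by
  constructor
  · rintro ⟨⟨e⟩, h⟩
    refine ⟨Quot.recOn e (fun e => ⟨e.1⟩) (fun _ _ _ => rfl), fun i j => ?_⟩
    -- The block of an edge is well defined up to links.
    let φ : Quot ((big d).Meet P.pairs) → Quot P.Link :=
      Quot.lift (fun e => Quot.mk _ e.1) (by
        rintro _ _ ⟨p, hp, l, hl, m, hm, rfl, rfl⟩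
        obtain ⟨i, x, rfl⟩ := big_cases l
        obtain ⟨j, y, rfl⟩ := big_cases m
        by_cases hlm : blockL d i x = blockL d j y
        · rw [hlm]
        · exact Quot.sound ⟨x, y, Pairing.eq_pair hp hl hm hlm ▸ hp⟩)
    have hφ : ∀ a b, EqvGen (fun x y => ∃ v k k', ((big d).glue P).att (Sum.inl (v, k)) = x ∧
        ((big d).glue P).att (Sum.inl (v, k')) = y) a b → φ a = φ b := by
      intro a b hab
      induction hab with
      | rel _ _ h =>
        obtain ⟨v, k, k', rfl, rfl⟩ := h
        rfl
      | refl => rfl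
      | symm _ _ _ ih => exact ih.symm
      | trans _ _ _ _ _ ih ih' => exact ih.trans ih'
    obtain ⟨a⟩ := (hd i).1
    obtain ⟨b⟩ := (hd j).1
    exact Quot.eqvGen_exact (hφ _ _ (h (Quot.mk _ ⟨i, a⟩) (Quot.mk _ ⟨j, b⟩)))
  · rintro ⟨⟨i⟩, h⟩
    obtain ⟨a⟩ := (hd i).1
    have h1 : ∀ i (a b : (d i).E), EqvGen (fun x y => ∃ v k k',
        ((big d).glue P).att (Sum.inl (v, k)) = x ∧ ((big d).glue P).att (Sum.inl (v, k')) = y)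
        (Quot.mk _ ⟨i, a⟩) (Quot.mk _ ⟨i, b⟩) := by
      intro i a b
      induction (hd i).2 a b with
      | rel _ _ h =>
        obtain ⟨v, k, k', rfl, rfl⟩ := h
        exact EqvGen.rel _ _ ⟨⟨i, v⟩, k, k', rfl, rfl⟩
      | refl => exact EqvGen.refl _
      | symm _ _ _ ih => exact ih.symm
      | trans _ _ _ _ _ ih ih' => exact ih.trans _ _ _ ih'
    have h2 : ∀ i j, EqvGen P.Link i j → ∀ (a : (d i).E) (b : (d j).E), EqvGen (fun x y =>
        ∃ v k k', ((big d).glue P).att (Sum.inl (v, k)) = x ∧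
          ((big d).glue P).att (Sum.inl (v, k')) = y)
        (Quot.mk _ ⟨i, a⟩) (Quot.mk _ ⟨j, b⟩) := by
      intro i j hij
      induction hij with
      | rel i j h =>
        obtain ⟨x, y, hp⟩ := h
        intro a b
        have hq : (Quot.mk _ ⟨i, (d i).att (Sum.inr x)⟩ : Quot ((big d).Meet P.pairs)) =
            Quot.mk _ ⟨j, (d j).att (Sum.inr y)⟩ :=
          Quot.sound ⟨_, hp, blockL d i x, by simp, blockL d j y, by simp, rfl, rfl⟩
        exact (h1 i a ((d i).att (Sum.inr x))).trans _ _ _ (hq ▸ h1 j ((d j).att (Sum.inr y)) b)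
      | refl => exact h1 _
      | symm _ _ _ ih => exact fun a b => (ih b a).symm
      | trans _ j _ _ _ ih ih' =>
        obtain ⟨c⟩ := (hd j).1
        exact fun a b => (ih a c).trans _ _ _ (ih' c b)
    refine ⟨⟨Quot.mk _ ⟨i, a⟩⟩, fun x y => ?_⟩
    induction x using Quot.ind with | mk x => ?_
    induction y using Quot.ind with | mk y => ?_
    exact h2 x.1 y.1 (h _ _) x.2 y.2

variable {f : J → I} {g : K → I} (h : Function.Bijective (Sum.elim f g)) {d : I → Diagram}

lemma Pairing.combine_injective {P Q : (big fun j => d (f j)).Pairing}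
    {P' Q' : (big fun k => d (g k)).Pairing} (e : P.combine h P' = Q.combine h Q') :
    P = Q ∧ P' = Q' := by
  constructor
  · apply Pairing.ext_mem
    intro x y
    obtain ⟨i, x, rfl⟩ := big_cases x
    obtain ⟨j, y, rfl⟩ := big_cases y
    rw [← Pairing.pair_inl_mem_combine h (P' := P'), ← Pairing.pair_inl_mem_combine h (P' := Q'), e]
  · apply Pairing.ext_mem
    intro x y
    obtain ⟨i, x, rfl⟩ := big_cases x
    obtain ⟨j, y, rfl⟩ := big_cases y
    rw [← Pairing.pair_inr_mem_combine h (P := P), ← Pairing.pair_inr_mem_combine h (P := Q), e]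

lemma subL_label (hf : Function.Injective f) (x : (big fun j => d (f j)).L) :
    (big d).label (subL hf d x) = (big fun j => d (f j)).label x := rfl

lemma Pairing.exists_combine (hf : Function.Injective f) (hg : Function.Injective g)
    (P : (big d).Pairing) (hP : ∀ j k, ¬ P.Link (f j) (g k)) :
    ∃ P₁ P₂, Pairing.combine h P₁ P₂ = P := by
  refine ⟨P.comap (subL hf d) (subL_label hf), P.comap (subL hg d) (subL_label hg), ?_⟩
  apply Pairing.ext_mem
  intro x y
  obtain ⟨i, x, rfl⟩ := big_cases x
  obtain ⟨i', y, rfl⟩ := big_cases y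
  obtain ⟨j | k, rfl⟩ := h.2 i <;> obtain ⟨j' | k', rfl⟩ := h.2 i'
  · refine (Pairing.pair_inl_mem_combine h).trans ?_
    refine Pairing.mem_comap.trans ?_
    rw [Finset.map_insert, Finset.map_singleton]
    rfl
  · exact iff_of_false (Pairing.pair_notMem_combine h) fun e => hP j k' ⟨x, y, e⟩
  · rw [Finset.pair_comm]
    exact iff_of_false (Pairing.pair_notMem_combine h) fun e => hP j' k ⟨y, x, e⟩
  · refine (Pairing.pair_inr_mem_combine h).trans ?_
    refine Pairing.mem_comap.trans ?_
    rw [Finset.map_insert, Finset.map_singleton]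
    rfl

/-- The blocks that are connected to a block of the first subfamily. -/
lemma Pairing.eqvGen_link_combine (hf : Function.Injective f)
    {P : (big fun j => d (f j)).Pairing} {P' : (big fun k => d (g k)).Pairing} (j : J) (i : I) :
    EqvGen (P.combine h P').Link (f j) i ↔ ∃ j', f j' = i ∧ EqvGen P.Link j j' := by
  constructor
  · have key : ∀ x y, EqvGen (P.combine h P').Link x y → ((∃ j, f j = x) ↔ ∃ j, f j = y) ∧
        ∀ j j', f j = x → f j' = y → EqvGen P.Link j j' := by
      intro x y hxy
      induction hxy with
      | rel x y hl =>
        obtain ⟨a, b, hab⟩ := hl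
        obtain ⟨j | k, rfl⟩ := h.2 x <;> obtain ⟨j' | k', rfl⟩ := h.2 y
        · refine ⟨iff_of_true ⟨j, rfl⟩ ⟨j', rfl⟩, fun m m' hm hm' => ?_⟩
          obtain rfl := hf hm
          obtain rfl := hf hm'
          exact EqvGen.rel _ _ ⟨a, b, (Pairing.pair_inl_mem_combine h).1 hab⟩
        · exact absurd hab (Pairing.pair_notMem_combine h)
        · rw [Finset.pair_comm] at hab
          exact absurd hab (Pairing.pair_notMem_combine h)
        · have hn : ∀ k, ¬ ∃ j, f j = g k := fun k ⟨j, e⟩ =>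
            absurd (h.1 (a₁ := Sum.inl j) (a₂ := Sum.inr k) e) (by simp)
          exact ⟨iff_of_false (hn k) (hn k'), fun m _ hm => absurd ⟨m, hm⟩ (hn k)⟩
      | refl x =>
        refine ⟨Iff.rfl, fun j j' hj hj' => ?_⟩
        obtain rfl := hf (hj.trans hj'.symm)
        exact EqvGen.refl _
      | symm _ _ _ ih => exact ⟨ih.1.symm, fun j j' hj hj' => (ih.2 j' j hj' hj).symm⟩
      | trans _ _ _ _ _ ih ih' =>
        refine ⟨ih.1.trans ih'.1, fun j j' hj hj' => ?_⟩
        obtain ⟨m, hm⟩ := ih.1.1 ⟨j, hj⟩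
        exact (ih.2 j m hj hm).trans _ _ _ (ih'.2 m j' hm hj')
    intro he
    obtain ⟨j', hj'⟩ := (key _ _ he).1.1 ⟨j, rfl⟩
    exact ⟨j', hj', (key _ _ he).2 j j' rfl hj'⟩
  · rintro ⟨j', rfl, he⟩
    induction he with
    | rel x y hl =>
      obtain ⟨a, b, hab⟩ := hl
      exact EqvGen.rel _ _ ⟨a, b, (Pairing.pair_inl_mem_combine h).2 hab⟩
    | refl => exact EqvGen.refl _
    | symm _ _ _ ih => exact ih.symm
    | trans _ _ _ _ _ ih ih' => exact ih.trans _ _ _ ih'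

end

end Diagram

open Classical in
/-- The sum over the pairings that glue a diagram to a connected one. -/
def connectedSum (D : Diagram) : Space 0 := ∑ P with (D.glue P).Connected, glueTerm P

lemma connectedSum_congr {D D' : Diagram} (f : Iso D D') : connectedSum D = connectedSum D' := by
  classical
  unfold connectedSum
  refine Finset.sum_equiv (Pairing.mapEquiv f.toWeakIso.onL f.toWeakIso.label_eq) (fun P => ?_)
    (fun P _ => (glueTerm_iso f P).symm)
  rw [Finset.mem_filter, Finset.mem_filter]
  refine and_congr (by simp) ⟨fun h => h.of_weakIso (f.toWeakIso.glue P), fun h => ?_⟩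
  have h' := h.of_weakIso (f.symm.toWeakIso.glue _)
  have e : (P.map f.toWeakIso.onL f.toWeakIso.label_eq).map f.symm.toWeakIso.onL
    f.symm.toWeakIso.label_eq = P :=
    (Pairing.mapEquiv f.toWeakIso.onL f.toWeakIso.label_eq).left_inv P
  exact e ▸ h'

lemma bijective_sumElim_val {I : Type} (p : I → Prop) : Function.Bijective
    (Sum.elim (Subtype.val : {i // p i} → I) (Subtype.val : {i // ¬ p i} → I)) := by
  classical
  exact (Equiv.sumCompl p).bijective

open Classical in
/-- In the sum over all pairings, the component of a given block is split off. -/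
lemma glueSum_big {I : Type} [Fintype I] [LinearOrder I] {d : I → Diagram}
    (hb : ∀ i, (d i).Balanced) (hc : ∀ i, (d i).Connected) (i₀ : I) :
    glueSum (big d) = ∑ S : Finset I with i₀ ∈ S,
      connectedSum (big fun j : {i // i ∈ S} => d j) *
        glueSum (big fun k : {i // i ∉ S} => d k) := by
  -- The pairings are sorted by the set `S` of the blocks that are linked to `i₀`.
  rw [glueSum, ← Finset.sum_fiberwise_of_maps_to
    (g := fun P : (big d).Pairing => Finset.univ.filter fun i => EqvGen P.Link i₀ i)
    (t := Finset.univ.filter fun S => i₀ ∈ S)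
    (fun P _ => by simpa using EqvGen.refl i₀)]
  refine Finset.sum_congr rfl fun S hS => ?_
  replace hS : i₀ ∈ S := by simpa using hS
  have h := bijective_sumElim_val (fun i => i ∈ S)
  rw [connectedSum, glueSum, Finset.sum_mul_sum, ← Finset.sum_product']
  symm
  refine Finset.sum_bij (fun x _ => Pairing.combine h x.1 x.2) ?_ ?_ ?_ ?_
  · rintro ⟨P, P'⟩ hP
    simp only [Finset.mem_product, Finset.mem_filter, Finset.mem_univ, true_and, and_true,
      connected_glue_big (fun i : {i // i ∈ S} => hc i)] at hP ⊢
    ext i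
    simp only [Finset.mem_filter, Finset.mem_univ, true_and]
    rw [Pairing.eqvGen_link_combine h Subtype.val_injective ⟨i₀, hS⟩ i]
    constructor
    · rintro ⟨j, rfl, _⟩
      exact j.2
    · exact fun hi => ⟨⟨i, hi⟩, rfl, hP.2 _ _⟩
  · rintro ⟨P, P'⟩ _ ⟨Q, Q'⟩ _ e
    obtain ⟨rfl, rfl⟩ := Pairing.combine_injective h e
    rfl
  · intro P hP
    replace hP : ∀ i, EqvGen P.Link i₀ i ↔ i ∈ S := by
      have := (Finset.mem_filter.1 hP).2
      intro i
      rw [← this]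
      simp
    obtain ⟨P₁, P₂, rfl⟩ := Pairing.exists_combine h Subtype.val_injective Subtype.val_injective P
      (fun j k hl => k.2 ((hP _).1 (((hP _).2 j.2).trans _ _ _ (EqvGen.rel _ _ hl))))
    refine ⟨(P₁, P₂), ?_, rfl⟩
    simp only [Finset.mem_product, Finset.mem_filter, Finset.mem_univ, true_and, and_true,
      connected_glue_big (fun i : {i // i ∈ S} => hc i)]
    have hj : ∀ j, EqvGen P₁.Link ⟨i₀, hS⟩ j := by
      intro j
      obtain ⟨j', hj', he⟩ := (Pairing.eqvGen_link_combine h Subtype.val_injective ⟨i₀, hS⟩ j).1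
        ((hP j).2 j.2)
      exact Subtype.ext hj' ▸ he
    exact ⟨⟨⟨i₀, hS⟩⟩, fun i j => (hj i).symm.trans _ _ _ (hj j)⟩
  · rintro ⟨P, P'⟩ _
    exact (glueTerm_combine h (Subtype.strictMono_coe _) (Subtype.strictMono_coe _) hb P P').symm

namespace Diagram

/-! ### Diagrams of words -/

/-- A reindexing of the family that preserves the order. -/
def bigReindex {I J : Type} [Finite I] [LinearOrder I] [Finite J] [LinearOrder J] (e : I ≃o J)
    (d : J → Diagram) : Iso (big fun i => d (e i)) (big d) :=
  WeakIso.toIso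
  { onV := e.toEquiv.sigmaCongrLeft (β := fun j => (d j).V)
    rot := fun _ => 0
    onL := e.toEquiv.sigmaCongrLeft (β := fun j => (d j).L)
    onE := e.toEquiv.sigmaCongrLeft (β := fun j => (d j).E)
    label_eq := fun _ => rfl
    att_vertex := fun v k => by rw [add_zero]; rfl
    att_leg := fun _ => rfl }
  (by
    intro x y hxy
    obtain ⟨i, x, rfl⟩ := big_cases x
    obtain ⟨j, y, rfl⟩ := big_cases y
    exact big_lt_of_strictMono e.strictMono hxy)

/-- The first element of a family is split off. -/
def sumSigmaFin {n : ℕ} (X : Fin (n + 1) → Type) :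
    X 0 ⊕ (Σ i : Fin n, X i.succ) ≃ Σ i, X i :=
  Equiv.ofBijective (Sum.elim (fun x => ⟨0, x⟩) (fun x => ⟨x.1.succ, x.2⟩)) (by
    constructor
    · rintro (x | ⟨j, x⟩) (y | ⟨k, y⟩) e
      · exact congrArg Sum.inl (eq_of_heq (Sigma.mk.inj e).2)
      · exact absurd (congrArg Sigma.fst e) (Fin.succ_ne_zero k).symm
      · exact absurd (congrArg Sigma.fst e) (Fin.succ_ne_zero j)
      · obtain rfl := Fin.succ_injective _ (congrArg Sigma.fst e)
        obtain rfl : x = y := eq_of_heq (Sigma.mk.inj e).2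
        rfl
    · rintro ⟨i, x⟩
      induction i using Fin.cases with
      | zero => exact ⟨Sum.inl x, rfl⟩
      | succ i => exact ⟨Sum.inr ⟨i, x⟩, rfl⟩)

/-- The first diagram of a family is split off. -/
def juxtBigSucc {n : ℕ} (d : Fin (n + 1) → Diagram) :
    Iso (juxt (d 0) (big fun i : Fin n => d i.succ)) (big d) :=
  WeakIso.toIso
  { onV := sumSigmaFin fun i => (d i).V
    rot := fun _ => 0
    onL := sumSigmaFin fun i => (d i).L
    onE := sumSigmaFin fun i => (d i).E
    label_eq := by
      intro (l : (d 0).L ⊕ (Σ i : Fin n, (d i.succ).L))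
      rcases l with l | l <;> rfl
    att_vertex := by
      rintro (v | v) k <;> rw [add_zero] <;> rfl
    att_leg := by
      intro (l : (d 0).L ⊕ (Σ i : Fin n, (d i.succ).L))
      rcases l with l | l <;> rfl }
  (by
    intro x y hxy
    rcases juxt_cases x with ⟨x, rfl⟩ | ⟨x, rfl⟩ <;> rcases juxt_cases y with ⟨y, rfl⟩ | ⟨y, rfl⟩
    · exact (blockL_lt_blockL (d := d)).2 (inlL_lt_inlL.1 hxy)
    · obtain ⟨j, y, rfl⟩ := big_cases y
      exact blockL_lt_of_lt (d := d) (Fin.succ_pos j) _ _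
    · exact absurd hxy (lt_asymm (inlL_lt_inrL _ _))
    · obtain ⟨i, x, rfl⟩ := big_cases x
      obtain ⟨j, y, rfl⟩ := big_cases y
      exact big_lt_of_strictMono (Fin.strictMono_succ) (inrL_lt_inrL.1 hxy))

/-- Diagrams without half-edges and edges are isomorphic. -/
def isoOfIsEmpty (D D' : Diagram) [IsEmpty D.V] [IsEmpty D.L] [IsEmpty D.E] [IsEmpty D'.V]
    [IsEmpty D'.L] [IsEmpty D'.E] : Iso D D' where
  onV := Equiv.equivOfIsEmpty _ _
  rot := fun _ => 0
  onL := ⟨Equiv.equivOfIsEmpty _ _, fun {a} => isEmptyElim a⟩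
  onE := Equiv.equivOfIsEmpty _ _
  label_eq := fun l => isEmptyElim l
  att_vertex := fun v => isEmptyElim v
  att_leg := fun l => isEmptyElim l

/-- The diagram of a word, as the diagram of the family of its letters. -/
def wordIso : ∀ {n : ℕ} (w : Fin n → Letter),
    Iso (wordDiagram (List.ofFn w)) (big fun i => (w i).diagram)
  | 0, w =>
    have : IsEmpty (big fun i => (w i).diagram).V :=
      inferInstanceAs (IsEmpty (Σ i : Fin 0, (w i).diagram.V))
    have : IsEmpty (big fun i => (w i).diagram).L :=
      inferInstanceAs (IsEmpty (Σ i : Fin 0, (w i).diagram.L))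
    have : IsEmpty (big fun i => (w i).diagram).E :=
      inferInstanceAs (IsEmpty (Σ i : Fin 0, (w i).diagram.E))
    isoOfIsEmpty empty _
  | n + 1, w =>
    have e : wordDiagram (List.ofFn w) =
        juxt (w 0).diagram (wordDiagram (List.ofFn fun i : Fin n => w i.succ)) := by
      rw [List.ofFn_succ]; rfl
    e ▸ (juxtCongr (Iso.refl (w 0).diagram) (wordIso fun i => w i.succ)).trans
      (juxtBigSucc fun i => (w i).diagram)

end Diagram

namespace Letter

instance : Fintype Letter := ⟨⟨[A, B], by simp⟩, by rintro (_ | _) <;> simp⟩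

lemma sum_univ {M : Type*} [AddCommMonoid M] (f : Letter → M) : ∑ x, f x = f A + f B := by
  change (Multiset.map f (A ::ₘ B ::ₘ 0)).sum = _
  simp

/-- The parameter-grade of the diagram of a symbol. -/
def weight : Letter → ℕ
  | A => 2
  | B => 1

lemma one_le_weight (x : Letter) : 1 ≤ x.weight := by
  rcases x with _ | _ <;> decide

lemma bidegree_diagram (x : Letter) : x.diagram.bidegree = (x.weight, 0) := by
  rcases x with _ | _
  · refine Prod.ext ?_ ?_
    · change ∑ᶠ l : Fin 3, Leg.paramGrade ((![Leg.a, Leg.bot, Leg.bot] : Fin 3 → Leg) l) = 2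
      rw [finsum_eq_sum_of_fintype, Fin.sum_univ_three]
      rfl
    · change ∑ᶠ l : Fin 3, Leg.opGrade ((![Leg.a, Leg.bot, Leg.bot] : Fin 3 → Leg) l) = 0
      rw [finsum_eq_sum_of_fintype, Fin.sum_univ_three]
      rfl
  · refine Prod.ext ?_ ?_
    · change ∑ᶠ l : Fin 2, Leg.paramGrade ((![Leg.b, Leg.bot] : Fin 2 → Leg) l) = 1
      rw [finsum_eq_sum_of_fintype, Fin.sum_univ_two]
      rfl
    · change ∑ᶠ l : Fin 2, Leg.opGrade ((![Leg.b, Leg.bot] : Fin 2 → Leg) l) = 0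
      rw [finsum_eq_sum_of_fintype, Fin.sum_univ_two]
      rfl

lemma balanced_diagram (x : Letter) : x.diagram.Balanced := by
  rcases x with _ | _
  · refine ⟨?_, (Equiv.swap 1 2 : Equiv.Perm (Fin 3)), ?_⟩
    · change ∀ l : Fin 3, (![Leg.a, Leg.bot, Leg.bot] : Fin 3 → Leg) l ≠ Leg.curv
      decide
    · change ∀ l : Fin 3, Leg.grade ((![Leg.a, Leg.bot, Leg.bot] : Fin 3 → Leg) l) = 1 →
        Leg.grade ((![Leg.a, Leg.bot, Leg.bot] : Fin 3 → Leg) (Equiv.swap 1 2 l)) = 1 ∧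
          Equiv.swap 1 2 (Equiv.swap 1 2 l) = l ∧ Equiv.swap 1 2 l ≠ l
      decide
  · refine ⟨?_, (Equiv.swap 0 1 : Equiv.Perm (Fin 2)), ?_⟩
    · change ∀ l : Fin 2, (![Leg.b, Leg.bot] : Fin 2 → Leg) l ≠ Leg.curv
      decide
    · change ∀ l : Fin 2, Leg.grade ((![Leg.b, Leg.bot] : Fin 2 → Leg) l) = 1 →
        Leg.grade ((![Leg.b, Leg.bot] : Fin 2 → Leg) (Equiv.swap 0 1 l)) = 1 ∧
          Equiv.swap 0 1 (Equiv.swap 0 1 l) = l ∧ Equiv.swap 0 1 l ≠ l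
      decide

lemma connected_diagram (x : Letter) : x.diagram.Connected := by
  rcases x with _ | _
  · exact ⟨⟨(0 : Fin 3)⟩, fun e e' => EqvGen.rel _ _ ⟨(), e, e', rfl, rfl⟩⟩
  · exact ⟨⟨()⟩, fun e e' => EqvGen.refl _⟩

end Letter

lemma bidegree_wordDiagram (w : List Letter) :
    (wordDiagram w).bidegree = ((w.map Letter.weight).sum, 0) := by
  induction w with
  | nil =>
    refine Prod.ext ?_ ?_
    · change ∑ᶠ l : Empty, _ = _
      rw [finsum_of_isEmpty]; rfl
    · change ∑ᶠ l : Empty, _ = _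
      rw [finsum_of_isEmpty]
  | cons x w ih =>
    rw [wordDiagram, bidegree_juxt, ih, Letter.bidegree_diagram, List.map_cons, List.sum_cons]
    rfl

/-! ### The exponential of a power series with commuting coefficients -/

section

open PowerSeries

variable {R : Type*} [Ring R]

/-- The operator that multiplies the coefficient of degree `i` by `i`. -/
def degreeOp : R⟦X⟧ →+ R⟦X⟧ where
  toFun f := PowerSeries.mk fun i => i • coeff i f
  map_zero' := by ext; simp
  map_add' f g := by ext; simp

lemma coeff_degreeOp (i : ℕ) (f : R⟦X⟧) : coeff i (degreeOp f) = i • coeff i f :=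
  coeff_mk i fun i => i • coeff i f

lemma degreeOp_monomial (i : ℕ) (a : R) : degreeOp (monomial i a) = monomial i (i • a) := by
  ext j
  rw [coeff_degreeOp, coeff_monomial, coeff_monomial]
  split_ifs with h
  · rw [h]
  · exact smul_zero _

lemma degreeOp_mul (f g : R⟦X⟧) : degreeOp (f * g) = degreeOp f * g + f * degreeOp g := by
  ext i
  rw [map_add, coeff_degreeOp, coeff_mul, coeff_mul, coeff_mul, Finset.smul_sum,
    ← Finset.sum_add_distrib]
  refine Finset.sum_congr rfl fun x hx => ?_
  rw [coeff_degreeOp, coeff_degreeOp, ← Finset.HasAntidiagonal.mem_antidiagonal.1 hx, add_smul, smul_mul_assoc,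
    mul_smul_comm]

lemma commute_degreeOp {f : R⟦X⟧} (hf : ∀ p q, Commute (coeff p f) (coeff q f)) :
    Commute f (degreeOp f) := by
  ext i
  rw [coeff_mul, coeff_mul, ← Finset.Nat.sum_antidiagonal_swap]
  refine Finset.sum_congr rfl fun x _ => ?_
  rw [Prod.fst_swap, Prod.snd_swap, coeff_degreeOp, mul_smul_comm, smul_mul_assoc,
    (hf _ _).eq]

lemma degreeOp_pow_succ {f : R⟦X⟧} (hf : ∀ p q, Commute (coeff p f) (coeff q f)) (k : ℕ) :
    degreeOp (f ^ (k + 1)) = (k + 1) • (degreeOp f * f ^ k) := by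
  induction k with
  | zero => simp
  | succ k ih =>
    rw [pow_succ, degreeOp_mul, ih, smul_mul_assoc, mul_assoc, ← pow_succ,
      ((commute_degreeOp hf).pow_left (k + 1)).eq, succ_nsmul _ (k + 1)]

lemma coeff_pow_eq_zero {f : R⟦X⟧} (hf : coeff 0 f = 0) {i k : ℕ} (h : i < k) :
    coeff i (f ^ k) = 0 := by
  induction k generalizing i with
  | zero => omega
  | succ k ih =>
    rw [pow_succ, coeff_mul]
    refine Finset.sum_eq_zero fun x hx => ?_
    have hx := Finset.HasAntidiagonal.mem_antidiagonal.1 hx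
    by_cases h0 : x.2 = 0
    · rw [h0, hf, mul_zero]
    · rw [ih (by omega), zero_mul]

variable [Algebra ℚ R]

/-- The coefficients of the exponential of a power series satisfy the recurrence that expresses
that its logarithmic derivative is the derivative of the series. -/
lemma exp_recurrence {f : R⟦X⟧} (hf : ∀ p q, Commute (coeff p f) (coeff q f))
    (h0 : coeff 0 f = 0) (i : ℕ) :
    i • ∑ k ∈ Finset.range (i + 1), ((k.factorial : ℚ)⁻¹ • coeff i (f ^ k)) =
      ∑ x ∈ Finset.HasAntidiagonal.antidiagonal i, (x.1 • coeff x.1 f) *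
        ∑ k ∈ Finset.range (x.2 + 1), ((k.factorial : ℚ)⁻¹ • coeff x.2 (f ^ k)) := by
  have h1 : ∀ k, i • ((((k + 1).factorial : ℕ) : ℚ)⁻¹ • coeff i (f ^ (k + 1))) =
      ∑ x ∈ Finset.HasAntidiagonal.antidiagonal i, (x.1 • coeff x.1 f) *
        ((k.factorial : ℚ)⁻¹ • coeff x.2 (f ^ k)) := by
    intro k
    rw [smul_comm, ← coeff_degreeOp, degreeOp_pow_succ hf, map_nsmul, coeff_mul,
      ← Nat.cast_smul_eq_nsmul ℚ, smul_smul, Finset.smul_sum]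
    refine Finset.sum_congr rfl fun x _ => ?_
    rw [coeff_degreeOp, mul_smul_comm]
    congr 1
    rw [Nat.factorial_succ]
    push_cast
    field_simp
  rw [Finset.sum_range_succ', smul_add, Finset.smul_sum, Finset.sum_congr rfl fun k _ => h1 k,
    Finset.sum_comm]
  have h2 : i • ((((0 : ℕ).factorial : ℕ) : ℚ)⁻¹ • coeff i (f ^ 0)) = 0 := by
    rw [pow_zero, coeff_one]
    split_ifs with h
    · rw [h, zero_smul]
    · rw [smul_zero, smul_zero]
  rw [h2, add_zero]
  refine Finset.sum_congr rfl fun x hx => ?_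
  rw [Finset.mul_sum]
  have hx := Finset.HasAntidiagonal.mem_antidiagonal.1 hx
  by_cases hx0 : x.1 = 0
  · rw [hx0, h0, smul_zero]
    simp
  · refine (Finset.sum_subset (Finset.range_mono (by omega)) fun k _ hk => ?_).symm
    rw [coeff_pow_eq_zero h0 (by simpa using hk), smul_zero, mul_zero]

/-- The recurrence determines the exponential. -/
lemma eq_exp_of_recurrence {f : R⟦X⟧} (hf : ∀ p q, Commute (coeff p f) (coeff q f))
    (h0 : coeff 0 f = 0) {z : ℕ → R} (hz0 : z 0 = 1)
    (hz : ∀ i, i • z i = ∑ x ∈ Finset.HasAntidiagonal.antidiagonal i, (x.1 • coeff x.1 f) * z x.2) (i : ℕ) :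
    z i = ∑ k ∈ Finset.range (i + 1), ((k.factorial : ℚ)⁻¹ • coeff i (f ^ k)) := by
  induction i using Nat.strong_induction_on with
  | _ i ih =>
    by_cases hi : i = 0
    · subst hi
      simp [hz0]
    · have h : i • z i = i • ∑ k ∈ Finset.range (i + 1),
          ((k.factorial : ℚ)⁻¹ • coeff i (f ^ k)) := by
        rw [hz, exp_recurrence hf h0]
        refine Finset.sum_congr rfl fun x hx => ?_
        have hx := Finset.HasAntidiagonal.mem_antidiagonal.1 hx
        by_cases hx0 : x.1 = 0
        · rw [hx0, zero_smul, zero_mul, zero_mul]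
        · rw [ih x.2 (by omega)]
      rw [← Nat.cast_smul_eq_nsmul ℚ, ← Nat.cast_smul_eq_nsmul ℚ] at h
      have hi' : (i : ℚ) ≠ 0 := by exact_mod_cast hi
      have := congrArg ((i : ℚ)⁻¹ • ·) h
      simpa only [smul_smul, inv_mul_cancel₀ hi', one_smul] using this

/-- A double sum over the sizes is regrouped according to the total size. -/
lemma sum_range_antidiagonal {M : Type*} [AddCommMonoid M] {F : ℕ → ℕ → M} {p q : ℕ}
    (h1 : ∀ m r, p < m → F m r = 0) (h2 : ∀ m r, q < r → F m r = 0) :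
    ∑ n ∈ Finset.range (p + q + 1), ∑ y ∈ Finset.HasAntidiagonal.antidiagonal n, F y.1 y.2 =
      ∑ m ∈ Finset.range (p + 1), ∑ r ∈ Finset.range (q + 1), F m r := by
  rw [← Finset.sum_product', ← Finset.sum_fiberwise_of_maps_to
    (s := Finset.range (p + 1) ×ˢ Finset.range (q + 1)) (g := fun y => y.1 + y.2)
    (t := Finset.range (p + q + 1)) (fun y hy => by
      simp only [Finset.mem_product, Finset.mem_range] at hy ⊢
      omega)]
  refine Finset.sum_congr rfl fun n _ => (Finset.sum_subset ?_ ?_).symm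
  · intro y hy
    exact Finset.HasAntidiagonal.mem_antidiagonal.2 (Finset.mem_filter.1 hy).2
  · intro y hy hy'
    simp only [Finset.mem_filter, Finset.mem_product, Finset.mem_range, not_and,
      Finset.HasAntidiagonal.mem_antidiagonal] at hy hy'
    by_cases hp : p < y.1
    · exact h1 _ _ hp
    · by_cases hq : q < y.2
      · exact h2 _ _ hq
      · exact absurd hy (hy' ⟨by omega, by omega⟩)

/-- The exponential formula: if `z n` is obtained from the `c m` by splitting off one component,
the total sum of the `z n` is the exponential of the total sum of the `c m`. -/
lemma exp_of_degreeOp_eq {c z : ℕ → R⟦X⟧} (hc : ∀ m p, p < m → coeff p (c m) = 0)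
    (hz : ∀ m p, p < m → coeff p (z m) = 0) (hc0 : c 0 = 0) (hz0 : z 0 = 1)
    (hcomm : ∀ m n p q, Commute (coeff p (c m)) (coeff q (c n)))
    (h : ∀ n, degreeOp (z n) = ∑ y ∈ Finset.HasAntidiagonal.antidiagonal n, degreeOp (c y.1) * z y.2) (i : ℕ) :
    ∑ n ∈ Finset.range (i + 1), coeff i (z n) =
      ∑ k ∈ Finset.range (i + 1), ((k.factorial : ℚ)⁻¹ • coeff i
        ((PowerSeries.mk fun j => ∑ m ∈ Finset.range (j + 1), coeff j (c m)) ^ k)) := by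
  refine eq_exp_of_recurrence (z := fun i => ∑ n ∈ Finset.range (i + 1), coeff i (z n))
    (fun p q => ?_) ?_ ?_ (fun i => ?_) i
  · rw [coeff_mk, coeff_mk]
    exact Commute.sum_left _ _ _ fun m _ => Commute.sum_right _ _ _ fun n _ => hcomm _ _ _ _
  · simp [hc0]
  · simp [hz0]
  · calc i • ∑ n ∈ Finset.range (i + 1), coeff i (z n) =
        ∑ n ∈ Finset.range (i + 1), ∑ y ∈ Finset.HasAntidiagonal.antidiagonal n,
          ∑ x ∈ Finset.HasAntidiagonal.antidiagonal i, (x.1 • coeff x.1 (c y.1)) * coeff x.2 (z y.2) := by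
          rw [Finset.smul_sum]
          refine Finset.sum_congr rfl fun n _ => ?_
          rw [← coeff_degreeOp, h, map_sum]
          refine Finset.sum_congr rfl fun y _ => ?_
          rw [coeff_mul]
          exact Finset.sum_congr rfl fun x _ => by rw [coeff_degreeOp]
      _ = ∑ x ∈ Finset.HasAntidiagonal.antidiagonal i, ∑ n ∈ Finset.range (i + 1),
          ∑ y ∈ Finset.HasAntidiagonal.antidiagonal n, (x.1 • coeff x.1 (c y.1)) * coeff x.2 (z y.2) := by
          rw [Finset.sum_comm]
          exact Finset.sum_congr rfl fun n _ => Finset.sum_comm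
      _ = _ := by
          refine Finset.sum_congr rfl fun x hx => ?_
          rw [coeff_mk, Finset.smul_sum, Finset.sum_mul_sum, ← Finset.HasAntidiagonal.mem_antidiagonal.1 hx]
          refine sum_range_antidiagonal
            (F := fun m r => (x.1 • coeff x.1 (c m)) * coeff x.2 (z r)) (fun m r hm => ?_)
            (fun m r hr => ?_)
          · rw [hc _ _ hm, smul_zero, zero_mul]
          · rw [hz _ _ hr, mul_zero]

end

/-! ### The generating series of the words -/

section

open PowerSeries

/-- Terms of families of balanced diagrams commute: both products are the term of the combined
pairing of the family that is indexed by the ordered sum. -/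
lemma glueTerm_commute {J K : Type} [Finite J] [LinearOrder J] [Finite K] [LinearOrder K]
    {d₁ : J → Diagram} {d₂ : K → Diagram} (h₁ : ∀ j, (d₁ j).Balanced)
    (h₂ : ∀ k, (d₂ k).Balanced) (P : (big d₁).Pairing) (P' : (big d₂).Pairing) :
    Commute (glueTerm P) (glueTerm P') := by
  have : Finite (J ⊕ₗ K) := inferInstanceAs (Finite (J ⊕ K))
  let d : J ⊕ₗ K → Diagram := fun x => Sum.elim d₁ d₂ (ofLex x)
  let f : J → J ⊕ₗ K := fun j => toLex (Sum.inl j)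
  let g : K → J ⊕ₗ K := fun k => toLex (Sum.inr k)
  have hf : StrictMono f := fun _ _ h => Sum.Lex.inl_lt_inl_iff.2 h
  have hg : StrictMono g := fun _ _ h => Sum.Lex.inr_lt_inr_iff.2 h
  have hfg : Function.Bijective (Sum.elim f g) := by
    constructor
    · rintro (x | x) (y | y) e
      · exact congrArg Sum.inl (hf.injective e)
      · exact absurd (toLex.injective e) (by simp)
      · exact absurd (toLex.injective e) (by simp)
      · exact congrArg Sum.inr (hg.injective e)
    · intro x
      rcases x with x | x
      · exact ⟨Sum.inl x, rfl⟩
      · exact ⟨Sum.inr x, rfl⟩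
  have hgf : Function.Bijective (Sum.elim g f) := by
    have : Sum.elim g f = Sum.elim f g ∘ Equiv.sumComm K J := by
      ext x; rcases x with x | x <;> rfl
    rw [this]
    exact hfg.comp (Equiv.sumComm K J).bijective
  have hd : ∀ x, (d x).Balanced := by
    intro x
    rcases x with x | x
    · exact h₁ x
    · exact h₂ x
  have e : Pairing.combine (d := d) hfg P P' = Pairing.combine (d := d) hgf P' P := by
    apply Pairing.ext_pairs
    ext p
    exact (Pairing.mem_combine (d := d) hfg hf.injective hg.injective).trans
      (or_comm.trans (Pairing.mem_combine (d := d) hgf hg.injective hf.injective).symm)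
  exact (glueTerm_combine hfg hf hg hd P P').symm.trans
    ((congrArg glueTerm e).trans (glueTerm_combine hgf hg hf hd P' P))

lemma connectedSum_commute {J K : Type} [Finite J] [LinearOrder J] [Finite K] [LinearOrder K]
    {d₁ : J → Diagram} {d₂ : K → Diagram} (h₁ : ∀ j, (d₁ j).Balanced)
    (h₂ : ∀ k, (d₂ k).Balanced) : Commute (connectedSum (big d₁)) (connectedSum (big d₂)) :=
  Commute.sum_left _ _ _ fun P _ => Commute.sum_right _ _ _ fun P' _ =>
    glueTerm_commute h₁ h₂ P P'

/-- The sum of the values of `F` on the diagrams of the words whose letters are indexed by `I`; the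
exponent of the variable is the parameter-grade. -/
def wordSeries (F : Diagram → Space 0) (I : Type) [Fintype I] [LinearOrder I] : (Space 0)⟦X⟧ :=
  ∑ w : I → Letter, monomial (∑ i, (w i).weight)
    ((∏ i, (w i).coeff) • F (big fun i => (w i).diagram))

/-- If `F` is invariant under isomorphisms, only the number of the letters matters. -/
lemma wordSeries_reindex {F : Diagram → Space 0} (hF : ∀ {D D' : Diagram}, Iso D D' → F D = F D')
    {I J : Type} [Fintype I] [LinearOrder I] [Fintype J] [LinearOrder J] (e : I ≃o J) :
    wordSeries F I = wordSeries F J := by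
  unfold wordSeries
  refine (Fintype.sum_equiv (e.toEquiv.arrowCongr (Equiv.refl Letter)).symm _ _ fun w => ?_).symm
  have h : ∀ i, (e.toEquiv.arrowCongr (Equiv.refl Letter)).symm w i = w (e i) := fun i => rfl
  have h1 : ∑ i, ((e.toEquiv.arrowCongr (Equiv.refl Letter)).symm w i).weight =
      ∑ j, (w j).weight := e.toEquiv.sum_comp fun j => (w j).weight
  have h2 : ∏ i, ((e.toEquiv.arrowCongr (Equiv.refl Letter)).symm w i).coeff =
      ∏ j, (w j).coeff := e.toEquiv.prod_comp fun j => (w j).coeff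
  have h3 := hF (bigReindex e fun j => (w j).diagram)
  rw [h1, h2, ← h3]
  rfl

lemma wordSeries_subtype {F : Diagram → Space 0} (hF : ∀ {D D' : Diagram}, Iso D D' → F D = F D')
    {n m : ℕ} (p : Fin n → Prop) [Fintype {i // p i}] (hm : Fintype.card {i // p i} = m) :
    wordSeries F {i // p i} = wordSeries F (Fin m) :=
  (wordSeries_reindex hF (Fintype.orderIsoFinOfCardEq _ hm)).symm

lemma coeff_wordSeries (F : Diagram → Space 0) (I : Type) [Fintype I] [LinearOrder I] (i : ℕ) :
    coeff i (wordSeries F I) = ∑ w : I → Letter, if ∑ i, (w i).weight = i then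
      (∏ i, (w i).coeff) • F (big fun i => (w i).diagram) else 0 := by
  rw [wordSeries, map_sum]
  refine Finset.sum_congr rfl fun w _ => ?_
  rw [coeff_monomial]
  simp only [eq_comm]

lemma card_le_weight {n : ℕ} (w : Fin n → Letter) : n ≤ ∑ i, (w i).weight := by
  calc n = ∑ _i : Fin n, 1 := by simp
    _ ≤ _ := Finset.sum_le_sum fun i _ => Letter.one_le_weight _

lemma coeff_wordSeries_of_lt (F : Diagram → Space 0) {n i : ℕ} (h : i < n) :
    coeff i (wordSeries F (Fin n)) = 0 := by
  rw [coeff_wordSeries]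
  refine Finset.sum_eq_zero fun w _ => if_neg ?_
  have := card_le_weight w
  omega

lemma coeff_wordSeries_commute (m n p q : ℕ) :
    Commute (coeff p (wordSeries connectedSum (Fin m)))
      (coeff q (wordSeries connectedSum (Fin n))) := by
  rw [coeff_wordSeries, coeff_wordSeries]
  refine Commute.sum_left _ _ _ fun w _ => Commute.sum_right _ _ _ fun w' _ => ?_
  split_ifs
  · exact ((connectedSum_commute (fun _ => Letter.balanced_diagram _)
      (fun _ => Letter.balanced_diagram _)).smul_left _).smul_right _
  · exact Commute.zero_right _
  · exact Commute.zero_left _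
  · exact Commute.zero_left _

/-- In a word, the component of a letter is split off; every letter is counted with its
parameter-grade. -/
lemma weight_smul_glueSum {I : Type} [Fintype I] [LinearOrder I] (w : I → Letter) :
    (∑ i, (w i).weight) • ((∏ i, (w i).coeff) • glueSum (big fun i => (w i).diagram)) =
      ∑ S : Finset I, ((∑ i : {i // i ∈ S}, (w i).weight) • ((∏ i : {i // i ∈ S}, (w i).coeff) •
        connectedSum (big fun j : {i // i ∈ S} => (w j).diagram))) *
          ((∏ i : {i // i ∉ S}, (w i).coeff) •
            glueSum (big fun j : {i // i ∉ S} => (w j).diagram)) := by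
  classical
  have h1 : ∀ i, glueSum (big fun i => (w i).diagram) = ∑ S : Finset I, if i ∈ S then
      connectedSum (big fun j : {i // i ∈ S} => (w j).diagram) *
        glueSum (big fun j : {i // i ∉ S} => (w j).diagram) else 0 := by
    intro i
    rw [glueSum_big (fun i => Letter.balanced_diagram (w i))
      (fun i => Letter.connected_diagram (w i)) i, Finset.sum_filter]
  have h2 : ∀ S : Finset I, ∏ i, (w i).coeff =
      (∏ i : {i // i ∈ S}, (w i).coeff) * ∏ i : {i // i ∉ S}, (w i).coeff := by
    intro S
    rw [← Fintype.prod_subtype_mul_prod_subtype (fun i => i ∈ S) fun i => (w i).coeff]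
    congr!
  have h3 : ∀ S : Finset I, ∑ i : {i // i ∈ S}, (w i).weight =
      ∑ i, if i ∈ S then (w i).weight else 0 := by
    intro S
    rw [← Finset.sum_filter, Finset.filter_mem_eq_inter, Finset.univ_inter]
    exact Finset.sum_coe_sort S fun i => (w i).weight
  rw [Finset.sum_smul]
  calc ∑ i, (w i).weight • ((∏ i, (w i).coeff) • glueSum (big fun i => (w i).diagram)) =
      ∑ i, ∑ S : Finset I, (if i ∈ S then (w i).weight else 0) • ((∏ i, (w i).coeff) •
        (connectedSum (big fun j : {i // i ∈ S} => (w j).diagram) *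
          glueSum (big fun j : {i // i ∉ S} => (w j).diagram))) := by
        refine Finset.sum_congr rfl fun i _ => ?_
        rw [h1 i, Finset.smul_sum, Finset.smul_sum]
        refine Finset.sum_congr rfl fun S _ => ?_
        split_ifs
        · rfl
        · rw [zero_smul]
          exact (congrArg _ (smul_zero _)).trans (smul_zero _)
    _ = _ := by
        rw [Finset.sum_comm]
        refine Finset.sum_congr rfl fun S _ => ?_
        rw [← Finset.sum_smul, h3, h2 S, smul_mul_assoc]
        congr 1
        rw [smul_mul_smul_comm]

/-- The exponential formula for the words whose letters are indexed by `I`, in differential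
form. -/
lemma degreeOp_wordSeries (I : Type) [Fintype I] [LinearOrder I] :
    degreeOp (wordSeries glueSum I) = ∑ S : Finset I,
      degreeOp (wordSeries connectedSum {i // i ∈ S}) * wordSeries glueSum {i // i ∉ S} := by
  classical
  rw [wordSeries, map_sum]
  have h1 : ∀ S : Finset I,
      degreeOp (wordSeries connectedSum {i // i ∈ S}) * wordSeries glueSum {i // i ∉ S} =
      ∑ w : I → Letter, monomial (∑ i, (w i).weight)
        (((∑ i : {i // i ∈ S}, (w i).weight) • ((∏ i : {i // i ∈ S}, (w i).coeff) •
        connectedSum (big fun j : {i // i ∈ S} => (w j).diagram))) *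
          ((∏ i : {i // i ∉ S}, (w i).coeff) •
            glueSum (big fun j : {i // i ∉ S} => (w j).diagram))) := by
    intro S
    rw [wordSeries, wordSeries, map_sum, Finset.sum_mul_sum, ← Fintype.sum_prod_type']
    refine (Fintype.sum_equiv (Equiv.piEquivPiSubtypeProd (fun i => i ∈ S) fun _ => Letter) _ _
      fun w => ?_).symm
    have h2 : ∑ i, (w i).weight =
        (∑ i : {i // i ∈ S}, (w i).weight) + ∑ i : {i // i ∉ S}, (w i).weight := by
      rw [← Fintype.sum_subtype_add_sum_subtype (fun i => i ∈ S) fun i => (w i).weight]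
      congr!
    rw [degreeOp_monomial, monomial_mul_monomial, h2]
    rfl
  rw [Finset.sum_congr rfl fun S _ => h1 S, Finset.sum_comm]
  refine Finset.sum_congr rfl fun w _ => ?_
  rw [degreeOp_monomial, weight_smul_glueSum, map_sum]

/-- The letters of a subword may be renumbered, so that the sum over the subsets becomes a sum over
their sizes, weighted by binomial coefficients. -/
lemma degreeOp_wordSeries_fin (n : ℕ) :
    degreeOp ((n.factorial : ℚ)⁻¹ • wordSeries glueSum (Fin n)) =
      ∑ y ∈ Finset.HasAntidiagonal.antidiagonal n,
        degreeOp ((y.1.factorial : ℚ)⁻¹ • wordSeries connectedSum (Fin y.1)) *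
          ((y.2.factorial : ℚ)⁻¹ • wordSeries glueSum (Fin y.2)) := by
  have hs : ∀ (q : ℚ) (f : (Space 0)⟦X⟧), degreeOp (q • f) = q • degreeOp f := fun q f => by
    ext i
    rw [coeff_degreeOp, coeff_smul, coeff_smul, coeff_degreeOp]
    exact smul_comm _ _ _
  have h1 : ∀ S : Finset (Fin n),
      degreeOp (wordSeries connectedSum {i // i ∈ S}) * wordSeries glueSum {i // i ∉ S} =
        degreeOp (wordSeries connectedSum (Fin S.card)) *
          wordSeries glueSum (Fin (n - S.card)) := by
    intro S
    rw [wordSeries_subtype connectedSum_congr (fun i => i ∈ S) (Fintype.card_coe S),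
      wordSeries_subtype glueSum_congr (fun i => i ∉ S) (m := n - S.card) (by
        rw [Fintype.card_subtype_compl, Fintype.card_fin, Fintype.card_coe])]
  rw [hs, degreeOp_wordSeries, Finset.sum_congr rfl fun S _ => h1 S, ← Finset.powerset_univ,
    Finset.sum_powerset_apply_card (fun m => degreeOp (wordSeries connectedSum (Fin m)) *
      wordSeries glueSum (Fin (n - m))), Finset.card_univ, Fintype.card_fin, Finset.smul_sum,
    Finset.Nat.sum_antidiagonal_eq_sum_range_succ
      (fun m r => degreeOp ((m.factorial : ℚ)⁻¹ • wordSeries connectedSum (Fin m)) *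
          ((r.factorial : ℚ)⁻¹ • wordSeries glueSum (Fin r)))]
  refine Finset.sum_congr rfl fun m hm => ?_
  have hm : m ≤ n := by simpa [Nat.lt_succ_iff] using hm
  rw [hs, smul_mul_smul_comm, ← Nat.cast_smul_eq_nsmul ℚ, smul_smul]
  congr 1
  rw [Nat.cast_choose ℚ hm]
  have h1 := Nat.factorial_ne_zero n
  have h2 := Nat.factorial_ne_zero m
  have h3 := Nat.factorial_ne_zero (n - m)
  field_simp

end

/-! ### Power series of diagrams -/

section

open PowerSeries

lemma cls_empty (κ : ℚ) : cls κ Diagram.empty = 1 :=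
  (congrArg (RingQuot.mkAlgHom ℚ (Rel κ))
    (map_one (MonoidAlgebra.of ℚ IsoClass) : formal Diagram.empty = 1)).trans (map_one _)

lemma glueSum_empty : glueSum Diagram.empty = 1 := by
  have h : ∀ P : Diagram.empty.Pairing, P = Pairing.empty Diagram.empty := fun P =>
    Pairing.ext_mem fun x => isEmptyElim x
  have h1 : (Pairing.empty Diagram.empty).coeff = 1 := by
    have h2 : (Pairing.empty Diagram.empty).crossings = 0 := by
      unfold Pairing.crossings
      rw [Nat.card_eq_zero.2 (Or.inl ⟨fun x => isEmptyElim x.1.1⟩),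
        Nat.card_eq_zero.2 (Or.inl ⟨fun x => isEmptyElim x.1.1⟩)]
    rw [Pairing.coeff, h2]
    simp [Pairing.empty]
  rw [glueSum, Fintype.sum_eq_single (Pairing.empty Diagram.empty) fun P hP => absurd (h P) hP,
    glueTerm, h1, one_smul, ← cls_congr 0 (glueEmpty _), cls_empty]

lemma wordSeries_glueSum_zero : wordSeries glueSum (Fin 0) = 1 := by
  have h : glueSum (big fun i => ((default : Fin 0 → Letter) i).diagram) = 1 := by
    rw [← glueSum_congr (wordIso _)]
    exact glueSum_empty
  rw [wordSeries, Fintype.sum_unique, h]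
  simp

lemma wordSeries_connectedSum_zero : wordSeries connectedSum (Fin 0) = 0 := by
  classical
  have h : connectedSum (big fun i => ((default : Fin 0 → Letter) i).diagram) = 0 := by
    rw [connectedSum]
    refine Finset.sum_eq_zero fun P hP => ?_
    obtain ⟨⟨i⟩, _⟩ := (connected_glue_big
      (fun i : Fin 0 => Letter.connected_diagram _) P).1 (Finset.mem_filter.1 hP).2
    exact i.elim0
  rw [wordSeries, Fintype.sum_unique, h]
  simp

/-- The exponential formula for words. -/
lemma sum_glueSum_eq_exp (i : ℕ) :
    ∑ n ∈ Finset.range (i + 1), ((n.factorial : ℚ)⁻¹ • coeff i (wordSeries glueSum (Fin n))) =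
      ∑ k ∈ Finset.range (i + 1), ((k.factorial : ℚ)⁻¹ • coeff i
        ((PowerSeries.mk fun j => ∑ m ∈ Finset.range (j + 1),
          ((m.factorial : ℚ)⁻¹ • coeff j (wordSeries connectedSum (Fin m)))) ^ k)) := by
  refine exp_of_degreeOp_eq
    (c := fun m => (m.factorial : ℚ)⁻¹ • wordSeries connectedSum (Fin m))
    (z := fun n => (n.factorial : ℚ)⁻¹ • wordSeries glueSum (Fin n)) (fun m p h => ?_)
    (fun m p h => ?_) ?_ ?_ (fun m n p q => ?_) degreeOp_wordSeries_fin i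
  · rw [coeff_smul, coeff_wordSeries_of_lt _ h]
    exact smul_zero _
  · rw [coeff_smul, coeff_wordSeries_of_lt _ h]
    exact smul_zero _
  · rw [wordSeries_connectedSum_zero]
    exact smul_zero _
  · rw [wordSeries_glueSum_zero]
    simp
  · rw [coeff_smul, coeff_smul]
    exact ((coeff_wordSeries_commute m n p q).smul_left _).smul_right _

namespace Series

variable {κ : ℚ}

lemma coe_of (D : Diagram) (t : ℕ × ℕ) [Decidable (D.bidegree = t)] :
    (of κ D t : Space κ) = if D.bidegree = t then cls κ D else 0 := by
  split_ifs with h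
  · subst h
    rw [of, Pi.single_eq_same]
  · rw [of, Pi.single_eq_of_ne (Ne.symm h)]
    rfl

/-- A series is purely parametric if it has no part of operator-grade different from zero and no
part of parameter-grade zero. -/
def IsParametric (x : Series κ) : Prop := ∀ t, t.1 = 0 ∨ t.2 ≠ 0 → x t = 0

/-- The part of operator-grade zero, as a power series in one variable, whose exponent is the
parameter-grade. -/
def toPowerSeries (x : Series κ) : (Space κ)⟦X⟧ := PowerSeries.mk fun i => (x (i, 0) : Space κ)

lemma sharpPow_eq_zero {x : Series κ} (hx : x.IsParametric) {n : ℕ} {t : ℕ × ℕ}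
    (h : t.1 < n ∨ t.2 ≠ 0) : sharpPow x n t = 0 := by
  classical
  induction n generalizing t with
  | zero =>
    have ht : t.2 ≠ 0 := by simpa using h
    apply Subtype.ext
    rw [sharpPow, coe_of, if_neg]
    · rfl
    · rintro rfl
      exact ht (congrArg Prod.snd (bidegree_wordDiagram []))
  | succ n ih =>
    apply Subtype.ext
    rw [sharpPow, sharp]
    refine Finset.sum_eq_zero fun p hp => ?_
    obtain ⟨h1, h2⟩ := Finset.mem_product.1 hp
    have h1 := Finset.HasAntidiagonal.mem_antidiagonal.1 h1
    have h2 := Finset.HasAntidiagonal.mem_antidiagonal.1 h2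
    by_cases h3 : p.1.1 < n ∨ p.2.1 ≠ 0
    · have := ih (t := (p.1.1, p.2.1)) h3
      rw [this]
      exact zero_mul _
    · have := hx (p.1.2, p.2.2) (by dsimp only; omega)
      rw [this]
      exact mul_zero _

lemma coe_sharp (x y : Series κ) (i : ℕ) :
    (sharp x y (i, 0) : Space κ) = coeff i (x.toPowerSeries * y.toPowerSeries) := by
  rw [coeff_mul, sharp]
  simp only [Finset.Nat.antidiagonal_zero, Finset.product_singleton, Finset.sum_map,
    Function.Embedding.coeFn_mk, toPowerSeries, coeff_mk]

lemma coe_sharpPow (x : Series κ) (n i : ℕ) :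
    (sharpPow x n (i, 0) : Space κ) = coeff i (x.toPowerSeries ^ n) := by
  classical
  induction n generalizing i with
  | zero =>
    rw [sharpPow, coe_of, pow_zero, coeff_one, cls_empty]
    have h : Diagram.empty.bidegree = (0, 0) := bidegree_wordDiagram []
    rw [h]
    simp [eq_comm]
  | succ n ih =>
    have h : toPowerSeries (sharpPow x n) = x.toPowerSeries ^ n := by
      ext i
      rw [toPowerSeries, coeff_mk, ih]
    rw [sharpPow, coe_sharp, h, pow_succ]

lemma expTerm_eq_zero {x : Series κ} (hx : x.IsParametric) {n : ℕ} {t : ℕ × ℕ}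
    (h : t.1 < n ∨ t.2 ≠ 0) : expTerm x n t = 0 := by
  have h1 : expTerm x n t = (n.factorial : ℚ)⁻¹ • sharpPow x n t := rfl
  rw [h1, sharpPow_eq_zero hx h]
  exact smul_zero _

lemma familySummable_expTerm {x : Series κ} (hx : x.IsParametric) :
    FamilySummable (expTerm x) := by
  intro t
  refine (Finset.finite_toSet (Finset.range (t.1 + 1))).subset fun n hn => ?_
  by_contra h
  refine hn (expTerm_eq_zero hx (Or.inl ?_))
  simp only [Finset.coe_range, Set.mem_Iio] at h
  omega

lemma expSharp_eq_zero {x : Series κ} (hx : x.IsParametric) {t : ℕ × ℕ} (h : t.2 ≠ 0) :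
    expSharp x t = 0 :=
  (finsum_congr fun _ => expTerm_eq_zero hx (Or.inr h)).trans finsum_zero

lemma expSharp_eq_sum {x : Series κ} (hx : x.IsParametric) (i : ℕ) :
    expSharp x (i, 0) = ∑ n ∈ Finset.range (i + 1), expTerm x n (i, 0) := by
  refine finsum_eq_sum_of_support_subset _ fun n hn => ?_
  by_contra h
  refine hn (expTerm_eq_zero hx (Or.inl ?_))
  simp only [Finset.coe_range, Set.mem_Iio] at h
  dsimp only
  omega

lemma coe_expTerm (x : Series κ) (n i : ℕ) : (expTerm x n (i, 0) : Space κ) =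
    (n.factorial : ℚ)⁻¹ • coeff i (x.toPowerSeries ^ n) := by
  rw [← coe_sharpPow]
  rfl

end Series

/-- The powers of the sum of the symbols are the sums over the words. -/
lemma sum_letter_pow (κ : ℚ) (n : ℕ) :
    (∑ x : Letter, monomial x.weight (x.coeff • cls κ x.diagram)) ^ n =
      ∑ w : Fin n → Letter, monomial (∑ i, (w i).weight)
        ((∏ i, (w i).coeff) • cls κ (wordDiagram (List.ofFn w))) := by
  induction n with
  | zero =>
    rw [pow_zero, Fintype.sum_unique, List.ofFn_zero, wordDiagram, cls_empty]
    simp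
  | succ n ih =>
    rw [pow_succ', ih, Finset.sum_mul_sum, ← Fintype.sum_prod_type']
    refine Fintype.sum_equiv (Fin.consEquiv fun _ => Letter) _ _ fun x => ?_
    have h : List.ofFn (Fin.consEquiv (fun _ => Letter) x : Fin (n + 1) → Letter) =
        x.1 :: List.ofFn x.2 := List.ofFn_cons _ _
    rw [h, wordDiagram, ← cls_mul, Fin.sum_univ_succ, Fin.prod_univ_succ, monomial_mul_monomial,
      smul_mul_smul_comm]
    rfl

lemma gluingMap_coeff_pow (n i : ℕ) :
    gluingMap (coeff i ((∑ x : Letter, monomial x.weight (x.coeff • cls 1 x.diagram)) ^ n)) =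
      coeff i (wordSeries glueSum (Fin n)) := by
  rw [sum_letter_pow, coeff_wordSeries, map_sum, map_sum]
  refine Finset.sum_congr rfl fun w _ => ?_
  rw [coeff_monomial]
  by_cases h : i = ∑ i, (w i).weight
  · rw [if_pos h, if_pos h.symm, map_smul, gluingMap_cls, glueSum_congr (wordIso w)]
  · rw [if_neg h, if_neg (Ne.symm h), map_zero]

/-- The series `A + B` has parts of positive parameter-grade and operator-grade zero only. -/
lemma isParametric_letters : Series.IsParametric
    ((1 / 2 : ℚ) • Series.of 1 tripod + Series.of 1 strut) := by
  classical
  intro t ht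
  have hA : tripod.bidegree = (2, 0) := Letter.bidegree_diagram Letter.A
  have hB : strut.bidegree = (1, 0) := Letter.bidegree_diagram Letter.B
  apply Subtype.ext
  change (1 / 2 : ℚ) • (Series.of 1 tripod t : Space 1) + (Series.of 1 strut t : Space 1) = 0
  rw [Series.coe_of, Series.coe_of, hA, hB, if_neg, if_neg, add_zero]
  · exact smul_zero _
  · rintro rfl; simp at ht
  · rintro rfl; simp at ht

lemma toPowerSeries_letters :
    Series.toPowerSeries ((1 / 2 : ℚ) • Series.of 1 tripod + Series.of 1 strut) =
      ∑ x : Letter, monomial x.weight (x.coeff • cls 1 x.diagram) := by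
  classical
  have hA : tripod.bidegree = (2, 0) := Letter.bidegree_diagram Letter.A
  have hB : strut.bidegree = (1, 0) := Letter.bidegree_diagram Letter.B
  ext i
  rw [Letter.sum_univ, map_add, coeff_monomial, coeff_monomial, Series.toPowerSeries, coeff_mk]
  change (1 / 2 : ℚ) • (Series.of 1 tripod (i, 0) : Space 1) +
    (Series.of 1 strut (i, 0) : Space 1) = _
  rw [Series.coe_of, Series.coe_of, hA, hB]
  congr 1
  · by_cases h : i = 2
    · subst h; rfl
    · rw [if_neg (by simpa using Ne.symm h)]
      exact (smul_zero _).trans (if_neg h).symm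
  · by_cases h : i = 1
    · subst h
      exact (one_smul ℚ _).symm
    · rw [if_neg (by simpa using Ne.symm h)]
      exact (if_neg h).symm

end

/-! ### The sum over the connected types -/

section

open PowerSeries

/-- The gluings of a word of length `n` to a connected diagram. -/
abbrev WordGluing (n : ℕ) : Type :=
  Σ w : Fin n → Letter, {P : (wordDiagram (List.ofFn w)).Pairing //
    ((wordDiagram (List.ofFn w)).glue P).Connected}

open Classical in
instance (n : ℕ) : Fintype (WordGluing n) :=
  inferInstanceAs (Fintype (Σ w : Fin n → Letter, {P : (wordDiagram (List.ofFn w)).Pairing //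
    ((wordDiagram (List.ofFn w)).glue P).Connected}))

/-- A connected type, given by a word of length `n` that is indexed by `Fin n`. -/
def WordGluing.toConnectedType (x : Σ n, WordGluing n) : ConnectedType :=
  ⟨⟨List.ofFn x.2.1, by
    intro h
    obtain ⟨⟨e⟩, _⟩ := x.2.2.2
    induction e using Quot.ind with | mk e => ?_
    rw [h] at e
    exact Empty.elim e, x.2.2.1⟩, x.2.2.2⟩

lemma WordGluing.toConnectedType_bijective :
    Function.Bijective WordGluing.toConnectedType := by
  constructor
  · rintro ⟨n, w, P, hP⟩ ⟨n', w', P', hP'⟩ h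
    have h1 : List.ofFn w = List.ofFn w' := congrArg (fun τ => τ.1.word) h
    have h2 := List.ofFn_inj'.1 h1
    obtain rfl : n = n' := congrArg Sigma.fst h2
    obtain rfl : w = w' := eq_of_heq (Sigma.mk.inj h2).2
    have h3 := congrArg Subtype.val h
    simp only [WordGluing.toConnectedType, GluingType.mk.injEq, heq_eq_eq, true_and] at h3
    subst h3
    rfl
  · rintro ⟨⟨word, hw, P⟩, hP⟩
    obtain ⟨⟨n, w⟩, rfl⟩ := List.equivSigmaTuple.symm.surjective word
    exact ⟨⟨n, w, P, hP⟩, rfl⟩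

open Classical in
/-- The contribution of a connected gluing to the part of a given type. -/
lemma coe_term (n : ℕ) (x : WordGluing n) (t : ℕ × ℕ) :
    ((((WordGluing.toConnectedType ⟨n, x⟩).1.length.factorial : ℚ)⁻¹ •
      (WordGluing.toConnectedType ⟨n, x⟩).1.term) t : Space 0) =
        if (∑ i, (x.1 i).weight, 0) = t then
          (n.factorial : ℚ)⁻¹ • ((∏ i, (x.1 i).coeff) • glueTerm x.2.1) else 0 := by
  obtain ⟨w, P, hP⟩ := x
  have h1 : (WordGluing.toConnectedType ⟨n, w, P, hP⟩).1.length = n := List.length_ofFn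
  have h2 : ((wordDiagram (List.ofFn w)).glue P).bidegree = (∑ i, (w i).weight, 0) := by
    rw [bidegree_glue, bidegree_wordDiagram, List.map_ofFn, List.sum_ofFn]
    rfl
  have h3 : ((List.ofFn w).map Letter.coeff).prod = ∏ i, (w i).coeff := by
    rw [List.map_ofFn, List.prod_ofFn]
    rfl
  rw [h1]
  change (n.factorial : ℚ)⁻¹ • ((((List.ofFn w).map Letter.coeff).prod * P.coeff) •
    (Series.of 0 ((wordDiagram (List.ofFn w)).glue P) t : Space 0)) = _
  rw [Series.coe_of, h2, h3]
  split_ifs with h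
  · rw [glueTerm, smul_smul (∏ i, (w i).coeff)]
  · exact (congrArg _ (smul_zero _)).trans (smul_zero _)

lemma term_eq_zero {n : ℕ} (x : WordGluing n) {t : ℕ × ℕ} (h : t.1 < n ∨ t.2 ≠ 0) :
    (((WordGluing.toConnectedType ⟨n, x⟩).1.length.factorial : ℚ)⁻¹ •
      (WordGluing.toConnectedType ⟨n, x⟩).1.term) t = 0 := by
  classical
  apply Subtype.ext
  rw [coe_term, if_neg]
  · rfl
  · rintro rfl
    have := card_le_weight x.1
    simp only [ne_eq, not_true_eq_false, or_false] at h
    omega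

lemma support_term_subset (t : ℕ × ℕ) :
    Function.support (fun x : Σ n, WordGluing n =>
      (((WordGluing.toConnectedType x).1.length.factorial : ℚ)⁻¹ •
        (WordGluing.toConnectedType x).1.term) t) ⊆
      ((Finset.range (t.1 + 1)).sigma fun n => (Finset.univ : Finset (WordGluing n))) := by
  rintro ⟨n, x⟩ hx
  have h : ¬ t.1 < n := fun h => hx (term_eq_zero x (Or.inl h))
  simp only [Finset.coe_sigma, Set.mem_sigma_iff, Finset.coe_range, Set.mem_Iio]
  exact ⟨by omega, by simp⟩

lemma familySummable_term : Series.FamilySummable (fun τ : ConnectedType =>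
    (τ.1.length.factorial : ℚ)⁻¹ • τ.1.term) := by
  intro t
  refine (((Finset.finite_toSet _).subset (support_term_subset t)).image
    WordGluing.toConnectedType).subset ?_
  rintro τ hτ
  obtain ⟨x, rfl⟩ := WordGluing.toConnectedType_bijective.2 τ
  exact ⟨x, hτ, rfl⟩

lemma familySum_term (t : ℕ × ℕ) : Series.familySum (fun τ : ConnectedType =>
    (τ.1.length.factorial : ℚ)⁻¹ • τ.1.term) t =
      ∑ n ∈ Finset.range (t.1 + 1), ∑ x : WordGluing n,
        (((WordGluing.toConnectedType ⟨n, x⟩).1.length.factorial : ℚ)⁻¹ •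
          (WordGluing.toConnectedType ⟨n, x⟩).1.term) t := by
  rw [Series.familySum, ← finsum_comp _ WordGluing.toConnectedType_bijective,
    finsum_eq_sum_of_support_subset _ (support_term_subset t), Finset.sum_sigma]

lemma isParametric_familySum : Series.IsParametric (Series.familySum (fun τ : ConnectedType =>
    (τ.1.length.factorial : ℚ)⁻¹ • τ.1.term)) := by
  intro t ht
  rw [familySum_term]
  refine Finset.sum_eq_zero fun n hn => Finset.sum_eq_zero fun x _ => ?_
  by_cases hn0 : n = 0
  · subst hn0
    exact absurd (List.ofFn_zero (f := x.1)) (WordGluing.toConnectedType ⟨0, x⟩).1.word_ne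
  · refine term_eq_zero x (ht.imp_left fun h => ?_)
    omega

/-- The connected pairings of words, sorted by the length of the word. As every letter has positive
parameter-grade, only words of length at most `j` contribute in degree `j`. -/
lemma toPowerSeries_familySum : Series.toPowerSeries (Series.familySum (fun τ : ConnectedType =>
    (τ.1.length.factorial : ℚ)⁻¹ • τ.1.term)) =
      PowerSeries.mk fun j => ∑ m ∈ Finset.range (j + 1),
        ((m.factorial : ℚ)⁻¹ • coeff j (wordSeries connectedSum (Fin m))) := by
  classical
  ext j
  rw [Series.toPowerSeries, coeff_mk, coeff_mk, familySum_term, Submodule.coe_sum]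
  refine Finset.sum_congr rfl fun n _ => ?_
  rw [Submodule.coe_sum, Finset.sum_congr rfl fun x _ => coe_term n x (j, 0), Fintype.sum_sigma,
    coeff_wordSeries, Finset.smul_sum]
  refine Finset.sum_congr rfl fun w _ => ?_
  by_cases h : ∑ i, (w i).weight = j
  · rw [if_pos h, ← connectedSum_congr (wordIso w), connectedSum, Finset.smul_sum,
      Finset.smul_sum, ← Finset.sum_subtype_eq_sum_filter]
    refine Finset.sum_congr (by ext; simp) fun P _ => ?_
    rw [if_pos (by rw [h])]
  · rw [if_neg h]
    refine (Finset.sum_eq_zero fun P _ => ?_).trans (smul_zero _).symm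
    rw [if_neg (by simpa using h)]

end

end Weil

end

theorem mainTheorem5 :
    (∃! lam : ∀ t : ℕ × ℕ, Weil.piece 1 t →ₗ[ℚ] Weil.piece 0 t, Weil.IsLambda lam) ∧
    ∀ lam : ∀ t : ℕ × ℕ, Weil.piece 1 t →ₗ[ℚ] Weil.piece 0 t, Weil.IsLambda lam →
      Weil.Series.FamilySummable (Weil.Series.expTerm
        ((1 / 2 : ℚ) • Weil.Series.of 1 Weil.tripod + Weil.Series.of 1 Weil.strut)) ∧
      Weil.Series.FamilySummable (fun τ : Weil.ConnectedType =>
        (τ.1.length.factorial : ℚ)⁻¹ • τ.1.term) ∧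
      Weil.Series.FamilySummable (Weil.Series.expTerm (Weil.Series.familySum
        (fun τ : Weil.ConnectedType => (τ.1.length.factorial : ℚ)⁻¹ • τ.1.term))) ∧
      Weil.onSeries lam (Weil.Series.expSharp
          ((1 / 2 : ℚ) • Weil.Series.of 1 Weil.tripod + Weil.Series.of 1 Weil.strut)) =
        Weil.Series.expSharp (Weil.Series.familySum
          (fun τ : Weil.ConnectedType => (τ.1.length.factorial : ℚ)⁻¹ • τ.1.term)) := by
  refine ⟨Weil.existsUnique_isLambda, fun lam hlam =>
    ⟨Weil.Series.familySummable_expTerm Weil.isParametric_letters, Weil.familySummable_term,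
      Weil.Series.familySummable_expTerm Weil.isParametric_familySum, ?_⟩⟩
  funext t
  obtain ⟨i, j⟩ := t
  by_cases hj : j = 0
  · subst hj
    apply Subtype.ext
    rw [Weil.onSeries, hlam.apply_eq, Weil.Series.expSharp_eq_sum Weil.isParametric_letters,
      Weil.Series.expSharp_eq_sum Weil.isParametric_familySum, Submodule.coe_sum,
      Submodule.coe_sum, map_sum]
    simp only [Weil.Series.coe_expTerm, map_smul, Weil.toPowerSeries_letters,
      Weil.gluingMap_coeff_pow, Weil.toPowerSeries_familySum]
    exact Weil.sum_glueSum_eq_exp i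
  · rw [Weil.onSeries, Weil.Series.expSharp_eq_zero Weil.isParametric_letters hj, map_zero,
      Weil.Series.expSharp_eq_zero Weil.isParametric_familySum hj]
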